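/- For integer sequences $X,Y$ let $\mathrm{lcis}(X,Y)$ be the length of a longest strictly increasing sequence that is a subsequence of both $X$ and $Y$; the LCIS problem is to compute $\mathrm{lcis}(X,Y)$. A branching program of width $W$ and length $T\ge 1$ on $N$ Boolean variables $x_1,\dots,x_N$ is a directed acyclic graph on $W\cdot T$ nodes, arranged in $T$ layers of $W$ nodes each, with a start node in the first and an accept node in the last layer. Edges go from a layer to the next one only, and for every layer other than the last there is a variable $x_i$ such that every edge leaving this layer is labelled with a constraint $x_i=0$ or $x_i=1$. The program accepts $x\in\{0,1\}^N$ if there is a path from the start node to the accept node all of whose edges carry constraints satisfied by $x$; it is satisfiable if it accepts some $x$. Branching programs are given by listing, for every layer other than the last, its variable and the table of its labelled edges. Algorithms are deterministic programs on a word RAM (unit cost per instruction). For LCIS on sequences of length at most $n$ with entries of absolute value at most $M$, words have $O(\log(n+M))$ bits; for branching programs on $N$ variables, words have $O(N+1)$ bits. **Theorem.** Suppose that LCIS has a strongly subquadratic algorithm, i.e., that for some $\varepsilon>0$ there is an algorithm that computes $\mathrm{lcis}(X,Y)$ for all integer sequences $X,Y$ of length at most $n$ in time $O(n^{2-\varepsilon})$.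 Then there are $\varepsilon'$ with $0<\varepsilon'<2$ and an algorithm that, for all functions $W=W(N)$ and $T=T(N)$ with $(\log W)(\log T)=o(N)$, decides in time $O((2-\varepsilon')^N)$ whether a given branching program of width $W(N)$ and length $T(N)$ on $N$ variables is satisfiable. Here, in the condition $(\log W)(\log T)=o(N)$, a value $1$ of $W$ or $T$ is read as $2$; the constants in the bounds on time and word size for branching programs may depend on the functions $W$ and $T$. -/

import Mathlib

open Filter Asymptotics

/-! ### Longest common increasing subsequences -/

/-- `Z` is a strictly increasing common subsequence of `X` and `Y`. -/
def IsCommonIncSubseq (X Y Z : List ℤ) : Prop :=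
  Z.Sublist X ∧ Z.Sublist Y ∧ Z.Pairwise (· < ·)

/-- The length of a longest common strictly increasing subsequence of `X` and `Y`. -/
noncomputable def lcis (X Y : List ℤ) : ℕ :=
  sSup {k : ℕ | ∃ Z : List ℤ, IsCommonIncSubseq X Y Z ∧ Z.length = k}

/-- The supremum in the definition of `lcis` is a maximum. -/
theorem lcis_isGreatest (X Y : List ℤ) :
    IsGreatest {k : ℕ | ∃ Z : List ℤ, IsCommonIncSubseq X Y Z ∧ Z.length = k} (lcis X Y) := by
  have hne : {k : ℕ | ∃ Z : List ℤ, IsCommonIncSubseq X Y Z ∧ Z.length = k}.Nonempty :=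
    ⟨0, [], ⟨List.nil_sublist _, List.nil_sublist _, List.Pairwise.nil⟩, rfl⟩
  have hb : BddAbove {k : ℕ | ∃ Z : List ℤ, IsCommonIncSubseq X Y Z ∧ Z.length = k} := by
    refine ⟨X.length, ?_⟩
    rintro k ⟨Z, hZ, rfl⟩
    exact hZ.1.length_le
  exact ⟨Nat.sSup_mem hne hb, fun k hk => le_csSup hb hk⟩

/-! ### The word RAM

Programs are finite structured programs over registers (named by natural numbers, finitely many
occur in a program) and a random access memory. A word of size `w` is a signed integer of absolute
value less than `2 ^ w`. Each instruction and each test of a conditional or of a loop takes one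
step. A computation in which a value does not fit into a word is not an execution, so a program
that runs successfully with words of size `w` runs in the same way with larger words. -/

namespace WordRAM

/-- Binary operations on words: arithmetic, bitwise logic and shifts. -/
inductive Op where
  | add | sub | mul | div | mod | and | or | xor | shl | shr

/-- The value of a binary operation; division and remainder are Euclidean (with `a / 0 = 0`),
bitwise operations are those of two's complement, a negative shift amount counts as `0`. -/
def Op.eval : Op → ℤ → ℤ → ℤ
  | .add, a, b => a + b
  | .sub, a, b => a - b
  | .mul, a, b => a * b
  | .div, a, b => a / b
  | .mod, a, b => a % b
  | .and, a, b => Int.land a b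
  | .or, a, b => Int.lor a b
  | .xor, a, b => Int.xor a b
  | .shl, a, b => a * 2 ^ b.toNat
  | .shr, a, b => a / 2 ^ b.toNat

/-- Programs of the word RAM. -/
inductive Prog where
  /-- do nothing -/
  | skip
  /-- `reg r := z` for a constant `z` -/
  | const (r : ℕ) (z : ℤ)
  /-- `reg r := o (reg a) (reg b)` -/
  | op (o : Op) (r a b : ℕ)
  /-- `reg r := mem (reg a)` -/
  | load (r a : ℕ)
  /-- `mem (reg a) := reg r` -/
  | store (a r : ℕ)
  /-- first `p`, then `q` -/
  | seq (p q : Prog)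
  /-- if `reg a < reg b` then `p` else `q` -/
  | ifLt (a b : ℕ) (p q : Prog)
  /-- while `reg a < reg b` do `p` -/
  | whileLt (a b : ℕ) (p : Prog)

/-- The state of the machine: contents of the registers and of the memory cells, where the memory
is addressed by (signed) words. -/
@[ext] structure State where
  reg : ℕ → ℤ
  mem : ℤ → ℤ

/-- Write `v` into register `r`. -/
def State.setReg (s : State) (r : ℕ) (v : ℤ) : State :=
  { s with reg := Function.update s.reg r v }

/-- Write `v` into the memory cell with address `a`. -/
def State.setMem (s : State) (a v : ℤ) : State :=
  { s with mem := Function.update s.mem a v }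

/-- `v` fits into a word of size `w`. -/
def Fits (w : ℕ) (v : ℤ) : Prop := |v| < 2 ^ w

/-- `Exec w p s t s'`: with words of size `w`, program `p` started in state `s` halts after exactly
`t` steps in state `s'`. -/
inductive Exec (w : ℕ) : Prog → State → ℕ → State → Prop where
  | skip (s : State) : Exec w .skip s 1 s
  | const (s : State) (r : ℕ) (z : ℤ) (hz : Fits w z) :
      Exec w (.const r z) s 1 (s.setReg r z)
  | op (s : State) (o : Op) (r a b : ℕ) (hv : Fits w (o.eval (s.reg a) (s.reg b))) :
      Exec w (.op o r a b) s 1 (s.setReg r (o.eval (s.reg a) (s.reg b)))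
  | load (s : State) (r a : ℕ) (hv : Fits w (s.mem (s.reg a))) :
      Exec w (.load r a) s 1 (s.setReg r (s.mem (s.reg a)))
  | store (s : State) (a r : ℕ) :
      Exec w (.store a r) s 1 (s.setMem (s.reg a) (s.reg r))
  | seq {p q : Prog} {s s₁ s₂ : State} {t₁ t₂ : ℕ} (hp : Exec w p s t₁ s₁)
      (hq : Exec w q s₁ t₂ s₂) : Exec w (.seq p q) s (t₁ + t₂) s₂
  | if_true {a b : ℕ} {p q : Prog} {s s' : State} {t : ℕ} (hab : s.reg a < s.reg b)
      (hp : Exec w p s t s') : Exec w (.ifLt a b p q) s (t + 1) s'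
  | if_false {a b : ℕ} {p q : Prog} {s s' : State} {t : ℕ} (hab : ¬ s.reg a < s.reg b)
      (hq : Exec w q s t s') : Exec w (.ifLt a b p q) s (t + 1) s'
  | while_true {a b : ℕ} {p : Prog} {s s₁ s₂ : State} {t₁ t₂ : ℕ} (hab : s.reg a < s.reg b)
      (hp : Exec w p s t₁ s₁) (hq : Exec w (.whileLt a b p) s₁ t₂ s₂) :
      Exec w (.whileLt a b p) s (t₁ + t₂ + 1) s₂
  | while_false {a b : ℕ} {p : Prog} {s : State} (hab : ¬ s.reg a < s.reg b) :
      Exec w (.whileLt a b p) s 1 s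

/-- The initial state on input `l`: the entries of `l` are in the memory cells `0, 1, 2, …`, all
other cells and all registers are `0`. -/
def initState (l : List ℤ) : State where
  reg := fun _ => 0
  mem := fun a => if 0 ≤ a then l.getD a.toNat 0 else 0

/-- With words of size `w`, program `p` on input `l` halts after at most `τ` steps and outputs `v`
in register `0`. -/
def Computes (w : ℕ) (p : Prog) (l : List ℤ) (τ : ℝ) (v : ℤ) : Prop :=
  ∃ (t : ℕ) (s : State), Exec w p (initState l) t s ∧ (t : ℝ) ≤ τ ∧ s.reg 0 = v

end WordRAM

/-- An instance of LCIS in memory: the two lengths, followed by the two sequences. -/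
def encodeLCIS (X Y : List ℤ) : List ℤ :=
  (X.length : ℤ) :: (Y.length : ℤ) :: (X ++ Y)

/-- `p` solves LCIS in time `O(f n)`, where `n` bounds the lengths of the two integer sequences.
If `M` bounds the absolute values of the entries, words of `O(log (n + M))` bits are used, so that
the entries and the positions in the sequences fit into words. -/
def SolvesLCISInTime (p : WordRAM.Prog) (f : ℕ → ℝ) : Prop :=
  ∃ (C : ℝ) (c : ℕ), ∀ (n M : ℕ) (X Y : List ℤ), 1 ≤ n → X.length ≤ n → Y.length ≤ n →
    (∀ x ∈ X, |x| ≤ (M : ℤ)) → (∀ y ∈ Y, |y| ≤ (M : ℤ)) →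
    WordRAM.Computes (c * (Nat.log 2 (n + M) + 1)) p (encodeLCIS X Y) (C * f n) (lcis X Y)

/-! ### Branching programs -/

/-- A (nondeterministic) branching program of width `W` and length `T` on `N` Boolean variables:
`T` layers of `W` nodes each; the edges leaving layer `k` lead to layer `k + 1` and are labelled
with constraints on one variable `var k`. The node `u` of layer `k` has an edge labelled
`var k = b` to node `v` of layer `k + 1` if `edge k u v b = true`. -/
structure BranchingProgram (N W T : ℕ) where
  /-- there is a first and a last layer -/
  length_pos : 0 < T
  /-- the start node, in the first layer -/
  start : Fin W
  /-- the accept node, in the last layer -/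
  accept : Fin W
  /-- the variable queried by the edges leaving a layer other than the last one -/
  var : Fin (T - 1) → Fin N
  /-- the labelled edges from each layer to the next -/
  edge : Fin (T - 1) → Fin W → Fin W → Bool → Bool

namespace BranchingProgram

variable {N W T : ℕ}

/-- There is a path `π` (`π k` is its node in layer `k`) from the start node to the accept node all
of whose edges carry constraints satisfied by `x`. -/
def Accepts (G : BranchingProgram N W T) (x : Fin N → Bool) : Prop :=
  ∃ π : Fin T → Fin W,
    π ⟨0, G.length_pos⟩ = G.start ∧
    π ⟨T - 1, Nat.sub_lt G.length_pos Nat.one_pos⟩ = G.accept ∧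
    ∀ k : Fin (T - 1),
      G.edge k (π ⟨k, by omega⟩) (π ⟨k + 1, by omega⟩) (x (G.var k)) = true

/-- Some assignment is accepted. -/
def Satisfiable (G : BranchingProgram N W T) : Prop :=
  ∃ x : Fin N → Bool, G.Accepts x

/-- A branching program in memory: `N`, `W`, `T`, the start and the accept node, and then for every
layer but the last one its variable followed by its `W × W` table of edges, with two entries
(`0` or `1`) per pair of nodes, for the constraints "variable `= 0`" and "variable `= 1`". -/
def encode (G : BranchingProgram N W T) : List ℤ :=
  [(N : ℤ), (W : ℤ), (T : ℤ), ((G.start : ℕ) : ℤ), ((G.accept : ℕ) : ℤ)] ++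
    (List.ofFn fun k : Fin (T - 1) =>
      ((G.var k : ℕ) : ℤ) ::
        (List.ofFn fun u : Fin W =>
          (List.ofFn fun v : Fin W =>
            [((G.edge k u v false).toNat : ℤ), ((G.edge k u v true).toNat : ℤ)]).flatten).flatten
      ).flatten

end BranchingProgram

open Classical in
/-- `p` decides, in time `O(f N)` and with words of `O(N + 1)` bits, the satisfiability of branching
programs of width `W N` and length `T N` on `N` variables (output `1` for satisfiable ones and `0`
for the others). The constants may depend on the functions `W` and `T`. -/
def SolvesBPSATInTime (p : WordRAM.Prog) (W T : ℕ → ℕ) (f : ℕ → ℝ) : Prop :=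
  ∃ (C : ℝ) (c : ℕ), ∀ (N : ℕ) (G : BranchingProgram N (W N) (T N)),
    WordRAM.Computes (c * (N + 1)) p G.encode (C * f N) (if G.Satisfiable then 1 else 0)

/-- `(log W) (log T) = o(N)`. A width or length of `1` is counted as `2` here, so that the condition
also bounds the other parameter. -/
def LogProductLittleO (W T : ℕ → ℕ) : Prop :=
  (fun N : ℕ => Real.logb 2 (max (W N) 2 : ℕ) * Real.logb 2 (max (T N) 2 : ℕ))
    =o[atTop] (fun N : ℕ => (N : ℝ))

namespace WordRAM

/-! ### A language with expressions, compiled to the word RAM -/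

/-- Operations that do not increase the bit length beyond the total bit length of the operands. -/
def Op.tame : Op → Bool
  | .add | .sub | .mul | .div | .mod | .shr => true
  | _ => false

/-- Expressions over registers and memory. -/
inductive Expr where
  | reg (r : ℕ)
  | lit (z : ℤ)
  | bin (o : Op) (a b : Expr)
  | deref (a : Expr)

namespace Expr

def eval (s : State) : Expr → ℤ
  | reg r => s.reg r
  | lit z => z
  | bin o a b => o.eval (a.eval s) (b.eval s)
  | deref a => s.mem (a.eval s)

def size : Expr → ℕ
  | reg _ => 1
  | lit _ => 1
  | bin _ a b => a.size + b.size
  | deref a => a.size + 1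

/-- Only registers below `k`, tame operations and small literals occur. -/
def wf (k : ℕ) : Expr → Bool
  | reg r => decide (r < k)
  | lit z => decide (z.natAbs ≤ 8)
  | bin o a b => o.tame && (a.wf k && b.wf k)
  | deref a => a.wf k

/-- Code that evaluates an expression into register `t`, using only registers from `t` on. -/
def comp : Expr → ℕ → Prog
  | reg r, t => .seq (.const t 0) (.op .add t r t)
  | lit z, t => .const t z
  | bin o a b, t => .seq (a.comp t) (.seq (b.comp (t + 1)) (.op o t t (t + 1)))
  | deref a, t => .seq (a.comp t) (.load t t)

def time : Expr → ℕ
  | reg _ => 2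
  | lit _ => 1
  | bin _ a b => a.time + (b.time + 1)
  | deref a => a.time + 1

theorem size_pos (e : Expr) : 1 ≤ e.size := by
  induction e <;> (simp [size]; try omega)

theorem time_lt (e : Expr) : e.time + 1 ≤ 3 * e.size := by
  induction e <;> simp [size, time] <;> omega

end Expr

/-- For bounds of at least 2 a sum is dominated by the product, so one multiplicative bound serves
all tame operations. -/
theorem Op.abs_eval_le {o : Op} (ho : o.tame) {x y : ℤ} {a b : ℤ} (ha : 2 ≤ a) (hb : 2 ≤ b)
    (hx : |x| ≤ a) (hy : |y| ≤ b) : |o.eval x y| ≤ a * b := by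
  have hab : a + b ≤ a * b := by nlinarith
  have haab : a ≤ a * b := by nlinarith
  have hdiv : ∀ z : ℤ, |x / z| ≤ |x| := fun z => by
    rw [Int.abs_eq_natAbs, Int.abs_eq_natAbs]
    exact_mod_cast Int.natAbs_ediv_le_natAbs x z
  cases o <;> simp only [Op.tame, Bool.false_eq_true] at ho <;> simp only [Op.eval]
  · exact (abs_add_le x y).trans (by linarith)
  · exact (abs_sub x y).trans (by linarith)
  · rw [abs_mul]; exact mul_le_mul hx hy (abs_nonneg _) (by linarith)
  · exact (hdiv y).trans (by linarith)
  · rcases eq_or_ne y 0 with rfl | h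
    · simpa using by linarith
    · rw [abs_of_nonneg (Int.emod_nonneg _ h)]
      have := Int.emod_lt_abs x h
      linarith
  · exact (hdiv _).trans (by linarith)

/-- All words of the state have absolute value at most `V`. -/
def State.Bdd (V : ℤ) (s : State) : Prop :=
  (∀ r, |s.reg r| ≤ V) ∧ ∀ a, |s.mem a| ≤ V

/-- Bounds multiply along the expression tree. This is how intermediate values are kept inside
words: it is enough that a fixed power of V fits. -/
theorem Expr.abs_eval_le {V : ℤ} {k : ℕ} (hV : 8 ≤ V) {e : Expr} (he : e.wf k) {s : State}
    (hs : s.Bdd V) : |e.eval s| ≤ V ^ e.size := by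
  have h1 : ∀ e : Expr, V ≤ V ^ e.size := fun e =>
    le_self_pow₀ (by linarith) (by have := e.size_pos; omega)
  induction e with
  | reg r => simpa [eval, size] using hs.1 r
  | lit z =>
    simp only [wf, decide_eq_true_eq] at he
    simp only [eval, size, pow_one]
    rw [Int.abs_eq_natAbs]; omega
  | bin o a b iha ihb =>
    simp only [wf, Bool.and_eq_true] at he
    rw [size, pow_add]
    exact Op.abs_eval_le he.1 (by linarith [h1 a]) (by linarith [h1 b]) (iha he.2.1) (ihb he.2.2)
  | deref a ih => exact (hs.2 _).trans (h1 (deref a))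

theorem fits_of_le {w : ℕ} {V v : ℤ} {i k : ℕ} (hV : 8 ≤ V) (hw : V ^ k < 2 ^ w) (hi : i ≤ k)
    (h : |v| ≤ V ^ i) : Fits w v :=
  (h.trans (pow_le_pow_right₀ (by linarith) hi)).trans_lt hw

/-- The evaluation works like a stack whose top is register t: the second operand is computed one
register higher, so the first survives. The state `a` being represented is kept apart from the
machine state `s`, because scratch registers make them differ. -/
theorem Expr.comp_exec {w t₀ k : ℕ} {V : ℤ} (hV : 8 ≤ V) (hw : V ^ k < 2 ^ w) {e : Expr}
    (he : e.wf t₀) (hk : e.size ≤ k) {a : State} (ha : a.Bdd V) {t : ℕ} (ht : t₀ ≤ t)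
    {s : State} (hr : ∀ r < t₀, s.reg r = a.reg r) (hm : s.mem = a.mem) :
    ∃ s', Exec w (e.comp t) s e.time s' ∧ s'.mem = s.mem ∧ s'.reg t = e.eval a ∧
      ∀ r, (r < t ∨ t + e.size ≤ r) → s'.reg r = s.reg r := by
  have hfit : ∀ e' : Expr, e'.wf t₀ → e'.size ≤ k → Fits w (e'.eval a) := fun e' he' hk' =>
    fits_of_le hV hw hk' (abs_eval_le hV he' ha)
  induction e generalizing t s with
  | reg r =>
    have hrt : r < t₀ := by simpa [wf] using he
    have hf := hfit _ he hk
    have h2 : Op.eval .add ((s.setReg t 0).reg r) ((s.setReg t 0).reg t) = a.reg r := by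
      simp [Op.eval, State.setReg, Function.update, hr r hrt, show r ≠ t by omega]
    refine ⟨(s.setReg t 0).setReg t (a.reg r), ?_, rfl, by simp [State.setReg, eval], ?_⟩
    · have := Exec.op (w := w) (s.setReg t 0) .add t r t (by rw [h2]; exact hf)
      rw [h2] at this
      exact Exec.seq (Exec.const s t 0 (by simp [Fits])) this
    · intro q hq
      simp only [size] at hq
      simp [State.setReg, Function.update, show q ≠ t by omega]
  | lit z =>
    refine ⟨s.setReg t z, Exec.const s t z (hfit _ he hk), rfl, by simp [State.setReg, eval], ?_⟩
    intro q hq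
    simp only [size] at hq
    simp [State.setReg, Function.update, show q ≠ t by omega]
  | bin o b c ihb ihc =>
    have he' := he
    simp only [wf, Bool.and_eq_true] at he'
    have hf := hfit _ he hk
    simp only [size] at hk ⊢
    have hb1 := b.size_pos
    have hc1 := c.size_pos
    obtain ⟨s₁, h₁, m₁, v₁, f₁⟩ := ihb he'.2.1 (by omega) ht hr hm
    obtain ⟨s₂, h₂, m₂, v₂, f₂⟩ := ihc he'.2.2 (by omega) (t := t + 1) (s := s₁) (by omega)
      (fun r hrt => by rw [f₁ r (by omega), hr r hrt]) (by rw [m₁, hm])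
    have h3 : o.eval (s₂.reg t) (s₂.reg (t + 1)) = (bin o b c).eval a := by
      rw [v₂, f₂ t (by omega), v₁]; rfl
    refine ⟨s₂.setReg t ((bin o b c).eval a), ?_, by rw [← m₁, ← m₂]; rfl,
      by simp [State.setReg], ?_⟩
    · have := Exec.op (w := w) s₂ o t t (t + 1) (by rw [h3]; exact hf)
      rw [h3] at this
      exact Exec.seq h₁ (Exec.seq h₂ this)
    · intro q hq
      simp only [State.setReg, Function.update, show q ≠ t by omega]
      simp only [dite_false]
      rw [f₂ q (by omega), f₁ q (by omega)]
  | deref b ihb =>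
    have hf := hfit _ he hk
    simp only [size] at hk ⊢
    obtain ⟨s₁, h₁, m₁, v₁, f₁⟩ := ihb he (by omega) ht hr hm
    have h3 : s₁.mem (s₁.reg t) = (deref b).eval a := by rw [v₁, m₁, hm]; rfl
    refine ⟨s₁.setReg t ((deref b).eval a), ?_, by rw [← m₁]; rfl, by simp [State.setReg], ?_⟩
    · have := Exec.load (w := w) s₁ t t (by rw [h3]; exact hf)
      rw [h3] at this
      exact Exec.seq h₁ this
    · intro q hq
      have hb1 := b.size_pos
      simp only [State.setReg, Function.update, show q ≠ t by omega]
      simp only [dite_false]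
      rw [f₁ q (by omega)]

/-- Structured programs with expressions. -/
inductive Stm where
  | skip
  | assign (r : ℕ) (e : Expr)
  | store (a e : Expr)
  | seq (p q : Stm)
  | ite (a b : Expr) (p q : Stm)
  | while (a b : Expr) (p : Stm)

/-- Execution of a structured program in which all words written have absolute value at most `V`;
every statement and test counts as one step. -/
inductive HExec (V : ℤ) : Stm → State → ℕ → State → Prop where
  | skip (s : State) : HExec V .skip s 1 s
  | assign (s : State) (r : ℕ) (e : Expr) (h : |e.eval s| ≤ V) :
      HExec V (.assign r e) s 1 (s.setReg r (e.eval s))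
  | store (s : State) (a e : Expr) (h : |e.eval s| ≤ V) :
      HExec V (.store a e) s 1 (s.setMem (a.eval s) (e.eval s))
  | seq {p q : Stm} {s s₁ s₂ : State} {t₁ t₂ : ℕ} (hp : HExec V p s t₁ s₁)
      (hq : HExec V q s₁ t₂ s₂) : HExec V (.seq p q) s (t₁ + t₂) s₂
  | ite_true {a b : Expr} {p q : Stm} {s s' : State} {t : ℕ} (hab : a.eval s < b.eval s)
      (hp : HExec V p s t s') : HExec V (.ite a b p q) s (t + 1) s'
  | ite_false {a b : Expr} {p q : Stm} {s s' : State} {t : ℕ} (hab : ¬ a.eval s < b.eval s)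
      (hq : HExec V q s t s') : HExec V (.ite a b p q) s (t + 1) s'
  | while_true {a b : Expr} {p : Stm} {s s₁ s₂ : State} {t₁ t₂ : ℕ} (hab : a.eval s < b.eval s)
      (hp : HExec V p s t₁ s₁) (hq : HExec V (.while a b p) s₁ t₂ s₂) :
      HExec V (.while a b p) s (t₁ + t₂ + 1) s₂
  | while_false {a b : Expr} {p : Stm} {s : State} (hab : ¬ a.eval s < b.eval s) :
      HExec V (.while a b p) s 1 s

namespace Stm

/-- Expressions are well-formed and of size at most `k`, only registers below `t₀` occur. -/
def wf (t₀ k : ℕ) : Stm → Bool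
  | skip => true
  | assign r e => decide (r < t₀) && (e.wf t₀ && decide (e.size ≤ k))
  | store a e => a.wf t₀ && decide (a.size ≤ k) && (e.wf t₀ && decide (e.size ≤ k))
  | seq p q => p.wf t₀ k && q.wf t₀ k
  | ite a b p q => a.wf t₀ && decide (a.size ≤ k) && (b.wf t₀ && decide (b.size ≤ k)) &&
      (p.wf t₀ k && q.wf t₀ k)
  | .while a b p => a.wf t₀ && decide (a.size ≤ k) && (b.wf t₀ && decide (b.size ≤ k)) && p.wf t₀ k

/-- Code for two expressions, evaluated into the registers `t₀` and `t₀ + 1`. -/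
def compPair (t₀ : ℕ) (a b : Expr) : Prog := .seq (a.comp t₀) (b.comp (t₀ + 1))

/-- Compilation; the registers from `t₀` on hold intermediate values. -/
def comp (t₀ : ℕ) : Stm → Prog
  | skip => .skip
  | assign r e => .seq (e.comp t₀) (.seq (.const r 0) (.op .add r t₀ r))
  | store a e => .seq (compPair t₀ a e) (.store t₀ (t₀ + 1))
  | seq p q => .seq (p.comp t₀) (q.comp t₀)
  | ite a b p q => .seq (compPair t₀ a b) (.ifLt t₀ (t₀ + 1) (p.comp t₀) (q.comp t₀))
  | .while a b p => .seq (compPair t₀ a b)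
      (.whileLt t₀ (t₀ + 1) (.seq (p.comp t₀) (compPair t₀ a b)))

end Stm

/-- The concrete state `c` represents the state `s` of a structured program. -/
structure Represents (t₀ t₁ : ℕ) (s c : State) : Prop where
  reg : ∀ r < t₀, c.reg r = s.reg r
  zero : ∀ r, t₁ ≤ r → c.reg r = 0
  mem : c.mem = s.mem

/-- The second expression needs at most k scratch registers starting at t₀ + 1, so everything from
t₀ + 1 + k on remains zero. -/
theorem compPair_exec {w t₀ k : ℕ} {V : ℤ} (hV : 8 ≤ V) (hw : V ^ k < 2 ^ w) {a b : Expr}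
    (ha : a.wf t₀) (hka : a.size ≤ k) (hb : b.wf t₀) (hkb : b.size ≤ k) {s c : State}
    (hs : s.Bdd V) (hc : Represents t₀ (t₀ + 1 + k) s c) :
    ∃ t c', Exec w (Stm.compPair t₀ a b) c t c' ∧ t + 2 ≤ 6 * k ∧
      Represents t₀ (t₀ + 1 + k) s c' ∧ c'.reg t₀ = a.eval s ∧ c'.reg (t₀ + 1) = b.eval s := by
  obtain ⟨s₁, h₁, m₁, v₁, f₁⟩ := Expr.comp_exec hV hw ha hka hs le_rfl hc.reg hc.mem
  have hA := a.size_pos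
  have hB := b.size_pos
  have ta := a.time_lt
  have tb := b.time_lt
  obtain ⟨s₂, h₂, m₂, v₂, f₂⟩ := Expr.comp_exec hV hw hb hkb hs (t := t₀ + 1) (s := s₁)
    (by omega) (fun r hr => by rw [f₁ r (by omega), hc.reg r hr]) (by rw [m₁, hc.mem])
  refine ⟨_, s₂, Exec.seq h₁ h₂, by omega, ⟨fun r hr => ?_, fun r hr => ?_, ?_⟩, ?_, v₂⟩
  · rw [f₂ r (by omega), f₁ r (by omega), hc.reg r hr]
  · rw [f₂ r (by omega), f₁ r (by omega), hc.zero r hr]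
  · rw [m₂, m₁, hc.mem]
  · rw [f₂ t₀ (by omega), v₁]

theorem HExec.bdd {V : ℤ} {p : Stm} {s s' : State} {t : ℕ} (h : HExec V p s t s')
    (hs : s.Bdd V) : s'.Bdd V := by
  induction h with
  | skip => exact hs
  | assign s r e h =>
    refine ⟨fun q => ?_, hs.2⟩
    by_cases hq : q = r
    · subst hq; simpa [State.setReg] using h
    · simpa [State.setReg, Function.update, hq] using hs.1 q
  | store s a e h =>
    refine ⟨hs.1, fun q => ?_⟩
    by_cases hq : q = a.eval s
    · subst hq; simpa [State.setMem] using h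
    · simpa [State.setMem, Function.update, hq] using hs.2 q
  | seq _ _ ih₁ ih₂ => exact ih₂ (ih₁ hs)
  | ite_true _ _ ih => exact ih hs
  | ite_false _ _ ih => exact ih hs
  | while_true _ _ _ ih₁ ih₂ => exact ih₂ (ih₁ hs)
  | while_false _ => exact hs

/-- Compiled programs simulate structured programs with constant slowdown. -/
theorem HExec.comp_exec {w t₀ k : ℕ} {V : ℤ} (hV : 8 ≤ V) (hw : V ^ k < 2 ^ w) {p : Stm}
    {s s' : State} {t : ℕ} (h : HExec V p s t s') (hp : p.wf t₀ k) (hs : s.Bdd V) {c : State}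
    (hc : Represents t₀ (t₀ + 1 + k) s c) :
    ∃ t' c', Exec w (p.comp t₀) c t' c' ∧ t' ≤ (6 * k + 1) * t ∧
      Represents t₀ (t₀ + 1 + k) s' c' := by
  induction h generalizing c with
  | skip s => exact ⟨1, c, Exec.skip c, by omega, hc⟩
  | assign s r e h =>
    simp only [Stm.wf, Bool.and_eq_true, decide_eq_true_eq] at hp
    obtain ⟨hr, he, hk⟩ := hp
    obtain ⟨s₁, h₁, m₁, v₁, f₁⟩ := Expr.comp_exec hV hw he hk hs le_rfl hc.reg hc.mem
    have hfit : Fits w (e.eval s) := fits_of_le hV hw hk (Expr.abs_eval_le hV he hs)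
    have h2 : Op.eval .add ((s₁.setReg r 0).reg t₀) ((s₁.setReg r 0).reg r) = e.eval s := by
      simp [Op.eval, State.setReg, Function.update, show t₀ ≠ r by omega, v₁]
    have h3 := Exec.op (w := w) (s₁.setReg r 0) .add r t₀ r (by rw [h2]; exact hfit)
    rw [h2] at h3
    have := e.time_lt
    refine ⟨_, _, Exec.seq h₁ (Exec.seq (Exec.const s₁ r 0 (by simp [Fits])) h3), by omega, ?_⟩
    have hE := e.size_pos
    refine ⟨fun q hq => ?_, fun q hq => ?_, m₁.trans hc.mem⟩
    · by_cases hqr : q = r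
      · subst hqr; simp [State.setReg]
      · simp [State.setReg, Function.update, hqr, f₁ q (by omega), hc.reg q hq]
    · simp [State.setReg, Function.update, show q ≠ r by omega, f₁ q (by omega), hc.zero q hq]
  | store s a e h =>
    simp only [Stm.wf, Bool.and_eq_true, decide_eq_true_eq] at hp
    obtain ⟨t, c', h₁, ht, hc', v₁, v₂⟩ := compPair_exec hV hw hp.1.1 hp.1.2 hp.2.1 hp.2.2 hs hc
    refine ⟨_, _, Exec.seq h₁ (Exec.store c' t₀ (t₀ + 1)), by omega,
      hc'.reg, hc'.zero, ?_⟩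
    simp [State.setMem, v₁, v₂, hc'.mem]
  | seq _ _ ih₁ ih₂ =>
    simp only [Stm.wf, Bool.and_eq_true] at hp
    obtain ⟨t₁, c₁, e₁, l₁, r₁⟩ := ih₁ hp.1 hs hc
    obtain ⟨t₂, c₂, e₂, l₂, r₂⟩ := ih₂ hp.2 (HExec.bdd (by assumption) hs) r₁
    exact ⟨_, c₂, Exec.seq e₁ e₂, by rw [mul_add]; omega, r₂⟩
  | ite_true hab _ ih =>
    simp only [Stm.wf, Bool.and_eq_true, decide_eq_true_eq] at hp
    obtain ⟨⟨⟨ha, hka⟩, hb, hkb⟩, hp, hq⟩ := hp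
    obtain ⟨t, c', h₁, ht, hc', v₁, v₂⟩ := compPair_exec hV hw ha hka hb hkb hs hc
    obtain ⟨t₁, c₁, e₁, l₁, r₁⟩ := ih hp hs hc'
    exact ⟨_, c₁, Exec.seq h₁ (Exec.if_true (by rwa [v₁, v₂]) e₁), by rw [mul_add]; omega, r₁⟩
  | ite_false hab _ ih =>
    simp only [Stm.wf, Bool.and_eq_true, decide_eq_true_eq] at hp
    obtain ⟨⟨⟨ha, hka⟩, hb, hkb⟩, hp, hq⟩ := hp
    obtain ⟨t, c', h₁, ht, hc', v₁, v₂⟩ := compPair_exec hV hw ha hka hb hkb hs hc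
    obtain ⟨t₁, c₁, e₁, l₁, r₁⟩ := ih hq hs hc'
    exact ⟨_, c₁, Exec.seq h₁ (Exec.if_false (by rwa [v₁, v₂]) e₁), by rw [mul_add]; omega, r₁⟩
  | while_true hab hb _ ih₁ ih₂ =>
    have hp' := hp
    simp only [Stm.wf, Bool.and_eq_true, decide_eq_true_eq] at hp
    obtain ⟨⟨⟨ha, hka⟩, hb, hkb⟩, hq⟩ := hp
    obtain ⟨t, c', h₁, ht, hc', v₁, v₂⟩ := compPair_exec hV hw ha hka hb hkb hs hc
    obtain ⟨t₁, c₁, e₁, l₁, r₁⟩ := ih₁ hq hs hc'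
    obtain ⟨t₂, c₂, e₂, l₂, r₂⟩ := ih₂ hp' (HExec.bdd (by assumption) hs) r₁
    -- The remaining loop, as compiled, starts by evaluating its test. That evaluation is moved to
    -- the end of the current loop body, where the compiled code performs it.
    cases e₂ with
    | seq e₂ e₃ =>
      refine ⟨_, c₂, Exec.seq h₁ (Exec.while_true (by rwa [v₁, v₂]) (Exec.seq e₁ e₂) e₃), ?_, r₂⟩
      rw [mul_add, mul_add]; omega
  | while_false hab =>
    simp only [Stm.wf, Bool.and_eq_true, decide_eq_true_eq] at hp
    obtain ⟨⟨⟨ha, hka⟩, hb, hkb⟩, hq⟩ := hp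
    obtain ⟨t, c', h₁, ht, hc', v₁, v₂⟩ := compPair_exec hV hw ha hka hb hkb hs hc
    exact ⟨_, c', Exec.seq h₁ (Exec.while_false (by rwa [v₁, v₂])), by omega, hc'⟩

/-! ### Reasoning about structured programs -/

namespace Stm

/-- Register `r` is assigned somewhere in the program. -/
def mods (r : ℕ) : Stm → Bool
  | skip => false
  | assign q _ => decide (q = r)
  | store _ _ => false
  | seq p q => p.mods r || q.mods r
  | ite _ _ p q => p.mods r || q.mods r
  | .while _ _ p => p.mods r

/-- The program contains a store instruction. -/
def stores : Stm → Bool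
  | skip => false
  | assign _ _ => false
  | store _ _ => true
  | seq p q => p.stores || q.stores
  | ite _ _ p q => p.stores || q.stores
  | .while _ _ p => p.stores

/-- `s'` agrees with `s` in everything that `p` does not write syntactically. -/
structure Frame (p : Stm) (s s' : State) : Prop where
  reg : ∀ r, p.mods r = false → s'.reg r = s.reg r
  mem : p.stores = false → s'.mem = s.mem

theorem Frame.rfl {p : Stm} {s : State} : p.Frame s s := ⟨fun _ _ => .refl _, fun _ => .refl _⟩

theorem Frame.trans {p : Stm} {s₁ s₂ s₃ : State} (h : p.Frame s₁ s₂) (h' : p.Frame s₂ s₃) :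
    p.Frame s₁ s₃ :=
  ⟨fun r hr => (h'.reg r hr).trans (h.reg r hr), fun hr => (h'.mem hr).trans (h.mem hr)⟩

theorem Frame.mono {p q : Stm} {s₁ s₂ : State} (h : p.Frame s₁ s₂)
    (h₁ : ∀ r, q.mods r = false → p.mods r = false) (h₂ : q.stores = false → p.stores = false) :
    q.Frame s₁ s₂ :=
  ⟨fun r hr => h.reg r (h₁ r hr), fun hr => h.mem (h₂ hr)⟩

end Stm

/-- Turns preservation of registers and memory into a syntactic check that `rfl` decides for
concrete programs. -/
theorem HExec.frame {V : ℤ} {p : Stm} {s s' : State} {t : ℕ} (h : HExec V p s t s') :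
    p.Frame s s' := by
  induction h with
  | skip => exact .rfl
  | assign s r e h =>
    refine ⟨fun q hq => ?_, fun _ => rfl⟩
    have : q ≠ r := by rintro rfl; simp [Stm.mods] at hq
    simp [State.setReg, this]
  | store s a e h => exact ⟨fun _ _ => rfl, fun h => by simp [Stm.stores] at h⟩
  | seq _ _ ih₁ ih₂ =>
    exact (ih₁.mono (by simp +contextual [Stm.mods]) (by simp +contextual [Stm.stores])).trans
      (ih₂.mono (by simp +contextual [Stm.mods]) (by simp +contextual [Stm.stores]))
  | ite_true _ _ ih => exact ih.mono (by simp +contextual [Stm.mods]) (by simp +contextual [Stm.stores])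
  | ite_false _ _ ih => exact ih.mono (by simp +contextual [Stm.mods]) (by simp +contextual [Stm.stores])
  | while_true _ _ _ ih₁ ih₂ =>
    exact (ih₁.mono (by simp +contextual [Stm.mods]) (by simp +contextual [Stm.stores])).trans ih₂
  | while_false _ => exact .rfl

/-- Started in `s`, program `p` halts after at most `τ` steps in a state satisfying `Q`. -/
def Wp (V : ℤ) (p : Stm) (s : State) (τ : ℕ) (Q : State → Prop) : Prop :=
  ∃ t s', HExec V p s t s' ∧ t ≤ τ ∧ Q s'

namespace Wp

variable {V : ℤ} {p q : Stm} {s : State} {τ τ₁ τ₂ : ℕ} {Q Q' : State → Prop} {a b e : Expr}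

theorem mono (h : Wp V p s τ Q) (hQ : ∀ s', p.Frame s s' → Q s' → Q' s') {τ' : ℕ} (hτ : τ ≤ τ') :
    Wp V p s τ' Q' := by
  obtain ⟨t, s', h, ht, hq⟩ := h
  exact ⟨t, s', h, ht.trans hτ, hQ s' h.frame hq⟩

theorem skip (h : Q s) : Wp V .skip s 1 Q := ⟨1, s, .skip s, le_rfl, h⟩

theorem assign {r : ℕ} (hv : |e.eval s| ≤ V) (h : Q (s.setReg r (e.eval s))) :
    Wp V (.assign r e) s 1 Q := ⟨1, _, .assign s r e hv, le_rfl, h⟩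

theorem store (hv : |e.eval s| ≤ V) (h : Q (s.setMem (a.eval s) (e.eval s))) :
    Wp V (.store a e) s 1 Q := ⟨1, _, .store s a e hv, le_rfl, h⟩

theorem seq (h : Wp V p s τ₁ (fun s' => Wp V q s' τ₂ Q)) : Wp V (.seq p q) s (τ₁ + τ₂) Q := by
  obtain ⟨t, s', h, ht, t', s'', h', ht', hq⟩ := h
  exact ⟨_, _, .seq h h', by omega, hq⟩

/-- An assignment followed by a program. -/
theorem assign_seq {r : ℕ} (hv : |e.eval s| ≤ V) (h : Wp V q (s.setReg r (e.eval s)) τ Q) :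
    Wp V (.seq (.assign r e) q) s (τ + 1) Q := by
  rw [add_comm]; exact seq (assign hv h)

theorem ite_pos (hc : a.eval s < b.eval s) (h : Wp V p s τ Q) :
    Wp V (.ite a b p q) s (τ + 1) Q := by
  obtain ⟨t, s', h, ht, hq⟩ := h
  exact ⟨_, _, .ite_true hc h, by omega, hq⟩

theorem ite_neg (hc : ¬ a.eval s < b.eval s) (h : Wp V q s τ Q) :
    Wp V (.ite a b p q) s (τ + 1) Q := by
  obtain ⟨t, s', h, ht, hq⟩ := h
  exact ⟨_, _, .ite_false hc h, by omega, hq⟩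

theorem ite (h₁ : a.eval s < b.eval s → Wp V p s τ Q) (h₂ : ¬ a.eval s < b.eval s → Wp V q s τ Q) :
    Wp V (.ite a b p q) s (τ + 1) Q := by
  by_cases hc : a.eval s < b.eval s
  · exact ite_pos hc (h₁ hc)
  · exact ite_neg hc (h₂ hc)

/-- A loop with `n` iterations, the `j`-th of which takes at most `τ j` steps. -/
theorem while_sum {I : ℕ → State → Prop} {n : ℕ} {τ : ℕ → ℕ} (h0 : I 0 s)
    (hI : ∀ j < n, ∀ s', p.Frame s s' → I j s' → a.eval s' < b.eval s' ∧ Wp V p s' (τ j) (I (j + 1)))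
    (hn : ∀ s', p.Frame s s' → I n s' → ¬ a.eval s' < b.eval s' ∧ Q s') :
    Wp V (.while a b p) s ((∑ j ∈ Finset.range n, (τ j + 1)) + 1) Q := by
  -- The induction runs over the number m of iterations still to come.
  have key : ∀ m ≤ n, ∀ s', p.Frame s s' → I (n - m) s' →
      Wp V (.while a b p) s' ((∑ j ∈ Finset.Ico (n - m) n, (τ j + 1)) + 1) Q := by
    intro m
    induction m with
    | zero =>
      intro _ s' hf hs
      obtain ⟨hc, hq⟩ := hn s' hf hs
      exact ⟨1, s', .while_false hc, by omega, hq⟩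
    | succ m ih =>
      intro hm s' hf hs
      obtain ⟨hc, t, s'', h, ht, hi⟩ := hI (n - (m + 1)) (by omega) s' hf hs
      rw [show n - (m + 1) + 1 = n - m by omega] at hi
      obtain ⟨t', s₃, h', ht', hq⟩ := ih (by omega) s'' (hf.trans h.frame) hi
      refine ⟨_, s₃, .while_true hc h h', ?_, hq⟩
      rw [Finset.sum_eq_sum_Ico_succ_bot (by omega), show n - (m + 1) + 1 = n - m by omega]
      omega
  have := key n le_rfl s .rfl (by simpa using h0)
  simpa using this

theorem while_const {I : ℕ → State → Prop} {n : ℕ} {τ : ℕ} (h0 : I 0 s)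
    (hI : ∀ j < n, ∀ s', p.Frame s s' → I j s' → a.eval s' < b.eval s' ∧ Wp V p s' τ (I (j + 1)))
    (hn : ∀ s', p.Frame s s' → I n s' → ¬ a.eval s' < b.eval s' ∧ Q s') :
    Wp V (.while a b p) s (n * (τ + 1) + 1) Q := by
  simpa using while_sum (τ := fun _ => τ) h0 hI hn

end Wp

end WordRAM

namespace WordRAM

/-! ### Running a program in a translated memory -/

namespace Prog

/-- Put the address `reg a` of the translated memory into register `0`: nonnegative addresses are
shifted by `reg 1`. The registers of the embedded program are shifted by `k`. -/
def embedAddr (k a : ℕ) : Prog :=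
  .seq (.const 0 0) (.ifLt (a + k) 0 (.op .add 0 (a + k) 0) (.op .add 0 (a + k) 1))

/-- The program with registers shifted by `k` and nonnegative memory addresses shifted by `reg 1`;
register `0` is used for addresses. -/
def embed (k : ℕ) : Prog → Prog
  | skip => .skip
  | const r z => .const (r + k) z
  | op o r a b => .op o (r + k) (a + k) (b + k)
  | load r a => .seq (embedAddr k a) (.load (r + k) 0)
  | store a r => .seq (embedAddr k a) (.store 0 (r + k))
  | seq p q => .seq (p.embed k) (q.embed k)
  | ifLt a b p q => .ifLt (a + k) (b + k) (p.embed k) (q.embed k)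
  | whileLt a b p => .whileLt (a + k) (b + k) (p.embed k)

end Prog

/-- The place of the memory cell `a` in a memory translated by `B`. -/
def shiftAddr (B a : ℤ) : ℤ := if a < 0 then a else a + B

theorem shiftAddr_injective {B : ℤ} (hB : 0 ≤ B) : Function.Injective (shiftAddr B) := by
  intro a b h
  simp only [shiftAddr] at h
  split_ifs at h <;> omega

/-- The state `c` contains the state `s` (with words of size `w`), with registers shifted by `k` and
memory translated by `B = reg 1`. -/
structure Contains (w k : ℕ) (B : ℤ) (s c : State) : Prop where
  fits : ∀ r, Fits w (s.reg r)
  base : c.reg 1 = B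
  reg : ∀ r, c.reg (r + k) = s.reg r
  mem : ∀ a, c.mem (shiftAddr B a) = s.mem a

theorem Contains.setReg {w k : ℕ} {B : ℤ} {s c : State} (h : Contains w k B s c) (hk : 2 ≤ k)
    {r : ℕ} {z : ℤ} (hz : Fits w z) : Contains w k B (s.setReg r z) (c.setReg (r + k) z) := by
  refine ⟨fun q => ?_, ?_, fun q => ?_, h.mem⟩
  · by_cases hq : q = r
    · subst hq; simpa [State.setReg] using hz
    · simpa [State.setReg, hq] using h.fits q
  · simp [State.setReg, Function.update, show 1 ≠ r + k by omega, h.base]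
  · by_cases hq : q = r
    · subst hq; simp [State.setReg]
    · simpa [State.setReg, hq] using h.reg q

/-- Only nonnegative addresses move, and they grow by at most B; this is why the outer word size
must accommodate 2 ^ w + B. -/
theorem embedAddr_exec {w w' k : ℕ} {B : ℤ} (hk : 2 ≤ k) (hB : 0 ≤ B) (hw : 2 ^ w + B ≤ 2 ^ w')
    {s c : State} (h : Contains w k B s c) (a : ℕ) :
    Exec w' (Prog.embedAddr k a) c 3 (c.setReg 0 (shiftAddr B (s.reg a))) := by
  have h1 := abs_lt.1 (h.fits a)
  have h2 : (c.setReg 0 0).reg (a + k) = s.reg a := by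
    rw [← h.reg a]; simp [State.setReg, Function.update, show k ≠ 0 by omega]
  have h3 : (c.setReg 0 0).reg 0 = 0 := by simp [State.setReg]
  have h4 : (c.setReg 0 0).reg 1 = B := by simp [State.setReg, h.base]
  have h5 : (c.setReg 0 (shiftAddr B (s.reg a))) =
      (c.setReg 0 0).setReg 0 (shiftAddr B (s.reg a)) := by simp [State.setReg]
  rw [h5]
  refine Exec.seq (t₁ := 1) (t₂ := 2) (Exec.const c 0 0 (by simp [Fits])) ?_
  by_cases hn : s.reg a < 0
  · have h6 : Op.eval .add ((c.setReg 0 0).reg (a + k)) ((c.setReg 0 0).reg 0) =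
        shiftAddr B (s.reg a) := by rw [h2, h3]; simp [Op.eval, shiftAddr, hn]
    rw [← h6]
    refine Exec.if_true (by rw [h2, h3]; exact hn) (Exec.op _ _ _ _ _ ?_)
    rw [h6]; simp only [shiftAddr, hn, if_true, Fits]
    exact abs_lt.2 ⟨by linarith, by linarith⟩
  · have h6 : Op.eval .add ((c.setReg 0 0).reg (a + k)) ((c.setReg 0 0).reg 1) =
        shiftAddr B (s.reg a) := by rw [h2, h4]; simp [Op.eval, shiftAddr, hn]
    rw [← h6]
    refine Exec.if_false (by rw [h2, h3]; exact hn) (Exec.op _ _ _ _ _ ?_)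
    rw [h6]; simp only [shiftAddr, hn, if_false, Fits]
    exact abs_lt.2 ⟨by linarith, by linarith⟩

/-- An embedded program simulates the original one with constant slowdown. -/
theorem Exec.embed {w w' k : ℕ} {B : ℤ} (hk : 2 ≤ k) (hB : 0 ≤ B) (hw : 2 ^ w + B ≤ 2 ^ w')
    {p : Prog} {s s' : State} {t : ℕ} (h : Exec w p s t s') {c : State}
    (hc : Contains w k B s c) :
    ∃ t' c', Exec w' (p.embed k) c t' c' ∧ t' ≤ 4 * t ∧ Contains w k B s' c' ∧
      ∀ r < k, r ≠ 0 → c'.reg r = c.reg r := by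
  have hmono : ∀ z, Fits w z → Fits w' z := fun z hz => by
    simp only [Fits] at hz ⊢; linarith
  induction h generalizing c with
  | skip s => exact ⟨1, c, Exec.skip c, by omega, hc, fun _ _ _ => rfl⟩
  | const s r z hz =>
    refine ⟨1, _, Exec.const c (r + k) z (hmono z hz), by omega, hc.setReg hk hz, fun q hq _ => ?_⟩
    simp [State.setReg, Function.update, show q ≠ r + k by omega]
  | op s o r a b hv =>
    have h1 := Exec.op (w := w') c o (r + k) (a + k) (b + k)
      (by rw [hc.reg, hc.reg]; exact hmono _ hv)
    rw [hc.reg, hc.reg] at h1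
    refine ⟨1, _, h1, by omega, hc.setReg hk hv, fun q hq _ => ?_⟩
    simp [State.setReg, Function.update, show q ≠ r + k by omega]
  | load s r a hv =>
    have h1 := embedAddr_exec hk hB hw hc a
    set c₁ := c.setReg 0 (shiftAddr B (s.reg a)) with hc₁
    have h2 : c₁.mem (c₁.reg 0) = s.mem (s.reg a) := by
      rw [← hc.mem]; simp [hc₁, State.setReg]
    have h3 : Contains w k B s c₁ := by
      refine ⟨hc.fits, by simp [hc₁, State.setReg, hc.base], fun q => ?_, hc.mem⟩
      rw [← hc.reg]; simp [hc₁, State.setReg, Function.update, show k ≠ 0 by omega]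
    have h4 := Exec.load (w := w') c₁ (r + k) 0 (by rw [h2]; exact hmono _ hv)
    rw [h2] at h4
    refine ⟨_, _, Exec.seq h1 h4, by omega, h3.setReg hk hv, fun q hq h0 => ?_⟩
    simp [hc₁, State.setReg, Function.update, show q ≠ r + k by omega, h0]
  | store s a r =>
    have h1 := embedAddr_exec hk hB hw hc a
    set c₁ := c.setReg 0 (shiftAddr B (s.reg a)) with hc₁
    refine ⟨_, _, Exec.seq h1 (Exec.store c₁ 0 (r + k)), by omega,
      ⟨hc.fits, by simp [hc₁, State.setReg, State.setMem, hc.base], fun q => ?_, fun q => ?_⟩,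
      fun q hq h0 => by simp [hc₁, State.setReg, State.setMem, h0]⟩
    · simpa [hc₁, State.setReg, State.setMem, Function.update, show k ≠ 0 by omega] using hc.reg q
    · have h2 : c₁.reg (r + k) = s.reg r := by
        rw [← hc.reg]; simp [hc₁, State.setReg, Function.update, show k ≠ 0 by omega]
      have h3 : c₁.reg 0 = shiftAddr B (s.reg a) := by simp [hc₁, State.setReg]
      simp only [State.setMem, h2, h3]
      by_cases hq : q = s.reg a
      · subst hq; simp
      · rw [Function.update_of_ne hq, Function.update_of_ne ((shiftAddr_injective hB).ne hq)]
        exact hc.mem q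
  | seq _ _ ih₁ ih₂ =>
    obtain ⟨t₁, c₁, e₁, l₁, r₁, f₁⟩ := ih₁ hc
    obtain ⟨t₂, c₂, e₂, l₂, r₂, f₂⟩ := ih₂ r₁
    exact ⟨_, c₂, Exec.seq e₁ e₂, by omega, r₂, fun r hr h0 => by rw [f₂ r hr h0, f₁ r hr h0]⟩
  | if_true hab _ ih =>
    obtain ⟨t₁, c₁, e₁, l₁, r₁, f₁⟩ := ih hc
    exact ⟨_, c₁, Exec.if_true (by rwa [hc.reg, hc.reg]) e₁, by omega, r₁, f₁⟩
  | if_false hab _ ih =>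
    obtain ⟨t₁, c₁, e₁, l₁, r₁, f₁⟩ := ih hc
    exact ⟨_, c₁, Exec.if_false (by rwa [hc.reg, hc.reg]) e₁, by omega, r₁, f₁⟩
  | while_true hab _ _ ih₁ ih₂ =>
    obtain ⟨t₁, c₁, e₁, l₁, r₁, f₁⟩ := ih₁ hc
    obtain ⟨t₂, c₂, e₂, l₂, r₂, f₂⟩ := ih₂ r₁
    exact ⟨_, c₂, Exec.while_true (by rwa [hc.reg, hc.reg]) e₁ e₂, by omega, r₂,
      fun r hr h0 => by rw [f₂ r hr h0, f₁ r hr h0]⟩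
  | while_false hab =>
    exact ⟨1, c, Exec.while_false (by rwa [hc.reg, hc.reg]), by omega, hc, fun _ _ _ => rfl⟩

end WordRAM

/-! ### Common increasing subsequences of concatenations of blocks -/

namespace LCISBlocks

/-- The chain `S` is placed by `I` into blocks that are sorted by `key`. -/
structure Placed (n : ℕ) (B : ℕ → List ℕ) (key : ℕ → ℕ) (S : Finset ℕ) (I : ℕ → ℕ) : Prop where
  lt : ∀ v ∈ S, I v < n
  mem : ∀ v ∈ S, v ∈ B (I v)
  lex : ∀ v ∈ S, ∀ v' ∈ S, v < v' → I v < I v' ∨ I v = I v' ∧ key v < key v'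

/-- The lexicographic order on labelled entries. -/
def Lex (key : ℕ → ℕ) (x y : ℕ × ℕ) : Prop := x.1 < y.1 ∨ x.1 = y.1 ∧ key x.2 < key y.2

/-- The entries of the blocks, labelled by their blocks. -/
def labelled (n : ℕ) (B : ℕ → List ℕ) : List (ℕ × ℕ) :=
  (List.range n).flatMap fun i => (B i).map fun v => (i, v)

theorem labelled_map_snd (n : ℕ) (B : ℕ → List ℕ) :
    (labelled n B).map Prod.snd = (List.range n).flatMap B := by
  simp [labelled, List.map_flatMap, Function.comp_def]

theorem mem_labelled {n : ℕ} {B : ℕ → List ℕ} {x : ℕ × ℕ} :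
    x ∈ labelled n B ↔ x.1 < n ∧ x.2 ∈ B x.1 := by
  rcases x with ⟨i, v⟩
  simp [labelled]

theorem labelled_pairwise {n : ℕ} {B : ℕ → List ℕ} {key : ℕ → ℕ}
    (hB : ∀ i < n, (B i).Pairwise fun v v' => key v < key v') :
    (labelled n B).Pairwise (Lex key) := by
  rw [labelled, List.pairwise_flatMap]
  refine ⟨fun i hi => ?_, ?_⟩
  · rw [List.pairwise_map]
    exact (hB i (List.mem_range.1 hi)).imp fun h => Or.inr ⟨rfl, h⟩
  · refine List.pairwise_lt_range.imp fun {i j} hij x hx y hy => ?_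
    simp only [List.mem_map] at hx hy
    obtain ⟨v, -, rfl⟩ := hx
    obtain ⟨v', -, rfl⟩ := hy
    exact Or.inl hij

/-- A sublist of the concatenation lifts to a sublist of the labelled concatenation, and the labels
are the positions. Blocks are sorted by `key` rather than by value, since a gadget lists its values
in its own order. -/
theorem exists_placed {n : ℕ} {B : ℕ → List ℕ} {key : ℕ → ℕ}
    (hB : ∀ i < n, (B i).Pairwise fun v v' => key v < key v') {Z : List ℕ}
    (hZ : Z.Pairwise (· < ·)) (h : Z.Sublist ((List.range n).flatMap B)) :
    ∃ I, Placed n B key Z.toFinset I := by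
  rw [← labelled_map_snd, List.sublist_map_iff] at h
  obtain ⟨L, hL, rfl⟩ := h
  have hP := (labelled_pairwise hB).sublist hL
  rw [List.pairwise_map] at hZ
  -- The relation is symmetrised so that it can be applied to two elements without knowing which
  -- comes first in the list.
  have hQ : L.Pairwise fun x y => (x.2 < y.2 → Lex key x y) ∧ (y.2 < x.2 → Lex key y x) :=
    (hP.and hZ).imp fun ⟨h₁, h₂⟩ => ⟨fun _ => h₁, fun h => absurd h (by omega)⟩
  have hex : ∀ v, ∃ i, v ∈ L.map Prod.snd → (i, v) ∈ L := fun v => by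
    by_cases hv : v ∈ L.map Prod.snd
    · obtain ⟨x, hx, rfl⟩ := List.mem_map.1 hv
      exact ⟨x.1, fun _ => hx⟩
    · exact ⟨0, fun h => absurd h hv⟩
  choose I hI using hex
  have hI' : ∀ v ∈ (L.map Prod.snd).toFinset, (I v, v) ∈ L := fun v hv =>
    hI v (List.mem_toFinset.1 hv)
  refine ⟨I, fun v hv => (mem_labelled.1 (hL.subset (hI' v hv))).1,
    fun v hv => (mem_labelled.1 (hL.subset (hI' v hv))).2, fun v hv v' hv' hlt => ?_⟩
  have : Std.Symm fun x y : ℕ × ℕ =>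
      (x.2 < y.2 → Lex key x y) ∧ (y.2 < x.2 → Lex key y x) := ⟨fun x y h => ⟨h.2, h.1⟩⟩
  have := hQ.forall (hI' v hv) (hI' v' hv') (by
    intro h; simp only [Prod.mk.injEq] at h; omega)
  exact this.1 hlt

/-- The labelled concatenation is sorted by an antisymmetric relation, and so is the labelled chain;
for such lists, containment of elements without repetition already gives a sublist. -/
theorem Placed.sublist {n : ℕ} {B : ℕ → List ℕ} {key : ℕ → ℕ}
    (hB : ∀ i < n, (B i).Pairwise fun v v' => key v < key v') {S : Finset ℕ} {I : ℕ → ℕ}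
    (h : Placed n B key S I) : (S.sort (· ≤ ·)).Sublist ((List.range n).flatMap B) := by
  rw [← labelled_map_snd]
  have hmap : S.sort (· ≤ ·) = ((S.sort (· ≤ ·)).map fun v => (I v, v)).map Prod.snd := by
    simp [Function.comp_def]
  rw [hmap]
  refine List.Sublist.map _ ?_
  have hP := labelled_pairwise hB
  have hL : ((S.sort (· ≤ ·)).map fun v => (I v, v)).Pairwise (Lex key) := by
    rw [List.pairwise_map]
    refine (Finset.sortedLT_sort S).pairwise.imp_of_mem fun {v v'} hv hv' hlt => ?_
    exact h.lex v (by simpa using hv) v' (by simpa using hv') hlt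
  have : Std.Antisymm (Lex key) := ⟨fun x y h h' => by simp only [Lex] at h h'; omega⟩
  refine List.sublist_of_subperm_of_pairwise ?_ hL hP
  refine List.subperm_of_subset ?_ fun x hx => ?_
  · exact (Finset.sort_nodup S _).map fun v v' h => (Prod.mk.inj h).2
  · obtain ⟨v, hv, rfl⟩ := List.mem_map.1 hx
    rw [Finset.mem_sort] at hv
    exact mem_labelled.2 ⟨h.lt v hv, h.mem v hv⟩

theorem card_le_lcis {n : ℕ} {B B' : ℕ → List ℕ} {key key' : ℕ → ℕ}
    (hB : ∀ i < n, (B i).Pairwise fun v v' => key v < key v')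
    (hB' : ∀ i < n, (B' i).Pairwise fun v v' => key' v < key' v')
    {S : Finset ℕ} {I J : ℕ → ℕ} (hI : Placed n B key S I) (hJ : Placed n B' key' S J) :
    S.card ≤ lcis (((List.range n).flatMap B).map (↑)) (((List.range n).flatMap B').map (↑)) := by
  refine (lcis_isGreatest _ _).2 ⟨(S.sort (· ≤ ·)).map (↑), ⟨(hI.sublist hB).map _,
    (hJ.sublist hB').map _, ?_⟩, by simp⟩
  rw [List.pairwise_map]
  exact (Finset.sortedLT_sort S).pairwise.imp fun h => by exact_mod_cast h

theorem exists_card_eq_lcis {n : ℕ} {B B' : ℕ → List ℕ} {key key' : ℕ → ℕ}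
    (hB : ∀ i < n, (B i).Pairwise fun v v' => key v < key v')
    (hB' : ∀ i < n, (B' i).Pairwise fun v v' => key' v < key' v') :
    ∃ (S : Finset ℕ) (I J : ℕ → ℕ), Placed n B key S I ∧ Placed n B' key' S J ∧
      S.card = lcis (((List.range n).flatMap B).map (↑)) (((List.range n).flatMap B').map (↑)) := by
  obtain ⟨Z, ⟨hX, hY, hlt⟩, hlen⟩ := (lcis_isGreatest (((List.range n).flatMap B).map (↑))
    (((List.range n).flatMap B').map (↑))).1
  rw [← hlen]
  obtain ⟨Z, hX', rfl⟩ := List.sublist_map_iff.1 hX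
  rw [List.pairwise_map] at hlt
  have hlt : Z.Pairwise (· < ·) := hlt.imp fun h => by exact_mod_cast h
  obtain ⟨Z', hY, hZ⟩ := List.sublist_map_iff.1 hY
  obtain rfl := (List.map_injective_iff.2 Nat.cast_injective) hZ
  obtain ⟨I, hI⟩ := exists_placed hB hlt hX'
  obtain ⟨J, hJ⟩ := exists_placed hB' hlt hY
  refine ⟨_, I, J, hI, hJ, ?_⟩
  rw [List.length_map, List.toFinset_card_of_nodup (hlt.imp fun h => by omega)]

/-! ### Separators -/

/-- The first value of the token `τ` of weight `w`. -/
def tokStart (D n w τ : ℕ) : ℕ := 3 * D * (n - 2 * w) + τ * (w * D)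

/-- The token that starts the block with number `m` of a level. -/
def headTok (side : Bool) (m : ℕ) : ℕ := if side then m % 2 else 1 - m % 2

/-- The part of weight `w` of the separator with number `i`. -/
def lowTok (D n : ℕ) (side : Bool) (i w : ℕ) : List ℕ :=
  if w ∣ i then List.range' (tokStart D n w (headTok side (i / w))) (w * D) ++
    List.range' (tokStart D n w 2) (if i / w % 2 = 1 then w * D else 0)
  else []

/-- The separator with number `i`. -/
def low (D K : ℕ) (side : Bool) (i : ℕ) : List ℕ :=
  (List.range K).flatMap fun j => lowTok D (2 ^ K) side i (2 ^ (K - 1 - j))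

/-- The separator with number `i` contains the token `τ` of weight `w`. -/
def LowAt (side : Bool) (i w τ : ℕ) : Prop :=
  w ∣ i ∧ (τ = headTok side (i / w) ∨ τ = 2 ∧ i / w % 2 = 1)

theorem headTok_le (side : Bool) (m : ℕ) : headTok side m ≤ 1 := by
  unfold headTok; split <;> omega

theorem mem_lowTok {D n : ℕ} {side : Bool} {i w v : ℕ} :
    v ∈ lowTok D n side i w ↔
      ∃ τ, LowAt side i w τ ∧ tokStart D n w τ ≤ v ∧ v < tokStart D n w τ + w * D := by
  unfold lowTok LowAt
  split_ifs with h1 h2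
  · simp only [List.mem_append, List.mem_range'_1, h1, h2, true_and, and_true]
    constructor
    · rintro (h | h)
      · exact ⟨_, Or.inl rfl, h⟩
      · exact ⟨2, Or.inr rfl, h⟩
    · rintro ⟨τ, rfl | rfl, h⟩
      · exact Or.inl h
      · exact Or.inr h
  · simp [h1, h2]
  · simp [h1]

theorem mem_low {D K : ℕ} {side : Bool} {i v : ℕ} :
    v ∈ low D K side i ↔ ∃ l < K, v ∈ lowTok D (2 ^ K) side i (2 ^ l) := by
  simp only [low, List.mem_flatMap, List.mem_range]
  constructor
  · rintro ⟨j, hj, h⟩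
    exact ⟨K - 1 - j, by omega, h⟩
  · rintro ⟨l, hl, h⟩
    exact ⟨K - 1 - l, by omega, by rwa [show K - 1 - (K - 1 - l) = l by omega]⟩

theorem LowAt.le_two {side : Bool} {i w τ : ℕ} (h : LowAt side i w τ) : τ ≤ 2 := by
  rcases h.2 with h | h
  · have := headTok_le side (i / w); omega
  · omega

/-- The end of the range of values of weight `2 ^ l`. -/
def cut (D K l : ℕ) : ℕ := 3 * D * (2 ^ K - 2 ^ l)

theorem cut_anti {D K l l' : ℕ} (h : l ≤ l') : cut D K l' ≤ cut D K l :=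
  Nat.mul_le_mul_left _ (Nat.sub_le_sub_left (Nat.pow_le_pow_right (by norm_num) h) _)

/-- The range of each weight is filled exactly by its three tokens, and heavier weights have smaller
values. -/
theorem cut_succ {D K l : ℕ} (h : l < K) : cut D K (l + 1) + 3 * (2 ^ l * D) = cut D K l := by
  have h1 : 2 ^ (l + 1) ≤ 2 ^ K := Nat.pow_le_pow_right (by norm_num) h
  rw [pow_succ] at h1
  unfold cut
  obtain ⟨c, hc⟩ := Nat.exists_eq_add_of_le h1
  rw [hc, pow_succ, Nat.add_sub_cancel_left, show 2 ^ l * 2 + c - 2 ^ l = c + 2 ^ l by omega]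
  ring

theorem tokStart_eq {D K l τ : ℕ} :
    tokStart D (2 ^ K) (2 ^ l) τ = cut D K (l + 1) + τ * (2 ^ l * D) := by
  unfold tokStart cut; rw [pow_succ, mul_comm 2]

theorem mem_lowTok_bounds {D K : ℕ} {side : Bool} {i l v : ℕ} (hl : l < K)
    (h : v ∈ lowTok D (2 ^ K) side i (2 ^ l)) : cut D K (l + 1) ≤ v ∧ v < cut D K l := by
  obtain ⟨τ, h1, h2, h3⟩ := mem_lowTok.1 h
  rw [tokStart_eq] at h2 h3
  have h4 := h1.le_two
  have h5 : τ * (2 ^ l * D) ≤ 2 * (2 ^ l * D) := Nat.mul_le_mul_right _ h4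
  have := cut_succ (D := D) hl
  constructor <;> omega

theorem low_lt {D K : ℕ} {side : Bool} {i v : ℕ} (h : v ∈ low D K side i) :
    v < 3 * D * 2 ^ K := by
  obtain ⟨l, hl, h⟩ := mem_low.1 h
  have := (mem_lowTok_bounds hl h).2
  exact this.trans_le (Nat.mul_le_mul_left _ (Nat.sub_le _ _))

/-- In the range of values of a given weight, entries of a separator come from that weight. -/
theorem lowAt_of_mem_low {D K : ℕ} {side : Bool} {i l v : ℕ} (h : v ∈ low D K side i)
    (h1 : cut D K (l + 1) ≤ v) (h2 : v < cut D K l) :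
    ∃ τ, LowAt side i (2 ^ l) τ ∧ cut D K (l + 1) + τ * (2 ^ l * D) ≤ v ∧
      v < cut D K (l + 1) + τ * (2 ^ l * D) + 2 ^ l * D := by
  obtain ⟨l', hl', h⟩ := mem_low.1 h
  have hb := mem_lowTok_bounds hl' h
  have : l = l' := by
    rcases lt_trichotomy l l' with hlt | heq | hlt
    · have := cut_anti (D := D) (K := K) (show l + 1 ≤ l' by omega); omega
    · exact heq
    · have := cut_anti (D := D) (K := K) (show l' + 1 ≤ l by omega); omega
  subst this
  obtain ⟨τ, h3, h4, h5⟩ := mem_lowTok.1 h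
  rw [tokStart_eq] at h4 h5
  exact ⟨τ, h3, h4, h5⟩

/-- Weights are listed from heavy to light, which is from small to large values; within a weight the
head token is 0 or 1 and precedes token 2. -/
theorem low_pairwise {D K : ℕ} {side : Bool} {i : ℕ} : (low D K side i).Pairwise (· < ·) := by
  rw [low, List.pairwise_flatMap]
  constructor
  · intro j hj
    unfold lowTok
    by_cases hdvd : 2 ^ (K - 1 - j) ∣ i
    · rw [if_pos hdvd, List.pairwise_append]
      refine ⟨List.pairwise_lt_range' .., List.pairwise_lt_range' .., fun v hv v' hv' => ?_⟩
      rw [List.mem_range'_1] at hv hv'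
      have h1 := headTok_le side (i / 2 ^ (K - 1 - j))
      simp only [tokStart] at hv hv'
      have h2 := Nat.mul_le_mul_right (2 ^ (K - 1 - j) * D) h1
      omega
    · rw [if_neg hdvd]
      exact List.Pairwise.nil
  · refine List.pairwise_lt_range.imp_of_mem fun {j j'} hj hj' hjj v hv v' hv' => ?_
    rw [List.mem_range] at hj hj'
    have h1 := mem_lowTok_bounds (by omega) hv
    have h2 := mem_lowTok_bounds (by omega) hv'
    have := cut_anti (D := D) (K := K) (show K - 1 - j' + 1 ≤ K - 1 - j by omega)
    omega

/-- A set of values together with monotone positions in the separators of both sides. -/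
structure LowChain (D K : ℕ) (S : Finset ℕ) (I J : ℕ → ℕ) : Prop where
  memX : ∀ v ∈ S, v ∈ low D K false (I v)
  memY : ∀ v ∈ S, v ∈ low D K true (J v)
  monoX : ∀ v ∈ S, ∀ v' ∈ S, v < v' → I v ≤ I v'
  monoY : ∀ v ∈ S, ∀ v' ∈ S, v < v' → J v ≤ J v'

theorem LowChain.subset {D K : ℕ} {S S' : Finset ℕ} {I J : ℕ → ℕ} (h : LowChain D K S I J)
    (hS : S' ⊆ S) : LowChain D K S' I J :=
  ⟨fun v hv => h.memX v (hS hv), fun v hv => h.memY v (hS hv),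
    fun v hv v' hv' => h.monoX v (hS hv) v' (hS hv'),
    fun v hv v' hv' => h.monoY v (hS hv) v' (hS hv')⟩

/-- Positions separating the values below `c` from the others. -/
theorem exists_split {S : Finset ℕ} {I J : ℕ → ℕ} {i j : ℕ}
    (monoX : ∀ v ∈ S, ∀ v' ∈ S, v < v' → I v ≤ I v')
    (monoY : ∀ v ∈ S, ∀ v' ∈ S, v < v' → J v ≤ J v')
    (hI : ∀ v ∈ S, I v ≤ i) (hJ : ∀ v ∈ S, J v ≤ j) (c : ℕ) :
    ∃ i₀ ≤ i, ∃ j₀ ≤ j, (∀ v ∈ S, v < c → I v ≤ i₀ ∧ J v ≤ j₀) ∧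
      ∀ v ∈ S, c ≤ v → i₀ ≤ I v ∧ j₀ ≤ J v := by
  rcases (S.filter (· < c)).eq_empty_or_nonempty with h | h
  · refine ⟨0, by omega, 0, by omega, fun v hv hc => ?_, fun v hv hc => by omega⟩
    have : v ∈ S.filter (· < c) := Finset.mem_filter.2 ⟨hv, hc⟩
    rw [h] at this
    exact absurd this (Finset.notMem_empty v)
  · have hm := Finset.max'_mem _ h
    have hle : ∀ v ∈ S, v < c → v ≤ (S.filter (· < c)).max' h := fun v hv hc =>
      Finset.le_max' _ _ (Finset.mem_filter.2 ⟨hv, hc⟩)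
    set m := (S.filter (· < c)).max' h
    rw [Finset.mem_filter] at hm
    refine ⟨I m, hI m hm.1, J m, hJ m hm.1, fun v hv hc => ?_, fun v hv hc => ?_⟩
    · rcases (hle v hv hc).lt_or_eq with hlt | rfl
      · exact ⟨monoX v hv m hm.1 hlt, monoY v hv m hm.1 hlt⟩
      · exact ⟨le_rfl, le_rfl⟩
    · exact ⟨monoX m hm.1 v hv (by omega), monoY m hm.1 v hv (by omega)⟩

theorem card_le_of_bounds {S : Finset ℕ} {a q : ℕ} (h : ∀ v ∈ S, a ≤ v ∧ v < a + q) :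
    S.card ≤ q := by
  have : S ⊆ Finset.Ico a (a + q) := fun v hv => Finset.mem_Ico.2 (h v hv)
  simpa using Finset.card_le_card this

/-- The number of entries of one weight in a chain. -/
theorem LowChain.card_level_le {D K l : ℕ} {S : Finset ℕ} {I J : ℕ → ℕ}
    (h : LowChain D K S I J) {i₀ j₀ i j : ℕ} (hi₀ : i₀ ≤ i) (hj₀ : j₀ ≤ j)
    (hS : ∀ v ∈ S, cut D K (l + 1) ≤ v ∧ v < cut D K l)
    (hI : ∀ v ∈ S, i₀ ≤ I v ∧ I v ≤ i) (hJ : ∀ v ∈ S, j₀ ≤ J v ∧ J v ≤ j) :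
    S.card + 2 ^ l * D * (2 * (i₀ / 2 ^ (l + 1)) + 2 * (j₀ / 2 ^ (l + 1))) ≤
      2 ^ l * D * (i / 2 ^ l + j / 2 ^ l) := by
  set w := 2 ^ l with hw
  have hwpos : 0 < w := by positivity
  have hdiv : ∀ x, x / 2 ^ (l + 1) = x / w / 2 := fun x => by
    rw [pow_succ, Nat.div_div_eq_div_mul]
  rw [hdiv, hdiv]
  set q := w * D
  set c := cut D K (l + 1)
  have hX : ∀ v ∈ S, ∃ τ, c + τ * q ≤ v ∧ v < c + τ * q + q ∧ τ ≤ 2 ∧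
      (τ = headTok false (I v / w) ∨ τ = 2 ∧ I v / w % 2 = 1) := fun v hv => by
    obtain ⟨τ, h1, h2, h3⟩ := lowAt_of_mem_low (h.memX v hv) (hS v hv).1 (hS v hv).2
    exact ⟨τ, h2, h3, h1.le_two, h1.2⟩
  have hY : ∀ v ∈ S, ∃ τ, c + τ * q ≤ v ∧ v < c + τ * q + q ∧ τ ≤ 2 ∧
      (τ = headTok true (J v / w) ∨ τ = 2 ∧ J v / w % 2 = 1) := fun v hv => by
    obtain ⟨τ, h1, h2, h3⟩ := lowAt_of_mem_low (h.memY v hv) (hS v hv).1 (hS v hv).2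
    exact ⟨τ, h2, h3, h1.le_two, h1.2⟩
  have hbX : ∀ v ∈ S, i₀ / w ≤ I v / w ∧ I v / w ≤ i / w := fun v hv =>
    ⟨Nat.div_le_div_right (hI v hv).1, Nat.div_le_div_right (hI v hv).2⟩
  have hbY : ∀ v ∈ S, j₀ / w ≤ J v / w ∧ J v / w ≤ j / w := fun v hv =>
    ⟨Nat.div_le_div_right (hJ v hv).1, Nat.div_le_div_right (hJ v hv).2⟩
  have h0X : i₀ / w ≤ i / w := Nat.div_le_div_right hi₀
  have h0Y : j₀ / w ≤ j / w := Nat.div_le_div_right hj₀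
  -- A value of S lies in the same token on both sides. Token 0 is common only to an odd position of
  -- X and an even one of Y, token 1 to an even and an odd one, token 2 to two odd ones. Two even
  -- positions have nothing in common.
  have tok : ∀ v ∈ S,
      (v < c + q → I v / w % 2 = 1 ∧ J v / w % 2 = 0) ∧
      (c + q ≤ v → v < c + 2 * q → I v / w % 2 = 0 ∧ J v / w % 2 = 1) ∧
      (c + 2 * q ≤ v → I v / w % 2 = 1 ∧ J v / w % 2 = 1) := by
    intro v hv
    obtain ⟨τ, a1, a2, a3, a4⟩ := hX v hv
    obtain ⟨τ', b1, b2, b3, b4⟩ := hY v hv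
    simp only [headTok, Bool.false_eq_true, if_false, if_true] at a4 b4
    have ha : τ = 0 ∨ τ = 1 ∨ τ = 2 := by omega
    have hb : τ' = 0 ∨ τ' = 1 ∨ τ' = 2 := by omega
    rcases ha with rfl | rfl | rfl <;> rcases hb with rfl | rfl | rfl <;>
      refine ⟨fun _ => ?_, fun _ _ => ?_, fun _ => ?_⟩ <;> omega
  set S0 := S.filter (· < c + q)
  set S1 := S.filter fun v => c + q ≤ v ∧ v < c + 2 * q
  set S2 := S.filter (c + 2 * q ≤ ·)
  have hcard : S.card ≤ S0.card + S1.card + S2.card := by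
    have : S ⊆ S0 ∪ S1 ∪ S2 := fun v hv => by
      simp only [S0, S1, S2, Finset.mem_union, Finset.mem_filter, hv, true_and]; omega
    exact (Finset.card_le_card this).trans
      ((Finset.card_union_le _ _).trans (Nat.add_le_add_right (Finset.card_union_le _ _) _))
  have hcl := fun v hv => (hX v hv)
  have hup : ∀ v ∈ S, v < c + 2 * q + q := fun v hv => by
    obtain ⟨τ, -, h2, h3, -⟩ := hX v hv
    have := Nat.mul_le_mul_right q h3
    omega
  have b0 : S0.card ≤ q := card_le_of_bounds (a := c) fun v hv => by
    have := Finset.mem_filter.1 hv; have := hS v this.1; omega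
  have b1 : S1.card ≤ q := card_le_of_bounds (a := c + q) fun v hv => by
    have := (Finset.mem_filter.1 hv).2; omega
  have b2 : S2.card ≤ q := card_le_of_bounds (a := c + 2 * q) fun v hv => by
    have := Finset.mem_filter.1 hv; have := hup v this.1; omega
  have e0 : S0.card = 0 ∨ ∃ v ∈ S, v < c + q := by
    rcases S0.eq_empty_or_nonempty with h | ⟨v, hv⟩
    · simp [h]
    · exact Or.inr ⟨v, Finset.mem_filter.1 hv⟩
  have e1 : S1.card = 0 ∨ ∃ v ∈ S, c + q ≤ v ∧ v < c + 2 * q := by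
    rcases S1.eq_empty_or_nonempty with h | ⟨v, hv⟩
    · simp [h]
    · exact Or.inr ⟨v, Finset.mem_filter.1 hv⟩
  have e2 : S2.card = 0 ∨ ∃ v ∈ S, c + 2 * q ≤ v := by
    rcases S2.eq_empty_or_nonempty with h | ⟨v, hv⟩
    · simp [h]
    · exact Or.inr ⟨v, Finset.mem_filter.1 hv⟩
  -- k bounds the number of tokens in use. Measured from the even positions below i₀ and j₀, every
  -- odd position needed is a step forward. If tokens 0 and 1 both occur, X has to pass from an odd
  -- to a later even position while Y is odd, which already makes three steps and pays for token 2
  -- as well.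
  have key : ∃ k, S0.card + S1.card + S2.card ≤ q * k ∧
      k + (2 * (i₀ / w / 2) + 2 * (j₀ / w / 2)) ≤ i / w + j / w := by
    rcases e0 with e0 | ⟨v0, hv0, l0⟩ <;> rcases e1 with e1 | ⟨v1, hv1, l1, l1'⟩ <;>
      rcases e2 with e2 | ⟨v2, hv2, l2⟩
    · exact ⟨0, by omega, by omega⟩
    · have := (tok v2 hv2).2.2 l2
      have := hbX v2 hv2; have := hbY v2 hv2
      exact ⟨1, by omega, by omega⟩
    · have := (tok v1 hv1).2.1 l1 l1'
      have := hbX v1 hv1; have := hbY v1 hv1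
      exact ⟨1, by omega, by omega⟩
    · have := (tok v2 hv2).2.2 l2
      have := hbX v2 hv2; have := hbY v2 hv2
      exact ⟨2, by omega, by omega⟩
    · have := (tok v0 hv0).1 l0
      have := hbX v0 hv0; have := hbY v0 hv0
      exact ⟨1, by omega, by omega⟩
    · have := (tok v2 hv2).2.2 l2
      have := hbX v2 hv2; have := hbY v2 hv2
      exact ⟨2, by omega, by omega⟩
    · have := (tok v0 hv0).1 l0
      have := (tok v1 hv1).2.1 l1 l1'
      have := hbX v0 hv0; have := hbX v1 hv1; have := hbY v1 hv1
      have : I v0 / w ≤ I v1 / w := Nat.div_le_div_right (h.monoX v0 hv0 v1 hv1 (by omega))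
      exact ⟨3, by omega, by omega⟩
    · have := (tok v0 hv0).1 l0
      have := (tok v1 hv1).2.1 l1 l1'
      have := hbX v0 hv0; have := hbX v1 hv1; have := hbY v1 hv1
      have : I v0 / w ≤ I v1 / w := Nat.div_le_div_right (h.monoX v0 hv0 v1 hv1 (by omega))
      exact ⟨3, by omega, by omega⟩
  obtain ⟨k, hk1, hk2⟩ := key
  calc _ ≤ q * k + q * (2 * (i₀ / w / 2) + 2 * (j₀ / w / 2)) := by omega
    _ = q * (k + (2 * (i₀ / w / 2) + 2 * (j₀ / w / 2))) := by ring
    _ ≤ _ := Nat.mul_le_mul_left _ hk2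

/-- Induction over the weights, from heavy to light, with positions rounded down to multiples of the
current weight. The heavier values end at some (i₀, j₀); they are bounded by induction and the
values of the new weight by `LowChain.card_level_le`. -/
theorem LowChain.card_le_aux {D K k : ℕ} (hk : k ≤ K) {S : Finset ℕ} {I J : ℕ → ℕ}
    (h : LowChain D K S I J) {i j : ℕ} (hS : ∀ v ∈ S, v < cut D K (K - k))
    (hI : ∀ v ∈ S, I v ≤ i) (hJ : ∀ v ∈ S, J v ≤ j) :
    S.card ≤ 2 ^ (K - k) * D * (i / 2 ^ (K - k) + j / 2 ^ (K - k)) := by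
  induction k generalizing S i j with
  | zero =>
    have : S = ∅ := Finset.eq_empty_of_forall_notMem fun v hv => by
      have := hS v hv
      simp [cut] at this
    simp [this]
  | succ k ih =>
    set l := K - (k + 1) with hl
    have hl1 : K - k = l + 1 := by omega
    rw [hl1] at ih
    obtain ⟨i₀, hi₀, j₀, hj₀, h1, h2⟩ := exists_split h.monoX h.monoY hI hJ (cut D K (l + 1))
    have hA := ih (by omega) (h.subset (Finset.filter_subset (· < cut D K (l + 1)) S))
      (fun v hv => (Finset.mem_filter.1 hv).2)
      (fun v hv => (h1 v (Finset.mem_filter.1 hv).1 (Finset.mem_filter.1 hv).2).1)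
      (fun v hv => (h1 v (Finset.mem_filter.1 hv).1 (Finset.mem_filter.1 hv).2).2)
    have hB := (h.subset (Finset.filter_subset (fun v => ¬ v < cut D K (l + 1)) S)).card_level_le
      (l := l) hi₀ hj₀
      (fun v hv => ⟨not_lt.1 (Finset.mem_filter.1 hv).2, hS v (Finset.mem_filter.1 hv).1⟩)
      (fun v hv => ⟨(h2 v (Finset.mem_filter.1 hv).1 (not_lt.1 (Finset.mem_filter.1 hv).2)).1,
        hI v (Finset.mem_filter.1 hv).1⟩)
      (fun v hv => ⟨(h2 v (Finset.mem_filter.1 hv).1 (not_lt.1 (Finset.mem_filter.1 hv).2)).2,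
        hJ v (Finset.mem_filter.1 hv).1⟩)
    have hC := S.card_filter_add_card_filter_not (· < cut D K (l + 1))
    -- The bound for the heavier weights is the very term subtracted in the bound for this weight,
    -- so the sum telescopes.
    have hE : 2 ^ (l + 1) * D * (i₀ / 2 ^ (l + 1) + j₀ / 2 ^ (l + 1)) =
        2 ^ l * D * (2 * (i₀ / 2 ^ (l + 1)) + 2 * (j₀ / 2 ^ (l + 1))) := by
      rw [pow_succ]; ring
    rw [hE] at hA
    omega

/-- Chains in the separators up to `i` and `j` have length at most `D * (i + j)`. -/
theorem LowChain.card_le {D K : ℕ} {S : Finset ℕ} {I J : ℕ → ℕ}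
    (h : LowChain D K S I J) {i j : ℕ} (hi : ∀ v ∈ S, I v ≤ i) (hj : ∀ v ∈ S, J v ≤ j) :
    S.card ≤ D * (i + j) := by
  have := h.card_le_aux le_rfl (fun v hv => ?_) hi hj
  · simpa using this
  · obtain ⟨l, hl, hv⟩ := mem_low.1 (h.memX v hv)
    have h1 := (mem_lowTok_bounds hl hv).2
    have h2 := cut_anti (D := D) (K := K) (Nat.zero_le l)
    simpa using h1.trans_le h2

end LCISBlocks

/-! ### Long chains in the separators -/

namespace LCISBlocks

theorem mem_low_of_lowAt {D K l τ v : ℕ} {side : Bool} {i : ℕ} (hl : l < K)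
    (h : LowAt side i (2 ^ l) τ) (h1 : cut D K (l + 1) + τ * (2 ^ l * D) ≤ v)
    (h2 : v < cut D K (l + 1) + τ * (2 ^ l * D) + 2 ^ l * D) : v ∈ low D K side i :=
  mem_low.2 ⟨l, hl, mem_lowTok.2 ⟨τ, h, by rwa [tokStart_eq], by rwa [tokStart_eq]⟩⟩

/-- The tokens to add at one weight, given the last binary digits of both positions. If both are
odd, tokens 0 and 2 are taken: X stays at its odd position while Y moves from the even position
before b to b. Hence token 0 imposes no condition on b. -/
theorem exists_tokens (c q a b : ℕ) : ∃ N : Finset ℕ, N.card = q * (a % 2 + b % 2) ∧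
    ∀ v ∈ N, c ≤ v ∧ v < c + 3 * q ∧ (v < c + q → a % 2 = 1) ∧
      (c + q ≤ v → v < c + 2 * q → a % 2 = 0 ∧ b % 2 = 1) ∧
      (c + 2 * q ≤ v → a % 2 = 1 ∧ b % 2 = 1) := by
  rcases Nat.mod_two_eq_zero_or_one a with ha | ha <;>
    rcases Nat.mod_two_eq_zero_or_one b with hb | hb
  · exact ⟨∅, by simp [ha, hb], by simp⟩
  · refine ⟨Finset.Ico (c + q) (c + 2 * q), by simp [ha, hb]; omega, fun v hv => ?_⟩
    rw [Finset.mem_Ico] at hv; omega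
  · refine ⟨Finset.Ico c (c + q), by simp [ha, hb], fun v hv => ?_⟩
    rw [Finset.mem_Ico] at hv; omega
  · refine ⟨Finset.Ico c (c + q) ∪ Finset.Ico (c + 2 * q) (c + 3 * q), ?_, fun v hv => ?_⟩
    · rw [Finset.card_union_of_disjoint]
      · simp [ha, hb]; omega
      · rw [Finset.disjoint_left]
        intro v hv hv'
        rw [Finset.mem_Ico] at hv hv'; omega
    · rw [Finset.mem_union, Finset.mem_Ico, Finset.mem_Ico] at hv; omega

/-- The binary digits of i and j are processed from the top. Each digit 1 adds one token of its
weight, and the chain built so far ends at the positions rounded down to the previous weight. -/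
theorem exists_lowChain_aux {D K k : ℕ} (hk : k ≤ K) {i j : ℕ} (hi : i < 2 ^ K) (hj : j < 2 ^ K) :
    ∃ (S : Finset ℕ) (I J : ℕ → ℕ), LowChain D K S I J ∧
      S.card = 2 ^ (K - k) * D * (i / 2 ^ (K - k) + j / 2 ^ (K - k)) ∧
      ∀ v ∈ S, v < cut D K (K - k) ∧ I v ≤ i / 2 ^ (K - k) * 2 ^ (K - k) ∧
        J v ≤ j / 2 ^ (K - k) * 2 ^ (K - k) := by
  induction k with
  | zero =>
    refine ⟨∅, id, id, ⟨by simp, by simp, by simp, by simp⟩, ?_, by simp⟩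
    simp [Nat.div_eq_of_lt hi, Nat.div_eq_of_lt hj]
  | succ k ih =>
    obtain ⟨S, I, J, hS, hcard, hb⟩ := ih (by omega)
    set l := K - (k + 1) with hl
    have hl1 : K - k = l + 1 := by omega
    have hlK : l < K := by omega
    rw [hl1] at hcard hb
    have hdiv : ∀ x, x / 2 ^ (l + 1) = x / 2 ^ l / 2 := fun x => by
      rw [pow_succ, Nat.div_div_eq_div_mul]
    have hcut := cut_succ (D := D) hlK
    rw [hdiv, hdiv] at hcard hb
    set w := 2 ^ l with hw
    have hwpos : 0 < w := by positivity
    have hw2 : 2 ^ (l + 1) = 2 * w := by rw [pow_succ, mul_comm]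
    rw [hw2] at hcard hb
    set a := i / w
    set b := j / w
    set q := w * D with hq
    set c := cut D K (l + 1)
    obtain ⟨N, hN, hNv⟩ := exists_tokens c q a b
    have hdisj : Disjoint S N := Finset.disjoint_left.2 fun v hv hv' => by
      have := (hb v hv).1; have := (hNv v hv').1; omega
    have ea : a / 2 * (2 * w) ≤ a * w := by
      rw [← mul_assoc]; exact Nat.mul_le_mul_right _ (by omega)
    have eb : b / 2 * (2 * w) = b / 2 * 2 * w := by rw [mul_assoc]
    have eb' : b / 2 * 2 * w ≤ b * w := Nat.mul_le_mul_right _ (by omega)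
    -- On the Y side token 0 is read at the even position `b / 2 * 2` and the later tokens at b.
    let I' : ℕ → ℕ := fun v => if v < c then I v else a * w
    let J' : ℕ → ℕ := fun v => if v < c then J v else if v < c + q then b / 2 * 2 * w else b * w
    have hIS : ∀ v ∈ S, I' v = I v := fun v hv => if_pos (hb v hv).1
    have hJS : ∀ v ∈ S, J' v = J v := fun v hv => if_pos (hb v hv).1
    have hIN : ∀ v ∈ N, I' v = a * w := fun v hv => if_neg (not_lt.2 (hNv v hv).1)
    have hJN : ∀ v ∈ N, J' v = if v < c + q then b / 2 * 2 * w else b * w := fun v hv =>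
      if_neg (not_lt.2 (hNv v hv).1)
    have low_of : ∀ {side i τ v}, LowAt side i w τ → c + τ * q ≤ v → v < c + τ * q + q →
        v ∈ low D K side i := fun h1 h2 h3 => mem_low_of_lowAt hlK h1 h2 h3
    have mX : ∀ v ∈ N, v ∈ low D K false (a * w) := fun v hv => by
      have h1 := hNv v hv
      have hdv : a * w / w = a := Nat.mul_div_cancel _ hwpos
      by_cases h2 : v < c + q
      · refine low_of (τ := 0) ⟨Dvd.intro_left _ rfl, Or.inl ?_⟩ ?_ ?_
        · rw [hdv, headTok, if_neg (by simp)]; omega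
        · omega
        · omega
      · by_cases h3 : v < c + 2 * q
        · refine low_of (τ := 1) ⟨Dvd.intro_left _ rfl, Or.inl ?_⟩ ?_ ?_
          · rw [hdv, headTok, if_neg (by simp)]; omega
          · omega
          · omega
        · refine low_of (τ := 2) ⟨Dvd.intro_left _ rfl, Or.inr ⟨rfl, ?_⟩⟩ ?_ ?_
          · rw [hdv]; omega
          · omega
          · omega
    have mY : ∀ v ∈ N, v ∈ low D K true (J' v) := fun v hv => by
      have h1 := hNv v hv
      rw [hJN v hv]
      have hdv : b * w / w = b := Nat.mul_div_cancel _ hwpos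
      have hdv' : b / 2 * 2 * w / w = b / 2 * 2 := Nat.mul_div_cancel _ hwpos
      by_cases h2 : v < c + q
      · rw [if_pos h2]
        refine low_of (τ := 0) ⟨Dvd.intro_left _ rfl, Or.inl ?_⟩ ?_ ?_
        · rw [hdv', headTok, if_pos rfl]; omega
        · omega
        · omega
      · rw [if_neg h2]
        by_cases h3 : v < c + 2 * q
        · refine low_of (τ := 1) ⟨Dvd.intro_left _ rfl, Or.inl ?_⟩ ?_ ?_
          · rw [hdv, headTok, if_pos rfl]; omega
          · omega
          · omega
        · refine low_of (τ := 2) ⟨Dvd.intro_left _ rfl, Or.inr ⟨rfl, ?_⟩⟩ ?_ ?_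
          · rw [hdv]; omega
          · omega
          · omega
    refine ⟨S ∪ N, I', J', ⟨?_, ?_, ?_, ?_⟩, ?_, ?_⟩
    · intro v hv
      rcases Finset.mem_union.1 hv with hv | hv
      · rw [hIS v hv]; exact hS.memX v hv
      · rw [hIN v hv]; exact mX v hv
    · intro v hv
      rcases Finset.mem_union.1 hv with hv | hv
      · rw [hJS v hv]; exact hS.memY v hv
      · exact mY v hv
    · intro v hv v' hv' hlt
      rcases Finset.mem_union.1 hv with hv | hv <;> rcases Finset.mem_union.1 hv' with hv' | hv'
      · rw [hIS v hv, hIS v' hv']; exact hS.monoX v hv v' hv' hlt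
      · rw [hIS v hv, hIN v' hv']; exact (hb v hv).2.1.trans ea
      · have := (hb v' hv').1; have := (hNv v hv).1; omega
      · rw [hIN v hv, hIN v' hv']
    · intro v hv v' hv' hlt
      rcases Finset.mem_union.1 hv with hv | hv <;> rcases Finset.mem_union.1 hv' with hv' | hv'
      · rw [hJS v hv, hJS v' hv']; exact hS.monoY v hv v' hv' hlt
      · rw [hJS v hv, hJN v' hv']
        have := (hb v hv).2.2
        split_ifs <;> omega
      · have := (hb v' hv').1; have := (hNv v hv).1; omega
      · rw [hJN v hv, hJN v' hv']
        split_ifs <;> omega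
    · rw [Finset.card_union_of_disjoint hdisj, hcard, hN]
      have e1 : 2 * w * D * (a / 2 + b / 2) = q * (2 * (a / 2) + 2 * (b / 2)) := by
        rw [hq]; ring
      rw [e1, ← mul_add]
      congr 1
      omega
    · intro v hv
      rcases Finset.mem_union.1 hv with hv | hv
      · rw [hIS v hv, hJS v hv]
        have := hb v hv
        refine ⟨by omega, by omega, by omega⟩
      · have := hNv v hv
        rw [hIN v hv, hJN v hv]
        refine ⟨by omega, le_rfl, ?_⟩
        split_ifs <;> omega

/-- Chains of length `D * (i + j)` in the separators up to `i` and `j`. -/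
theorem exists_lowChain {D K : ℕ} {i j : ℕ} (hi : i < 2 ^ K) (hj : j < 2 ^ K) :
    ∃ (S : Finset ℕ) (I J : ℕ → ℕ), LowChain D K S I J ∧ S.card = D * (i + j) ∧
      ∀ v ∈ S, I v ≤ i ∧ J v ≤ j := by
  obtain ⟨S, I, J, h, hc, hb⟩ := exists_lowChain_aux (D := D) le_rfl hi hj
  simp only [Nat.sub_self, pow_zero, Nat.div_one, one_mul, mul_one] at hc hb
  exact ⟨S, I, J, h, hc, fun v hv => (hb v hv).2⟩

/-! ### Gadgets between separators -/

/-- Data of a family of pairs of gadgets: a gadget of each side is given by a set of values in the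
order described by the involution `ord`. -/
structure Gadgets (D K : ℕ) where
  ord : Bool → ℕ → ℕ
  ord_lt : ∀ side e, e < D → ord side e < D
  ord_ord : ∀ side e, e < D → ord side (ord side e) = e
  leaf : Bool → ℕ → ℕ → Bool

variable {D K : ℕ} (Γ : Gadgets D K)

/-- The sum of a value and its mirror image. -/
def mirror (D K : ℕ) : ℕ := 2 * (3 * D * 2 ^ K) + D

/-- The mirrored separator with number `i`. -/
def high (D K : ℕ) (side : Bool) (i : ℕ) : List ℕ :=
  ((low D K side (2 ^ K - 1 - i)).map (mirror D K - ·)).reverse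

namespace Gadgets

/-- Position e holds the value `ord side e`; since `ord` is an involution, it also maps values back
to positions. -/
def mid (side : Bool) (i : ℕ) : List ℕ :=
  (List.range D).flatMap fun e =>
    if Γ.leaf side i (Γ.ord side e) then [3 * D * 2 ^ K + Γ.ord side e] else []

/-- A gadget between two separators. -/
def block (side : Bool) (i : ℕ) : List ℕ :=
  low D K side i ++ (Γ.mid side i ++ high D K side i)

/-- The order of the entries of a block. -/
def key (side : Bool) (v : ℕ) : ℕ :=
  if 3 * D * 2 ^ K ≤ v ∧ v < 3 * D * 2 ^ K + D then
    3 * D * 2 ^ K + Γ.ord side (v - 3 * D * 2 ^ K) else v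

/-- The sequence of all blocks. -/
def sequence (side : Bool) : List ℕ := (List.range (2 ^ K)).flatMap (Γ.block side)

theorem mem_mid {side : Bool} {i v : ℕ} :
    v ∈ Γ.mid side i ↔ ∃ e < D, Γ.leaf side i e ∧ v = 3 * D * 2 ^ K + e := by
  simp only [mid, List.mem_flatMap, List.mem_range]
  constructor
  · rintro ⟨e, he, h⟩
    split_ifs at h with hl
    · exact ⟨_, Γ.ord_lt side e he, hl, by simpa using h⟩
    · simp at h
  · rintro ⟨e, he, hl, rfl⟩
    refine ⟨Γ.ord side e, Γ.ord_lt side e he, ?_⟩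
    rw [Γ.ord_ord side e he, if_pos hl]
    simp

theorem _root_.LCISBlocks.mem_high {side : Bool} {i v : ℕ} :
    v ∈ high D K side i ↔ v ≤ mirror D K ∧ mirror D K - v ∈ low D K side (2 ^ K - 1 - i) := by
  simp only [high, List.mem_reverse, List.mem_map]
  constructor
  · rintro ⟨u, hu, rfl⟩
    have := low_lt hu
    refine ⟨Nat.sub_le _ _, ?_⟩
    rwa [Nat.sub_sub_self]
    unfold mirror; omega
  · rintro ⟨hv, h⟩
    exact ⟨_, h, Nat.sub_sub_self hv⟩

theorem _root_.LCISBlocks.lt_of_mem_high {side : Bool} {i v : ℕ} (h : v ∈ high D K side i) :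
    3 * D * 2 ^ K + D < v ∧ v ≤ mirror D K := by
  obtain ⟨h1, h2⟩ := mem_high.1 h
  have := low_lt h2
  unfold mirror at *
  omega

/-- `key` replaces a gadget value by its position in the gadget and fixes all separator values. The
three value ranges are disjoint and appear in increasing order. -/
theorem block_pairwise (side : Bool) (i : ℕ) :
    (Γ.block side i).Pairwise fun v v' => Γ.key side v < Γ.key side v' := by
  have kl : ∀ v, v < 3 * D * 2 ^ K → Γ.key side v = v := fun v hv => by
    rw [key, if_neg (by omega)]
  have kh : ∀ v, 3 * D * 2 ^ K + D < v → Γ.key side v = v := fun v hv => by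
    rw [key, if_neg (by omega)]
  have km : ∀ e < D, Γ.key side (3 * D * 2 ^ K + e) = 3 * D * 2 ^ K + Γ.ord side e :=
    fun e he => by rw [key, if_pos (by omega), Nat.add_sub_cancel_left]
  rw [block, List.pairwise_append, List.pairwise_append]
  refine ⟨?_, ⟨?_, ?_, fun v hv v' hv' => ?_⟩, fun v hv v' hv' => ?_⟩
  · refine low_pairwise.imp_of_mem fun {v v'} hv hv' h => ?_
    rwa [kl v (low_lt hv), kl v' (low_lt hv')]
  · rw [mid, List.pairwise_flatMap]
    refine ⟨fun e _ => by split_ifs <;> simp, ?_⟩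
    refine List.pairwise_lt_range.imp_of_mem fun {e e'} he he' hlt v hv v' hv' => ?_
    rw [List.mem_range] at he he'
    have hm : ∀ e < D, ∀ v, v ∈ (if Γ.leaf side i (Γ.ord side e) then
        [3 * D * 2 ^ K + Γ.ord side e] else []) → Γ.key side v = 3 * D * 2 ^ K + e := by
      intro e he v hv
      split_ifs at hv
      · rw [List.mem_singleton] at hv
        rw [hv, km _ (Γ.ord_lt side e he), Γ.ord_ord side e he]
      · simp at hv
    rw [hm e he v hv, hm e' he' v' hv']
    omega
  · rw [high, List.pairwise_reverse, List.pairwise_map]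
    refine low_pairwise.imp_of_mem fun {v v'} hv hv' h => ?_
    have h1 := low_lt hv
    have h2 := low_lt hv'
    rw [kh _ (by unfold mirror; omega), kh _ (by unfold mirror; omega)]
    unfold mirror; omega
  · obtain ⟨e, he, -, rfl⟩ := Γ.mem_mid.1 hv
    have := lt_of_mem_high hv'
    rw [km e he, kh v' this.1]
    have := Γ.ord_lt side e he
    omega
  · have h1 := low_lt hv
    rw [kl v h1]
    rcases List.mem_append.1 hv' with hv' | hv'
    · obtain ⟨e, he, -, rfl⟩ := Γ.mem_mid.1 hv'
      rw [km e he]; omega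
    · have := lt_of_mem_high hv'
      rw [kh v' this.1]; omega

/-! ### The LCIS of the sequences of blocks -/

/-- `S` is a chain in the gadgets with numbers `i` and `j`. -/
def Good (i j : ℕ) (S : Finset ℕ) : Prop :=
  (∀ e ∈ S, e < D ∧ Γ.leaf false i e ∧ Γ.leaf true j e) ∧
    ∀ side, ∀ e ∈ S, ∀ e' ∈ S, e < e' → Γ.ord side e < Γ.ord side e'

/-- The length of a longest common increasing subsequence of the two sequences of blocks. -/
noncomputable def value : ℕ :=
  lcis ((Γ.sequence false).map (↑)) ((Γ.sequence true).map (↑))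

theorem mem_block_low {side : Bool} {i v : ℕ} (h : v ∈ Γ.block side i)
    (hv : v < 3 * D * 2 ^ K) : v ∈ low D K side i := by
  simp only [block, List.mem_append] at h
  rcases h with h | h | h
  · exact h
  · obtain ⟨e, he, -, rfl⟩ := Γ.mem_mid.1 h
    omega
  · have := lt_of_mem_high h
    omega

theorem mem_block_mid {side : Bool} {i v : ℕ} (h : v ∈ Γ.block side i)
    (hv : 3 * D * 2 ^ K ≤ v) (hv' : v < 3 * D * 2 ^ K + D) :
    Γ.leaf side i (v - 3 * D * 2 ^ K) := by
  simp only [block, List.mem_append] at h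
  rcases h with h | h | h
  · have := low_lt h; omega
  · obtain ⟨e, he, hl, rfl⟩ := Γ.mem_mid.1 h
    rwa [Nat.add_sub_cancel_left]
  · have := lt_of_mem_high h
    omega

theorem mem_block_high {side : Bool} {i v : ℕ} (h : v ∈ Γ.block side i)
    (hv : 3 * D * 2 ^ K + D ≤ v) : v ≤ mirror D K ∧
    mirror D K - v ∈ low D K side (2 ^ K - 1 - i) := by
  simp only [block, List.mem_append] at h
  rcases h with h | h | h
  · have := low_lt h; omega
  · obtain ⟨e, he, hl, rfl⟩ := Γ.mem_mid.1 h
    omega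
  · exact mem_high.1 h

/-- A longest chain is cut by value into a low, a gadget and a high part. The low part is bounded by
its end positions, the high part, after mirroring, by its start positions, and any advance in
between costs D per block. -/
theorem value_lt {H : ℕ} (hH : 0 < H)
    (h : ∀ i < 2 ^ K, ∀ j < 2 ^ K, ∀ S, Γ.Good i j S → S.card < H) :
    Γ.value < D * (2 * (2 ^ K - 1)) + H := by
  obtain ⟨S, I, J, hI, hJ, hcard⟩ := exists_card_eq_lcis (n := 2 ^ K)
    (fun i _ => Γ.block_pairwise false i) (fun i _ => Γ.block_pairwise true i)
  rw [value, sequence, sequence, ← hcard]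
  set n := 2 ^ K with hn
  set c := 3 * D * n with hc
  have hn1 : 0 < n := by positivity
  have monoX : ∀ v ∈ S, ∀ v' ∈ S, v < v' → I v ≤ I v' := fun v hv v' hv' hlt => by
    have := hI.lex v hv v' hv' hlt; omega
  have monoY : ∀ v ∈ S, ∀ v' ∈ S, v < v' → J v ≤ J v' := fun v hv v' hv' hlt => by
    have := hJ.lex v hv v' hv' hlt; omega
  have bI : ∀ v ∈ S, I v ≤ n - 1 := fun v hv => by have := hI.lt v hv; omega
  have bJ : ∀ v ∈ S, J v ≤ n - 1 := fun v hv => by have := hJ.lt v hv; omega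
  -- The low values end by (i₁, j₁), the high values start no earlier than (i₂, j₂), and gadget
  -- values are placed between the two.
  obtain ⟨i₂, hi₂, j₂, hj₂, hL₂, hR₂⟩ := exists_split monoX monoY bI bJ (c + D)
  obtain ⟨i₁, hi₁, j₁, hj₁, hL₁, hR₁⟩ := exists_split (S := S.filter (· < c + D))
    (fun v hv v' hv' => monoX v (Finset.mem_filter.1 hv).1 v' (Finset.mem_filter.1 hv').1)
    (fun v hv v' hv' => monoY v (Finset.mem_filter.1 hv).1 v' (Finset.mem_filter.1 hv').1)
    (fun v hv => (hL₂ v (Finset.mem_filter.1 hv).1 (Finset.mem_filter.1 hv).2).1)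
    (fun v hv => (hL₂ v (Finset.mem_filter.1 hv).1 (Finset.mem_filter.1 hv).2).2) c
  have hlow : (S.filter (· < c)).card ≤ D * (i₁ + j₁) := by
    have hch : LowChain D K (S.filter (· < c)) I J :=
      ⟨fun v hv => Γ.mem_block_low (hI.mem v (Finset.mem_filter.1 hv).1) (Finset.mem_filter.1 hv).2,
       fun v hv => Γ.mem_block_low (hJ.mem v (Finset.mem_filter.1 hv).1) (Finset.mem_filter.1 hv).2,
       fun v hv v' hv' => monoX v (Finset.mem_filter.1 hv).1 v' (Finset.mem_filter.1 hv').1,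
       fun v hv v' hv' => monoY v (Finset.mem_filter.1 hv).1 v' (Finset.mem_filter.1 hv').1⟩
    have hsub : ∀ v ∈ S.filter (· < c), I v ≤ i₁ ∧ J v ≤ j₁ := fun v hv => by
      have hv := Finset.mem_filter.1 hv
      exact hL₁ v (Finset.mem_filter.2 ⟨hv.1, by omega⟩) hv.2
    exact hch.card_le (fun v hv => (hsub v hv).1) (fun v hv => (hsub v hv).2)
  have hhigh : (S.filter (c + D ≤ ·)).card ≤ D * ((n - 1 - i₂) + (n - 1 - j₂)) := by
    have hb : ∀ v ∈ S.filter (c + D ≤ ·), v ≤ mirror D K := fun v hv =>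
      (Γ.mem_block_high (hI.mem v (Finset.mem_filter.1 hv).1) (Finset.mem_filter.1 hv).2).1
    have hinj : Set.InjOn (mirror D K - ·) (S.filter (c + D ≤ ·)) := fun v hv v' hv' hvv => by
      have h1 := hb v hv
      have h2 := hb v' hv'
      simp only at hvv
      omega
    rw [← Finset.card_image_of_injOn hinj]
    -- Mirroring reverses both the values and the numbering of the blocks, so monotonicity is
    -- preserved.
    have hch : LowChain D K ((S.filter (c + D ≤ ·)).image (mirror D K - ·))
        (fun v => n - 1 - I (mirror D K - v)) (fun v => n - 1 - J (mirror D K - v)) := by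
      refine ⟨?_, ?_, ?_, ?_⟩
      · intro u hu
        obtain ⟨v, hv, rfl⟩ := Finset.mem_image.1 hu
        rw [Nat.sub_sub_self (hb v hv)]
        exact (Γ.mem_block_high (hI.mem v (Finset.mem_filter.1 hv).1)
          (Finset.mem_filter.1 hv).2).2
      · intro u hu
        obtain ⟨v, hv, rfl⟩ := Finset.mem_image.1 hu
        rw [Nat.sub_sub_self (hb v hv)]
        exact (Γ.mem_block_high (hJ.mem v (Finset.mem_filter.1 hv).1)
          (Finset.mem_filter.1 hv).2).2
      · intro u hu u' hu' hlt
        obtain ⟨v, hv, rfl⟩ := Finset.mem_image.1 hu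
        obtain ⟨v', hv', rfl⟩ := Finset.mem_image.1 hu'
        rw [Nat.sub_sub_self (hb v hv), Nat.sub_sub_self (hb v' hv')]
        have := monoX v' (Finset.mem_filter.1 hv').1 v (Finset.mem_filter.1 hv).1 (by omega)
        omega
      · intro u hu u' hu' hlt
        obtain ⟨v, hv, rfl⟩ := Finset.mem_image.1 hu
        obtain ⟨v', hv', rfl⟩ := Finset.mem_image.1 hu'
        rw [Nat.sub_sub_self (hb v hv), Nat.sub_sub_self (hb v' hv')]
        have := monoY v' (Finset.mem_filter.1 hv').1 v (Finset.mem_filter.1 hv).1 (by omega)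
        omega
    refine hch.card_le (fun u hu => ?_) (fun u hu => ?_)
    · obtain ⟨v, hv, rfl⟩ := Finset.mem_image.1 hu
      rw [Nat.sub_sub_self (hb v hv)]
      have := (hR₂ v (Finset.mem_filter.1 hv).1 (Finset.mem_filter.1 hv).2).1
      omega
    · obtain ⟨v, hv, rfl⟩ := Finset.mem_image.1 hu
      rw [Nat.sub_sub_self (hb v hv)]
      have := (hR₂ v (Finset.mem_filter.1 hv).1 (Finset.mem_filter.1 hv).2).2
      omega
  set M := S.filter fun v => c ≤ v ∧ v < c + D with hM
  have hMD : M.card ≤ D := card_le_of_bounds (a := c) fun v hv => (Finset.mem_filter.1 hv).2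
  have hsum : S.card ≤ (S.filter (· < c)).card + M.card + (S.filter (c + D ≤ ·)).card := by
    have : S ⊆ S.filter (· < c) ∪ M ∪ S.filter (c + D ≤ ·) := fun v hv => by
      simp only [hM, Finset.mem_union, Finset.mem_filter, hv, true_and]; omega
    exact (Finset.card_le_card this).trans
      ((Finset.card_union_le _ _).trans (Nat.add_le_add_right (Finset.card_union_le _ _) _))
  by_cases heq : i₁ = i₂ ∧ j₁ = j₂
  · obtain ⟨rfl, rfl⟩ := heq
    have hpos : ∀ v ∈ M, I v = i₁ ∧ J v = j₁ := fun v hv => by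
      have hv := Finset.mem_filter.1 hv
      have h1 := hL₂ v hv.1 hv.2.2
      have h2 := hR₁ v (Finset.mem_filter.2 ⟨hv.1, hv.2.2⟩) hv.2.1
      omega
    have hinj : Set.InjOn (· - c) (M : Set ℕ) := fun v hv v' hv' hvv => by
      have h1 := (Finset.mem_filter.1 hv).2
      have h2 := (Finset.mem_filter.1 hv').2
      simp only at hvv
      omega
    have hgood : Γ.Good i₁ j₁ (M.image (· - c)) := by
      constructor
      · intro e he
        obtain ⟨v, hv, rfl⟩ := Finset.mem_image.1 he
        have hv' := Finset.mem_filter.1 hv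
        refine ⟨by omega, ?_, ?_⟩
        · rw [← (hpos v hv).1]
          exact Γ.mem_block_mid (hI.mem v hv'.1) hv'.2.1 hv'.2.2
        · rw [← (hpos v hv).2]
          exact Γ.mem_block_mid (hJ.mem v hv'.1) hv'.2.1 hv'.2.2
      · intro side e he e' he' hlt
        obtain ⟨v, hv, rfl⟩ := Finset.mem_image.1 he
        obtain ⟨v', hv', rfl⟩ := Finset.mem_image.1 he'
        have p1 := hpos v hv
        have p2 := hpos v' hv'
        have hv := Finset.mem_filter.1 hv
        have hv' := Finset.mem_filter.1 hv'
        have hkey : Γ.key side v < Γ.key side v' := by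
          cases side
          · have := hI.lex v hv.1 v' hv'.1 (by omega); omega
          · have := hJ.lex v hv.1 v' hv'.1 (by omega); omega
        rw [key, key, if_pos hv.2, if_pos hv'.2] at hkey
        exact Nat.lt_of_add_lt_add_left hkey
    have hlt := h i₁ (by omega) j₁ (by omega) _ hgood
    rw [Finset.card_image_of_injOn hinj] at hlt
    have : D * (i₁ + j₁) + D * ((n - 1 - i₁) + (n - 1 - j₁)) = D * (2 * (n - 1)) := by
      rw [← mul_add]; congr 1; omega
    omega
  -- Here i₁ + j₁ + 1 ≤ i₂ + j₂, so the separators lose at least D, which the at most D gadget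
  -- values cannot exceed. The inequality is strict because H is positive.
  · have : D * (i₁ + j₁) + D + D * ((n - 1 - i₂) + (n - 1 - j₂)) ≤ D * (2 * (n - 1)) := by
      calc _ = D * (i₁ + j₁ + 1 + ((n - 1 - i₂) + (n - 1 - j₂))) := by ring
        _ ≤ _ := Nat.mul_le_mul_left _ (by omega)
    omega

/-- A low chain up to (i, j), the gadget chain at (i, j), and the mirror image of a low chain up to
the positions (i, j) counted from the end fit together. -/
theorem le_value {i j : ℕ} (hi : i < 2 ^ K) (hj : j < 2 ^ K) {S : Finset ℕ} (hS : Γ.Good i j S) :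
    D * (2 * (2 ^ K - 1)) + S.card ≤ Γ.value := by
  set n := 2 ^ K with hn
  set c := 3 * D * n with hc
  obtain ⟨L, IL, JL, hL, cL, bL⟩ := exists_lowChain (D := D) hi hj
  obtain ⟨R, IR, JR, hR, cR, bR⟩ := exists_lowChain (D := D) (K := K)
    (i := n - 1 - i) (j := n - 1 - j) (by omega) (by omega)
  have hLlt : ∀ v ∈ L, v < c := fun v hv => low_lt (hL.memX v hv)
  have hRlt : ∀ v ∈ R, v < c := fun v hv => low_lt (hR.memX v hv)
  have hmir : mirror D K = 2 * c + D := rfl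
  set M := S.image (c + ·) with hM
  set U := R.image (mirror D K - ·) with hU
  have hMb : ∀ v ∈ M, c ≤ v ∧ v < c + D := fun v hv => by
    obtain ⟨e, he, rfl⟩ := Finset.mem_image.1 hv
    have := (hS.1 e he).1
    omega
  have hUb : ∀ v ∈ U, c + D < v ∧ v ≤ mirror D K ∧ mirror D K - v ∈ R := fun v hv => by
    obtain ⟨u, hu, rfl⟩ := Finset.mem_image.1 hv
    have := hRlt u hu
    refine ⟨by omega, by omega, ?_⟩
    rwa [Nat.sub_sub_self (by omega)]
  have hcard : (L ∪ M ∪ U).card = D * (2 * (n - 1)) + S.card := by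
    rw [Finset.card_union_of_disjoint, Finset.card_union_of_disjoint, cL, hM, hU,
      Finset.card_image_of_injective _ (add_right_injective c), Finset.card_image_of_injOn, cR]
    · have : D * (i + j) + D * ((n - 1 - i) + (n - 1 - j)) = D * (2 * (n - 1)) := by
        rw [← mul_add]; congr 1; omega
      omega
    · intro v hv v' hv' hvv
      have h1 := hRlt v hv
      have h2 := hRlt v' hv'
      simp only at hvv
      omega
    · refine Finset.disjoint_left.2 fun v hv hv' => ?_
      have := hLlt v hv; have := hMb v hv'; omega
    · refine Finset.disjoint_left.2 fun v hv hv' => ?_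
      have := hUb v hv'
      rcases Finset.mem_union.1 hv with hv | hv
      · have := hLlt v hv; omega
      · have := hMb v hv; omega
  rw [← hcard]
  -- Positions of the combined chain on one side; `placed` treats both sides at once.
  let pos (iL : ℕ → ℕ) (i : ℕ) (iR : ℕ → ℕ) (v : ℕ) : ℕ :=
    if v < c then iL v else if v < c + D then i else n - 1 - iR (mirror D K - v)
  have placed : ∀ (side : Bool) (iL iR : ℕ → ℕ) (i : ℕ), i < n →
      (∀ v ∈ L, v ∈ low D K side (iL v)) → (∀ v ∈ R, v ∈ low D K side (iR v)) →
      (∀ v ∈ L, iL v ≤ i) → (∀ v ∈ R, iR v ≤ n - 1 - i) →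
      (∀ v ∈ L, ∀ v' ∈ L, v < v' → iL v ≤ iL v') → (∀ v ∈ R, ∀ v' ∈ R, v < v' → iR v ≤ iR v') →
      (∀ e ∈ S, Γ.leaf side i e) →
      Placed n (Γ.block side) (Γ.key side) (L ∪ M ∪ U) (pos iL i iR) := by
    intro side iL iR i hi mL mR bL bR oL oR mS
    have pL : ∀ v ∈ L, pos iL i iR v = iL v := fun v hv => if_pos (hLlt v hv)
    have pM : ∀ v ∈ M, pos iL i iR v = i := fun v hv => by
      have := hMb v hv
      simp only [pos]; rw [if_neg (by omega), if_pos (by omega)]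
    have pU : ∀ v ∈ U, pos iL i iR v = n - 1 - iR (mirror D K - v) := fun v hv => by
      have := hUb v hv
      simp only [pos]; rw [if_neg (by omega), if_neg (by omega)]
    have kN : ∀ v, ¬ (c ≤ v ∧ v < c + D) → Γ.key side v = v := fun v hv => if_neg hv
    have kM : ∀ v, c ≤ v ∧ v < c + D → Γ.key side v = c + Γ.ord side (v - c) := fun v hv =>
      if_pos hv
    have kMlt : ∀ v, c ≤ v ∧ v < c + D → Γ.key side v < c + D := fun v hv => by
      rw [kM v hv]; have := Γ.ord_lt side (v - c) (by omega); omega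
    have kMge : ∀ v, c ≤ v ∧ v < c + D → c ≤ Γ.key side v := fun v hv => by
      rw [kM v hv]; omega
    refine ⟨?_, ?_, ?_⟩
    · intro v hv
      rcases Finset.mem_union.1 hv with hv | hv
      · rcases Finset.mem_union.1 hv with hv | hv
        · rw [pL v hv]; have := bL v hv; omega
        · rw [pM v hv]; exact hi
      · rw [pU v hv]; omega
    · intro v hv
      simp only [block, List.mem_append]
      rcases Finset.mem_union.1 hv with hv | hv
      · rcases Finset.mem_union.1 hv with hv | hv
        · rw [pL v hv]; exact Or.inl (mL v hv)
        · rw [pM v hv]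
          obtain ⟨e, he, rfl⟩ := Finset.mem_image.1 hv
          exact Or.inr (Or.inl (Γ.mem_mid.2 ⟨e, (hS.1 e he).1, mS e he, rfl⟩))
      · rw [pU v hv]
        have h1 := hUb v hv
        refine Or.inr (Or.inr (mem_high.2 ⟨h1.2.1, ?_⟩))
        have := bR _ h1.2.2
        rw [← hn, show n - 1 - (n - 1 - iR (mirror D K - v)) = iR (mirror D K - v) by omega]
        exact mR _ h1.2.2
    · intro v hv v' hv' hlt
      have key_le : pos iL i iR v ≤ pos iL i iR v' ∧ Γ.key side v < Γ.key side v' := by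
        rcases Finset.mem_union.1 hv with hv | hv
        · rcases Finset.mem_union.1 hv with hv | hv
          · have h1 := hLlt v hv
            have h2 := bL v hv
            rw [pL v hv, kN v (by omega)]
            rcases Finset.mem_union.1 hv' with hv' | hv'
            · rcases Finset.mem_union.1 hv' with hv' | hv'
              · have := hLlt v' hv'
                rw [pL v' hv', kN v' (by omega)]
                exact ⟨oL v hv v' hv' hlt, hlt⟩
              · rw [pM v' hv']
                have := kMge v' (hMb v' hv')
                omega
            · have h3 := hUb v' hv'
              have := bR _ h3.2.2
              rw [pU v' hv', kN v' (by omega)]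
              omega
          · have h1 := hMb v hv
            rw [pM v hv]
            rcases Finset.mem_union.1 hv' with hv' | hv'
            · rcases Finset.mem_union.1 hv' with hv' | hv'
              · have := hLlt v' hv'; omega
              · rw [pM v' hv', kM v h1, kM v' (hMb v' hv')]
                obtain ⟨e, he, rfl⟩ := Finset.mem_image.1 hv
                obtain ⟨e', he', rfl⟩ := Finset.mem_image.1 hv'
                simp only [Nat.add_sub_cancel_left]
                have := hS.2 side e he e' he' (by simpa using hlt)
                omega
            · have h3 := hUb v' hv'
              have := bR _ h3.2.2
              have := kMlt v h1
              rw [pU v' hv', kN v' (by omega)]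
              omega
        · have h1 := hUb v hv
          rw [pU v hv, kN v (by omega)]
          rcases Finset.mem_union.1 hv' with hv' | hv'
          · rcases Finset.mem_union.1 hv' with hv' | hv'
            · have := hLlt v' hv'; omega
            · have := hMb v' hv'; omega
          · have h3 := hUb v' hv'
            rw [pU v' hv', kN v' (by omega)]
            have := oR _ h3.2.2 _ h1.2.2 (by omega)
            omega
      omega
  exact card_le_lcis (fun i _ => Γ.block_pairwise false i) (fun i _ => Γ.block_pairwise true i)
    (placed false IL IR i hi hL.memX hR.memX (fun v hv => (bL v hv).1) (fun v hv => (bR v hv).1)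
      hL.monoX hR.monoX fun e he => (hS.1 e he).2.1)
    (placed true JL JR j hj hL.memY hR.memY (fun v hv => (bL v hv).2) (fun v hv => (bR v hv).2)
      hL.monoY hR.monoY fun e he => (hS.1 e he).2.2)

end Gadgets

end LCISBlocks

/-! ### Reachability as a formula -/

namespace Reachability

/-- The leaf with number `e` of the reachability formula of depth `d`: a pair of nodes and a layer.
The digits of `e` select an intermediate node and one of the two halves of the path. -/
def leafOf (W : ℕ) : ℕ → ℕ → ℕ → ℕ → ℕ → ℕ × ℕ × ℕ
  | 0, u, v, k, _ => (u, v, k)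
  | d + 1, u, v, k, e =>
    if e / (2 * W) ^ d % 2 = 0 then leafOf W d u (e / (2 * W) ^ d / 2) k (e % (2 * W) ^ d)
    else leafOf W d (e / (2 * W) ^ d / 2) v (k + 2 ^ d) (e % (2 * W) ^ d)

/-- The number of a leaf with the order of the intermediate nodes reversed. -/
def flipOrd (W : ℕ) : ℕ → ℕ → ℕ
  | 0, e => e
  | d + 1, e => (2 * (W - 1 - e / (2 * W) ^ d / 2) + e / (2 * W) ^ d % 2) * (2 * W) ^ d +
      flipOrd W d (e % (2 * W) ^ d)

/-- There is a path of length `2 ^ d` from node `u` of layer `k` to the node `v`. -/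
def Reach (W : ℕ) (step : ℕ → ℕ → ℕ → Prop) : ℕ → ℕ → ℕ → ℕ → Prop
  | 0, k, u, v => step k u v
  | d + 1, k, u, v => ∃ w < W, Reach W step d k u w ∧ Reach W step d (k + 2 ^ d) w v

variable {W : ℕ}

theorem flip_digit_lt {q : ℕ} (h : q < 2 * W) :
    2 * (W - 1 - q / 2) + q % 2 + 1 ≤ 2 * W := by omega

theorem flip_flip_digit {q : ℕ} (h : q < 2 * W) :
    2 * (W - 1 - (2 * (W - 1 - q / 2) + q % 2) / 2) + (2 * (W - 1 - q / 2) + q % 2) % 2 = q := by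
  omega

theorem digits_lt {d e : ℕ} (h : e < (2 * W) ^ (d + 1)) :
    e / (2 * W) ^ d < 2 * W ∧ e % (2 * W) ^ d < (2 * W) ^ d ∧ 0 < (2 * W) ^ d := by
  have hpos : 0 < (2 * W) ^ d := by
    rcases Nat.eq_zero_or_pos W with rfl | hW
    · simp [pow_succ] at h
    · positivity
  refine ⟨?_, Nat.mod_lt _ hpos, hpos⟩
  rw [Nat.div_lt_iff_lt_mul hpos, ← pow_succ']
  exact h

theorem flipOrd_lt {d e : ℕ} (h : e < (2 * W) ^ d) : flipOrd W d e < (2 * W) ^ d := by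
  induction d generalizing e with
  | zero => exact h
  | succ d ih =>
    obtain ⟨h1, h2, h3⟩ := digits_lt h
    have h4 := ih h2
    rw [flipOrd]
    set P := (2 * W) ^ d
    have h6 := Nat.mul_le_mul_right P (flip_digit_lt h1)
    rw [pow_succ', ← show P = (2 * W) ^ d from rfl]
    rw [add_mul, one_mul] at h6
    omega

/-- Reversal acts digit by digit in base 2W: a digit is 2 * node + half, and only the node is
reversed. The half keeps its order because both halves are needed, one after the other. -/
theorem flipOrd_digits {d e : ℕ} (h : e < (2 * W) ^ (d + 1)) :
    flipOrd W (d + 1) e / (2 * W) ^ d = 2 * (W - 1 - e / (2 * W) ^ d / 2) + e / (2 * W) ^ d % 2 ∧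
      flipOrd W (d + 1) e % (2 * W) ^ d = flipOrd W d (e % (2 * W) ^ d) := by
  obtain ⟨h1, h2, h3⟩ := digits_lt h
  have h4 := flipOrd_lt h2
  rw [flipOrd]
  constructor
  · rw [mul_comm, Nat.mul_add_div h3, Nat.div_eq_of_lt h4, add_zero]
  · rw [mul_comm, Nat.mul_add_mod, Nat.mod_eq_of_lt h4]

theorem flipOrd_flipOrd {d e : ℕ} (h : e < (2 * W) ^ d) : flipOrd W d (flipOrd W d e) = e := by
  induction d generalizing e with
  | zero => rfl
  | succ d ih =>
    obtain ⟨h1, h2, h3⟩ := digits_lt h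
    obtain ⟨h4, h5⟩ := flipOrd_digits h
    conv_lhs => rw [flipOrd]
    rw [h4, h5, ih h2]
    rw [flip_flip_digit h1, mul_comm]
    exact Nat.div_add_mod e _

/-- A set of leaves that is increasing in both orders. -/
structure Inc (W d : ℕ) (S : Finset ℕ) : Prop where
  lt : ∀ e ∈ S, e < (2 * W) ^ d
  inc : ∀ e ∈ S, ∀ e' ∈ S, e < e' → flipOrd W d e < flipOrd W d e'

/-- All leaves in `S` are satisfied. -/
def Sat (W : ℕ) (step : ℕ → ℕ → ℕ → Prop) (d k u v : ℕ) (S : Finset ℕ) : Prop :=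
  ∀ e ∈ S, step (leafOf W d u v k e).2.2 (leafOf W d u v k e).1 (leafOf W d u v k e).2.1

variable {step : ℕ → ℕ → ℕ → Prop}

/-- Two leaves in a common increasing set use the same intermediate node. -/
theorem Inc.node_eq {d : ℕ} {S : Finset ℕ} (h : Inc W (d + 1) S) {e e' : ℕ} (he : e ∈ S)
    (he' : e' ∈ S) : e / (2 * W) ^ d / 2 = e' / (2 * W) ^ d / 2 := by
  wlog hlt : e < e' generalizing e e'
  · rcases (not_lt.1 hlt).lt_or_eq with hlt' | rfl
    · exact (this he' he hlt').symm
    · rfl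
  have h1 := h.inc e he e' he' hlt
  -- In the first order the node cannot decrease; in the second, W - 1 - node cannot decrease.
  have h2 : e / (2 * W) ^ d ≤ e' / (2 * W) ^ d := Nat.div_le_div_right hlt.le
  have h3 : flipOrd W (d + 1) e / (2 * W) ^ d ≤ flipOrd W (d + 1) e' / (2 * W) ^ d :=
    Nat.div_le_div_right h1.le
  have h4 := digits_lt (h.lt e he)
  have h5 := digits_lt (h.lt e' he')
  rw [(flipOrd_digits (h.lt e he)).1, (flipOrd_digits (h.lt e' he')).1] at h3
  omega

/-- All elements share the node, so those of one half share the whole leading digit, and both orders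
compare them by the remaining digits. -/
theorem Inc.half {d : ℕ} {S : Finset ℕ} (h : Inc W (d + 1) S) (b : ℕ) :
    Inc W d ((S.filter fun e => e / (2 * W) ^ d % 2 = b).image (· % (2 * W) ^ d)) ∧
      ((S.filter fun e => e / (2 * W) ^ d % 2 = b).image (· % (2 * W) ^ d)).card =
        (S.filter fun e => e / (2 * W) ^ d % 2 = b).card := by
  have hdig : ∀ e ∈ S.filter (fun e => e / (2 * W) ^ d % 2 = b),
      ∀ e' ∈ S.filter (fun e => e / (2 * W) ^ d % 2 = b),
        e / (2 * W) ^ d = e' / (2 * W) ^ d := fun e he e' he' => by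
    rw [Finset.mem_filter] at he he'
    have := h.node_eq he.1 he'.1
    omega
  refine ⟨⟨fun r hr => ?_, fun r hr r' hr' hlt => ?_⟩, Finset.card_image_of_injOn ?_⟩
  · obtain ⟨e, he, rfl⟩ := Finset.mem_image.1 hr
    exact (digits_lt (h.lt e (Finset.mem_filter.1 he).1)).2.1
  · obtain ⟨e, he, rfl⟩ := Finset.mem_image.1 hr
    obtain ⟨e', he', rfl⟩ := Finset.mem_image.1 hr'
    have h1 := hdig e he e' he'
    rw [Finset.mem_filter] at he he'
    have h2 : e < e' := by
      rw [← Nat.div_add_mod e ((2 * W) ^ d), ← Nat.div_add_mod e' ((2 * W) ^ d), h1]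
      exact Nat.add_lt_add_left hlt _
    have h3 := h.inc e he.1 e' he'.1 h2
    have h4 : flipOrd W (d + 1) e / (2 * W) ^ d = flipOrd W (d + 1) e' / (2 * W) ^ d := by
      rw [(flipOrd_digits (h.lt e he.1)).1, (flipOrd_digits (h.lt e' he'.1)).1, h1]
    rw [← Nat.div_add_mod (flipOrd W (d + 1) e) ((2 * W) ^ d),
      ← Nat.div_add_mod (flipOrd W (d + 1) e') ((2 * W) ^ d), h4,
      (flipOrd_digits (h.lt e he.1)).2, (flipOrd_digits (h.lt e' he'.1)).2] at h3
    exact Nat.lt_of_add_lt_add_left h3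
  · intro e he e' he' heq
    have h1 := hdig e he e' he'
    simp only at heq
    rw [← Nat.div_add_mod e ((2 * W) ^ d), ← Nat.div_add_mod e' ((2 * W) ^ d), h1, heq]

/-- The common node w splits S into sets for the two subformulas with endpoints (u, w) and (w, v).
Each has at most 2 ^ d elements, and the maximal total forces both to be maximal. -/
theorem Inc.card_le {d : ℕ} {S : Finset ℕ} (h : Inc W d S) {k u v : ℕ}
    (hS : Sat W step d k u v S) : S.card ≤ 2 ^ d ∧ (S.card = 2 ^ d → Reach W step d k u v) := by
  induction d generalizing S k u v with
  | zero =>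
    have hsub : S ⊆ {0} := fun e he => by have := h.lt e he; simp at this ⊢; exact this
    refine ⟨by simpa using Finset.card_le_card hsub, fun hc => ?_⟩
    obtain ⟨e, he⟩ := Finset.card_pos.1 (show 0 < S.card by rw [hc]; norm_num)
    exact hS e he
  | succ d ih =>
    rcases S.eq_empty_or_nonempty with rfl | ⟨e₀, he₀⟩
    · refine ⟨by simp, fun hc => ?_⟩
      have : 0 < 2 ^ (d + 1) := by positivity
      rw [← hc] at this
      exact absurd this (by simp)
    set w := e₀ / (2 * W) ^ d / 2 with hw
    have hw' : ∀ e ∈ S, e / (2 * W) ^ d / 2 = w := fun e he => h.node_eq he he₀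
    have hwW : w < W := by have := (digits_lt (h.lt e₀ he₀)).1; omega
    obtain ⟨i0, c0⟩ := h.half 0
    obtain ⟨i1, c1⟩ := h.half 1
    have hsum : S.card = (S.filter fun e => e / (2 * W) ^ d % 2 = 0).card +
        (S.filter fun e => e / (2 * W) ^ d % 2 = 1).card := by
      rw [← S.card_filter_add_card_filter_not (fun e => e / (2 * W) ^ d % 2 = 0)]
      congr 2
      ext e
      simp
    obtain ⟨l0, r0⟩ := ih i0 (k := k) (u := u) (v := w) fun r hr => by
      obtain ⟨e, he, rfl⟩ := Finset.mem_image.1 hr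
      rw [Finset.mem_filter] at he
      have := hS e he.1
      rwa [leafOf, if_pos he.2, hw' e he.1] at this
    obtain ⟨l1, r1⟩ := ih i1 (k := k + 2 ^ d) (u := w) (v := v) fun r hr => by
      obtain ⟨e, he, rfl⟩ := Finset.mem_image.1 hr
      rw [Finset.mem_filter] at he
      have := hS e he.1
      rwa [leafOf, if_neg (by omega), hw' e he.1] at this
    rw [c0] at l0 r0
    rw [c1] at l1 r1
    rw [pow_succ]
    exact ⟨by omega, fun hc => ⟨w, hwW, r0 (by omega), r1 (by omega)⟩⟩

/-- The sets for the two halves of the path are shifted to the leading digits 2 * w and 2 * w + 1.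
These are consecutive in both orders. -/
theorem Reach.exists_inc {d k u v : ℕ} (h : Reach W step d k u v) :
    ∃ S, Inc W d S ∧ Sat W step d k u v S ∧ S.card = 2 ^ d := by
  induction d generalizing k u v with
  | zero => exact ⟨{0}, ⟨by simp, by simp⟩, fun e _ => h, by simp⟩
  | succ d ih =>
    obtain ⟨w, hw, h0, h1⟩ := h
    obtain ⟨S0, i0, s0, c0⟩ := ih h0
    obtain ⟨S1, i1, s1, c1⟩ := ih h1
    set P := (2 * W) ^ d with hP
    have hPpos : 0 < P := by have : 0 < W := by omega
                             positivity
    have dig : ∀ c r, r < P → (P * c + r) / P = c ∧ (P * c + r) % P = r := fun c r hr => by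
      constructor
      · rw [Nat.mul_add_div hPpos, Nat.div_eq_of_lt hr, add_zero]
      · rw [Nat.mul_add_mod, Nat.mod_eq_of_lt hr]
    have hfl : ∀ c r, r < P → flipOrd W (d + 1) (P * c + r) =
        P * (2 * (W - 1 - c / 2) + c % 2) + flipOrd W d r := fun c r hr => by
      rw [flipOrd, ← hP, (dig c r hr).1, (dig c r hr).2, mul_comm]
    have lt_of : ∀ c r, c < 2 * W → r < P → P * c + r < (2 * W) ^ (d + 1) := fun c r hc hr => by
      rw [pow_succ, ← hP]
      calc P * c + r < P * (c + 1) := by rw [mul_add, mul_one]; omega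
        _ ≤ _ := Nat.mul_le_mul_left _ hc
    have mem : ∀ e ∈ S0.image (P * (2 * w) + ·) ∪ S1.image (P * (2 * w + 1) + ·),
        ∃ r, r < P ∧ ((r ∈ S0 ∧ e = P * (2 * w) + r) ∨ (r ∈ S1 ∧ e = P * (2 * w + 1) + r)) := by
      intro e he
      rcases Finset.mem_union.1 he with he | he
      · obtain ⟨r, hr, rfl⟩ := Finset.mem_image.1 he
        exact ⟨r, i0.lt r hr, Or.inl ⟨hr, rfl⟩⟩
      · obtain ⟨r, hr, rfl⟩ := Finset.mem_image.1 he
        exact ⟨r, i1.lt r hr, Or.inr ⟨hr, rfl⟩⟩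
    have emul : P * (2 * w + 1) = P * (2 * w) + P := by ring
    refine ⟨S0.image (P * (2 * w) + ·) ∪ S1.image (P * (2 * w + 1) + ·),
      ⟨fun e he => ?_, fun e he e' he' hlt => ?_⟩, fun e he => ?_, ?_⟩
    · obtain ⟨r, hr, ⟨-, rfl⟩ | ⟨-, rfl⟩⟩ := mem e he
      · exact lt_of _ _ (by omega) hr
      · exact lt_of _ _ (by omega) hr
    · obtain ⟨r, hr, hre⟩ := mem e he
      obtain ⟨r', hr', hre'⟩ := mem e' he'
      have g0 : 2 * (W - 1 - 2 * w / 2) + 2 * w % 2 = 2 * (W - 1 - w) := by omega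
      have g1 : 2 * (W - 1 - (2 * w + 1) / 2) + (2 * w + 1) % 2 = 2 * (W - 1 - w) + 1 := by omega
      have f0 := flipOrd_lt hr
      have f1 := flipOrd_lt hr'
      rcases hre with ⟨hS, rfl⟩ | ⟨hS, rfl⟩ <;> rcases hre' with ⟨hS', rfl⟩ | ⟨hS', rfl⟩
      · rw [hfl _ _ hr, hfl _ _ hr']
        exact Nat.add_lt_add_left (i0.inc r hS r' hS' (by omega)) _
      · rw [hfl _ _ hr, hfl _ _ hr', g0, g1, mul_add, mul_one]
        omega
      · omega
      · rw [hfl _ _ hr, hfl _ _ hr']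
        exact Nat.add_lt_add_left (i1.inc r hS r' hS' (by omega)) _
    · obtain ⟨r, hr, ⟨hS, rfl⟩ | ⟨hS, rfl⟩⟩ := mem e he
      · have := s0 r hS
        rwa [leafOf, ← hP, (dig _ r hr).1, (dig _ r hr).2, if_pos (by omega),
          show 2 * w / 2 = w by omega]
      · have := s1 r hS
        rwa [leafOf, ← hP, (dig _ r hr).1, (dig _ r hr).2, if_neg (by omega),
          show (2 * w + 1) / 2 = w by omega]
    · rw [Finset.card_union_of_disjoint, Finset.card_image_of_injective _ (add_right_injective _),
        Finset.card_image_of_injective _ (add_right_injective _), c0, c1, pow_succ]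
      · omega
      · refine Finset.disjoint_left.2 fun e he he' => ?_
        obtain ⟨r, hr, rfl⟩ := Finset.mem_image.1 he
        obtain ⟨r', hr', heq⟩ := Finset.mem_image.1 he'
        have := i0.lt r hr
        omega

theorem leafOf_lt {d u v k e : ℕ} (hu : u < W) (hv : v < W) (he : e < (2 * W) ^ d) :
    (leafOf W d u v k e).1 < W ∧ (leafOf W d u v k e).2.1 < W ∧
      (leafOf W d u v k e).2.2 < k + 2 ^ d := by
  induction d generalizing u v k e with
  | zero => exact ⟨hu, hv, by simp [leafOf]⟩
  | succ d ih =>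
    obtain ⟨h1, h2, h3⟩ := digits_lt he
    rw [leafOf, pow_succ 2 d]
    split_ifs
    · have := ih (k := k) hu (show e / (2 * W) ^ d / 2 < W by omega) h2
      omega
    · have := ih (k := k + 2 ^ d) (show e / (2 * W) ^ d / 2 < W by omega) hv h2
      omega

theorem reach_iff_exists_path {d k u v : ℕ} (hu : u < W) (hv : v < W) :
    Reach W step d k u v ↔ ∃ π : ℕ → ℕ, (∀ l, π l < W) ∧ π k = u ∧ π (k + 2 ^ d) = v ∧
      ∀ l, k ≤ l → l < k + 2 ^ d → step l (π l) (π (l + 1)) := by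
  induction d generalizing k u v with
  | zero =>
    constructor
    · intro h
      refine ⟨fun l => if l ≤ k then u else v, fun l => by simp only; split_ifs <;> assumption,
        by simp, by simp, fun l h1 h2 => ?_⟩
      obtain rfl : l = k := by simp at h2; omega
      simp only
      rw [if_pos le_rfl, if_neg (by omega)]
      exact h
    · rintro ⟨π, -, rfl, rfl, h⟩
      exact h k le_rfl (by simp)
  | succ d ih =>
    have hpow : 2 ^ (d + 1) = 2 ^ d + 2 ^ d := by rw [pow_succ]; ring
    constructor
    · rintro ⟨w, hw, h0, h1⟩
      obtain ⟨π, a1, a2, a3, a4⟩ := (ih hu hw).1 h0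
      obtain ⟨π', b1, b2, b3, b4⟩ := (ih hw hv).1 h1
      have hpos : 0 < 2 ^ d := by positivity
      refine ⟨fun l => if l ≤ k + 2 ^ d then π l else π' l,
        fun l => by simp only; split_ifs <;> [exact a1 l; exact b1 l], by simp [a2], ?_, ?_⟩
      · simp only
        rw [if_neg (by omega), hpow, ← add_assoc, b3]
      · intro l h1 h2
        simp only
        rcases lt_trichotomy l (k + 2 ^ d) with hl | rfl | hl
        · rw [if_pos (by omega), if_pos (by omega)]
          exact a4 l h1 hl
        · rw [if_pos le_rfl, if_neg (by omega), a3, ← b2]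
          exact b4 _ le_rfl (by omega)
        · rw [if_neg (by omega), if_neg (by omega)]
          exact b4 l (by omega) (by omega)
    · rintro ⟨π, h1, h2, h3, h4⟩
      refine ⟨π (k + 2 ^ d), h1 _, (ih hu (h1 _)).2 ⟨π, h1, h2, rfl, fun l hl hl' => ?_⟩,
        (ih (h1 _) hv).2 ⟨π, h1, rfl, ?_, fun l hl hl' => ?_⟩⟩
      · exact h4 l hl (by omega)
      · rw [← h3, hpow, add_assoc]
      · exact h4 l (by omega) (by omega)

end Reachability

/-! ### Branching programs as families of gadgets -/

namespace BranchingProgram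

open Reachability LCISBlocks

variable {N W T : ℕ} (G : BranchingProgram N W T)

/-- The edges as a relation on natural numbers; layers after the last one are connected by
identities. -/
def stepRel (x : Fin N → Bool) (k u v : ℕ) : Prop :=
  if h : k < T - 1 ∧ u < W ∧ v < W then
    G.edge ⟨k, h.1⟩ ⟨u, h.2.1⟩ ⟨v, h.2.2⟩ (x (G.var ⟨k, h.1⟩)) = true
  else u = v

/-- Beyond the last layer only identity steps exist, so a path of length 2 ^ d is an accepting path
followed by waiting at the accept node. -/
theorem accepts_iff_reach {d : ℕ} (hd : T ≤ 2 ^ d) (x : Fin N → Bool) :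
    G.Accepts x ↔ Reach W (G.stepRel x) d 0 G.start G.accept := by
  rw [reach_iff_exists_path G.start.2 G.accept.2]
  have hT := G.length_pos
  constructor
  · rintro ⟨π, h0, h1, h2⟩
    refine ⟨fun k => if h : k < T then π ⟨k, h⟩ else G.accept, fun k => ?_, ?_, ?_, ?_⟩
    · simp only; split_ifs <;> exact Fin.isLt _
    · simp only; rw [dif_pos hT, h0]
    · simp only; rw [dif_neg (by omega)]
    · intro k _ hk
      by_cases hkT : k < T - 1
      · simp only
        rw [dif_pos (by omega), dif_pos (by omega), stepRel,
          dif_pos ⟨hkT, Fin.isLt _, Fin.isLt _⟩]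
        exact h2 ⟨k, hkT⟩
      · rw [stepRel, dif_neg (by omega)]
        simp only
        rw [dif_neg (show ¬ k + 1 < T by omega)]
        split_ifs with h
        · have : (⟨k, h⟩ : Fin T) = ⟨T - 1, by omega⟩ := Fin.ext (by simp only; omega)
          rw [this, h1]
        · rfl
  · rintro ⟨π, hW, h0, h1, h2⟩
    -- In the identity layers the path cannot move, so it reaches the accept node by layer T - 1.
    have hstay : ∀ k, T - 1 + k ≤ 2 ^ d → π (T - 1 + k) = π (T - 1) := by
      intro k
      induction k with
      | zero => intro _; rfl
      | succ k ih =>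
        intro hk
        have := h2 (T - 1 + k) (by omega) (by omega)
        rw [stepRel, dif_neg (by omega)] at this
        rw [← add_assoc, ← this, ih (by omega)]
    refine ⟨fun k => ⟨π k, hW k⟩, Fin.ext h0, Fin.ext ?_, fun k => ?_⟩
    · have := hstay (2 ^ d - (T - 1)) (by omega)
      rw [show T - 1 + (2 ^ d - (T - 1)) = 0 + 2 ^ d by omega, h1] at this
      exact this.symm
    · have := h2 k (by omega) (by omega)
      rw [stepRel, dif_pos ⟨k.2, hW _, hW _⟩] at this
      exact this

/-- The assignment given by the binary digits of two numbers. -/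
def assign (N K i j : ℕ) (x : Fin N) : Bool :=
  if (x : ℕ) < K then decide (i / 2 ^ (x : ℕ) % 2 = 1)
  else decide (j / 2 ^ ((x : ℕ) - K) % 2 = 1)

/-- Binary digits that belong to no variable, present when N < 2 * K, are set to 0. -/
theorem exists_assign {N K : ℕ} (hK : N ≤ 2 * K) (x : Fin N → Bool) :
    ∃ i < 2 ^ K, ∃ j < 2 ^ K, assign N K i j = x := by
  have key : ∀ f : ℕ → Bool, ∃ i < 2 ^ K, ∀ l < K, decide (i / 2 ^ l % 2 = 1) = f l := fun f =>
    ⟨Nat.ofBits fun l : Fin K => f l, Nat.ofBits_lt_two_pow _, fun l hl => by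
      rw [← Nat.testBit_eq_decide_div_mod_eq, Nat.testBit_ofBits_lt _ _ hl]⟩
  obtain ⟨i, hi, hi'⟩ := key fun l => if h : l < N then x ⟨l, h⟩ else false
  obtain ⟨j, hj, hj'⟩ := key fun l => if h : l + K < N then x ⟨l + K, h⟩ else false
  refine ⟨i, hi, j, hj, funext fun y => ?_⟩
  have := y.2
  unfold assign
  split_ifs with h
  · rw [hi' _ h, dif_pos y.2]
  · rw [hj' _ (by omega), dif_pos (by omega)]
    congr 1
    ext
    simp only
    omega

/-- The leaves of the gadgets: each side checks the edges that query its own variables. -/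
def leafSat (K : ℕ) (side : Bool) (i k u v : ℕ) : Bool :=
  if h : k < T - 1 ∧ u < W ∧ v < W then
    if (G.var ⟨k, h.1⟩ : ℕ) < K then
      side || G.edge ⟨k, h.1⟩ ⟨u, h.2.1⟩ ⟨v, h.2.2⟩
        (decide (i / 2 ^ (G.var ⟨k, h.1⟩ : ℕ) % 2 = 1))
    else
      !side || G.edge ⟨k, h.1⟩ ⟨u, h.2.1⟩ ⟨v, h.2.2⟩
        (decide (i / 2 ^ ((G.var ⟨k, h.1⟩ : ℕ) - K) % 2 = 1))
  else decide (u = v)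

/-- The queried variable belongs to one half; that side tests the edge and the other agrees. In the
identity layers both sides make the same test. -/
theorem leafSat_and_leafSat {K i j k u v : ℕ} :
    (G.leafSat K false i k u v ∧ G.leafSat K true j k u v) ↔
      G.stepRel (assign N K i j) k u v := by
  unfold leafSat stepRel assign
  split_ifs <;> simp

/-- The gadgets for a branching program. -/
def gadgets (K d : ℕ) : Gadgets ((2 * W) ^ d) K where
  ord side e := if side then flipOrd W d e else e
  ord_lt side e he := by
    cases side
    · exact he
    · exact flipOrd_lt he
  ord_ord side e he := by
    cases side
    · rfl
    · exact flipOrd_flipOrd he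
  leaf side i e := G.leafSat K side i (leafOf W d G.start G.accept 0 e).2.2
    (leafOf W d G.start G.accept 0 e).1 (leafOf W d G.start G.accept 0 e).2.1

/-- X lists the leaves by number, so its order adds no condition beyond that of Y. -/
theorem good_iff {K d i j : ℕ} {S : Finset ℕ} : (G.gadgets K d).Good i j S ↔
    Inc W d S ∧ Sat W (G.stepRel (assign N K i j)) d 0 G.start G.accept S := by
  constructor
  · rintro ⟨h1, h2⟩
    exact ⟨⟨fun e he => (h1 e he).1, h2 true⟩, fun e he => G.leafSat_and_leafSat.1 (h1 e he).2⟩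
  · rintro ⟨h1, h2⟩
    refine ⟨fun e he => ⟨h1.lt e he, G.leafSat_and_leafSat.2 (h2 e he)⟩, fun side => ?_⟩
    cases side
    · exact fun e _ e' _ h => h
    · exact h1.inc

/-- The reduction is correct. -/
theorem satisfiable_iff {K d : ℕ} (hK : N ≤ 2 * K) (hd : T ≤ 2 ^ d) :
    G.Satisfiable ↔ (2 * W) ^ d * (2 * (2 ^ K - 1)) + 2 ^ d ≤ (G.gadgets K d).value := by
  constructor
  · rintro ⟨x, hx⟩
    obtain ⟨i, hi, j, hj, rfl⟩ := exists_assign hK x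
    obtain ⟨S, h1, h2, h3⟩ := ((G.accepts_iff_reach hd _).1 hx).exists_inc
    rw [← h3]
    exact (G.gadgets K d).le_value hi hj (G.good_iff.2 ⟨h1, h2⟩)
  · intro h
    by_contra hn
    refine absurd ((G.gadgets K d).value_lt (H := 2 ^ d) (by positivity) ?_) (not_lt.2 h)
    intro i hi j hj S hS
    obtain ⟨h1, h2⟩ := G.good_iff.1 hS
    obtain ⟨h3, h4⟩ := h1.card_le h2
    refine h3.lt_of_ne fun hc => hn ⟨_, (G.accepts_iff_reach hd _).2 (h4 hc)⟩

end BranchingProgram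

/-! ### Evaluation of expressions and updates of states -/

namespace WordRAM

namespace Expr

instance : Add Expr := ⟨.bin .add⟩
instance : Sub Expr := ⟨.bin .sub⟩
instance : Mul Expr := ⟨.bin .mul⟩
instance : Div Expr := ⟨.bin .div⟩
instance : Mod Expr := ⟨.bin .mod⟩
instance (n : ℕ) : OfNat Expr n := ⟨.lit n⟩

variable (s : State) (a b : Expr)

theorem eval_add : (a + b).eval s = a.eval s + b.eval s := rfl
theorem eval_sub : (a - b).eval s = a.eval s - b.eval s := rfl
theorem eval_mul : (a * b).eval s = a.eval s * b.eval s := rfl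
theorem eval_div : (a / b).eval s = a.eval s / b.eval s := rfl
theorem eval_mod : (a % b).eval s = a.eval s % b.eval s := rfl
theorem eval_ofNat (n : ℕ) : (no_index (OfNat.ofNat n) : Expr).eval s = ((OfNat.ofNat n : ℕ) : ℤ) := rfl
theorem eval_zero : (0 : Expr).eval s = 0 := rfl
theorem eval_one : (1 : Expr).eval s = 1 := rfl
theorem eval_reg (r : ℕ) : (reg r).eval s = s.reg r := rfl
theorem eval_deref : (deref a).eval s = s.mem (a.eval s) := rfl
theorem eval_shr : (bin .shr a b).eval s = a.eval s / 2 ^ (b.eval s).toNat := rfl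

end Expr

theorem State.setReg_reg (s : State) (r : ℕ) (v : ℤ) (q : ℕ) :
    (s.setReg r v).reg q = if q = r then v else s.reg q := by
  simp [State.setReg, Function.update_apply]

theorem State.setReg_mem (s : State) (r : ℕ) (v : ℤ) : (s.setReg r v).mem = s.mem := rfl

theorem State.setMem_reg (s : State) (a v : ℤ) : (s.setMem a v).reg = s.reg := rfl

theorem State.setMem_mem (s : State) (a v : ℤ) :
    (s.setMem a v).mem = Function.update s.mem a v := rfl

/-! ### Writing lists -/

/-- The memory `m` with the list `L` written at address `P`. -/
def writeList (m : ℤ → ℤ) (P : ℤ) (L : List ℤ) (a : ℤ) : ℤ :=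
  if P ≤ a ∧ a < P + L.length then L.getD (a - P).toNat 0 else m a

theorem writeList_append_singleton (m : ℤ → ℤ) (P : ℤ) (L : List ℤ) (v : ℤ) :
    Function.update (writeList m P L) (P + L.length) v = writeList m P (L ++ [v]) := by
  funext a
  simp only [Function.update_apply, writeList, List.length_append, List.length_singleton]
  push_cast
  split_ifs with h1 h2 h3 h4 h5
  · subst h1
    simp
  · omega
  · rw [List.getD_append _ _ _ _ (by omega)]
  · omega
  · omega
  · rfl

theorem writeList_of_lt {m : ℤ → ℤ} {P : ℤ} {L : List ℤ} {a : ℤ} (h : a < P) :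
    writeList m P L a = m a := if_neg (by omega)

theorem writeList_set {m : ℤ → ℤ} {P : ℤ} {L : List ℤ} {k : ℕ} (hk : k < L.length) (v : ℤ) :
    Function.update (writeList m P L) (P + k) v = writeList m P (L.set k v) := by
  funext a
  simp only [Function.update_apply, writeList, List.length_set]
  split_ifs with h1 h2 h3
  · subst h1
    simp [hk]
  · omega
  · rw [List.getD_eq_getElem?_getD, List.getD_eq_getElem?_getD, List.getElem?_set_ne (by omega)]
  · rfl

/-- The memory of `s` is `m` with the list `L` written at address `P`, and register `12` points
behind this list. -/
structure Out (m : ℤ → ℤ) (P : ℤ) (L : List ℤ) (s : State) : Prop where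
  mem : s.mem = writeList m P L
  ptr : s.reg 12 = P + L.length

theorem Out.setReg {m : ℤ → ℤ} {P : ℤ} {L : List ℤ} {s : State} (h : Out m P L s) {r : ℕ}
    (hr : r ≠ 12) (v : ℤ) : Out m P L (s.setReg r v) :=
  ⟨h.mem, by rw [State.setReg_reg, if_neg hr.symm, h.ptr]⟩

namespace Wp

variable {V : ℤ} {p q : Stm} {s : State} {τ τ₁ τ₂ : ℕ} {a b e : Expr} {m : ℤ → ℤ} {P : ℤ}
  {L L₁ L₂ : List ℤ} {Q : State → Prop}

/-- A loop whose iterations write lists, in time linear in their lengths. -/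
theorem emit_loop {I : ℕ → State → Prop} {k α β : ℕ} {f : ℕ → List ℤ} (h0 : I 0 s)
    (hO : Out m P L s) (hV : P + (L.length + ((List.range k).flatMap f).length) ≤ V)
    (hbody : ∀ j < k, ∀ s' L', p.Frame s s' → I j s' → Out m P L' s' →
      P + (L'.length + (f j).length) ≤ V → a.eval s' < b.eval s' ∧
        Wp V p s' (α + β * (f j).length) (fun s'' => I (j + 1) s'' ∧ Out m P (L' ++ f j) s''))
    (hend : ∀ s', p.Frame s s' → I k s' → ¬ a.eval s' < b.eval s') :
    Wp V (.while a b p) s ((α + 1) * k + β * ((List.range k).flatMap f).length + 1)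
      (Out m P (L ++ (List.range k).flatMap f)) := by
  have hsum : ∀ j, ((List.range j).flatMap f).length = ∑ i ∈ Finset.range j, (f i).length := by
    intro j
    induction j with
    | zero => simp
    | succ j ih => rw [Finset.sum_range_succ, ← ih, List.range_succ]; simp
  have hlen : ∀ j ≤ k, ((List.range j).flatMap f).length ≤ ((List.range k).flatMap f).length := by
    intro j hj
    rw [hsum, hsum]
    exact Finset.sum_le_sum_of_subset (Finset.range_subset_range.2 hj)
  refine (while_sum (n := k) (τ := fun j => α + β * (f j).length)
    (I := fun j s' => I j s' ∧ Out m P (L ++ (List.range j).flatMap f) s')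
    ⟨h0, by simpa using hO⟩ (fun j hj s' hf hs => ?_) (fun s' hf hs => ⟨hend s' hf hs.1, hs.2⟩)).mono
      (fun _ _ h => h) ?_
  · have hj1 := hlen (j + 1) hj
    have hex : (List.range (j + 1)).flatMap f = (List.range j).flatMap f ++ f j := by
      rw [List.range_succ]; simp
    obtain ⟨h1, h2⟩ := hbody j hj s' _ hf hs.1 hs.2 (by
      rw [hex] at hj1
      simp only [List.length_append] at hj1 ⊢
      push_cast
      omega)
    refine ⟨h1, h2.mono (fun s'' _ h => ⟨h.1, ?_⟩) le_rfl⟩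
    rw [hex, ← List.append_assoc]
    exact h.2
  · rw [hsum, Finset.sum_add_distrib, Finset.sum_add_distrib, ← Finset.mul_sum]
    simp
    linarith

/-- The value `v` is appended to the output. -/
theorem emit (hO : Out m P L s) (he : e.eval s = τ) (hτ : (τ : ℤ) ≤ V)
    (hV : P + (L.length + 1) ≤ V) (hP : 0 ≤ P) :
    Wp V (.seq (.store (.reg 12) e) (.assign 12 (.reg 12 + 1))) s 2
      (Out m P (L ++ [(τ : ℤ)])) := by
  refine seq (τ₁ := 1) (store (by rw [he, abs_of_nonneg (by omega)]; exact hτ) (assign ?_ ?_))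
  · simp only [Expr.eval_add, Expr.eval_reg, Expr.eval_one, State.setMem_reg, hO.ptr]
    rw [abs_of_nonneg (by omega)]; omega
  · refine ⟨?_, ?_⟩
    · rw [State.setReg_mem, State.setMem_mem, Expr.eval_reg, hO.ptr, hO.mem, he,
        writeList_append_singleton]
    · simp [State.setReg_reg, Expr.eval_add, Expr.eval_reg, Expr.eval_one, State.setMem_reg, hO.ptr]
      ring

end Wp

/-- Write the numbers from `reg 17` to `reg 17 + reg 18 - 1`. -/
def emitRun : Stm :=
  .seq (.assign 16 0) (.while (.reg 16) (.reg 18)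
    (.seq (.seq (.store (.reg 12) (.reg 17 + .reg 16)) (.assign 12 (.reg 12 + 1)))
      (.assign 16 (.reg 16 + 1))))

theorem emitRun_spec {V : ℤ} {s : State} {m : ℤ → ℤ} {P : ℤ} {L : List ℤ} {st len : ℕ}
    (hO : Out m P L s) (hst : s.reg 17 = st) (hlen : s.reg 18 = len) (hb : (st + len : ℤ) ≤ V)
    (hV : P + (L.length + len) ≤ V) (hP : 0 ≤ P) :
    Wp V emitRun s (4 * len + 2) (Out m P (L ++ (List.range' st len).map (↑))) := by
  have hlist : (List.range' st len).map (fun x : ℕ => (x : ℤ)) =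
      (List.range len).flatMap fun j => [((st + j : ℕ) : ℤ)] := by
    rw [List.range'_eq_map_range, List.map_map, List.map_eq_flatMap]
    rfl
  rw [hlist]
  have hll : ((List.range len).flatMap fun j => [((st + j : ℕ) : ℤ)]).length = len := by
    rw [← hlist]; simp
  refine (Wp.assign_seq (by simp [Expr.eval_zero]; omega)
    (Wp.emit_loop (α := 3) (β := 0) (I := fun j s' => s'.reg 16 = j) ?_
      (hO.setReg (by norm_num) _) (by rw [hll]; exact hV) ?_ ?_)).mono (fun _ _ h => h) ?_
  · simp [State.setReg_reg, Expr.eval_zero]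
  · intro j hj s' L' hf hI hO' hV'
    have h17 : s'.reg 17 = st := by rw [hf.reg 17 rfl]; simpa [State.setReg_reg] using hst
    have h18 : s'.reg 18 = len := by rw [hf.reg 18 rfl]; simpa [State.setReg_reg] using hlen
    refine ⟨by simp only [Expr.eval_reg, hI, h18]; exact_mod_cast hj, ?_⟩
    refine (Wp.seq (Wp.mono (Wp.emit (τ := st + j) hO' ?_ ?_ ?_ hP) (fun s'' hf' h => ?_) le_rfl)
      (τ₁ := 2) (τ₂ := 1)).mono (fun _ _ h => h) (by omega)
    · simp [Expr.eval_add, Expr.eval_reg, h17, hI]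
    · push_cast; omega
    · simpa using hV'
    · have h16 : s''.reg 16 = j := by rw [hf'.reg 16 rfl, hI]
      refine Wp.assign ?_ ⟨?_, ?_⟩
      · simp only [Expr.eval_add, Expr.eval_reg, Expr.eval_one, h16]
        rw [abs_of_nonneg (by omega)]; omega
      · simp [State.setReg_reg, Expr.eval_add, Expr.eval_reg, Expr.eval_one, h16]
      · exact h.setReg (by norm_num) _
  · intro s' hf hI
    have h18 : s'.reg 18 = len := by rw [hf.reg 18 rfl]; simpa [State.setReg_reg] using hlen
    simp [Expr.eval_reg, hI, h18]
  · omega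

end WordRAM

/-! ### Programs that write separators -/

namespace WordRAM

open LCISBlocks

/-- Write a run of length `reg 18` that starts at `e`. -/
def emitAt (e : Expr) : Stm := .seq (.assign 17 e) emitRun

theorem emitAt_spec {V : ℤ} {s : State} {m : ℤ → ℤ} {P : ℤ} {L : List ℤ} {e : Expr} {st len : ℕ}
    (hO : Out m P L s) (he : e.eval s = st) (hlen : s.reg 18 = len) (hb : (st + len : ℤ) ≤ V)
    (hV : P + (L.length + len) ≤ V) (hP : 0 ≤ P) :
    Wp V (emitAt e) s (4 * len + 3) (Out m P (L ++ (List.range' st len).map (↑))) := by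
  refine (Wp.assign_seq (by rw [he, abs_of_nonneg] <;> omega)
    (emitRun_spec (hO.setReg (by norm_num) _) (by simp [State.setReg_reg, he])
      (by simpa [State.setReg_reg] using hlen) hb hV hP)).mono (fun _ _ h => h) le_rfl

def tokBase : Expr := 3 * .reg 9 * (.reg 10 - 2 * .reg 14)

def headExpr (side : Bool) : Expr :=
  tokBase + (if side then .reg 15 % 2 else 1 - .reg 15 % 2) * .reg 18

/-- Start of the mirrored run. The image of an interval under v ↦ M - v is again an interval, and it
is written from its lower end M + 1 - (start + length), with M the mirror constant. -/
def mirrorExpr (e : Expr) : Expr := 6 * .reg 9 * .reg 10 + .reg 9 + 1 - (e + .reg 18)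

/-- Write the part of weight `reg 14` of the separator with number `reg 13`. -/
def emitLowTok (side : Bool) : Stm :=
  .ite (.reg 13 % .reg 14) 1
    (.seq (.assign 15 (.reg 13 / .reg 14)) (.seq (.assign 18 (.reg 14 * .reg 9))
      (.seq (emitAt (headExpr side))
        (.ite (.reg 15 % 2) 1 .skip (emitAt (tokBase + 2 * .reg 18))))))
    .skip

/-- Write the mirror image of the part of weight `reg 14` of the separator with number `reg 33`. -/
def emitHighTok (side : Bool) : Stm :=
  .ite (.reg 33 % .reg 14) 1
    (.seq (.assign 15 (.reg 33 / .reg 14)) (.seq (.assign 18 (.reg 14 * .reg 9))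
      (.seq (.ite (.reg 15 % 2) 1 .skip (emitAt (mirrorExpr (tokBase + 2 * .reg 18))))
        (emitAt (mirrorExpr (headExpr side))))))
    .skip

/-- The registers with the parameters of the construction. -/
structure Params (D n : ℕ) (s : State) : Prop where
  D : s.reg 9 = D
  n : s.reg 10 = n

theorem Params.frame {D n : ℕ} {s s' : State} (h : Params D n s) {p : Stm} (hf : p.Frame s s')
    (h9 : p.mods 9 = false) (h10 : p.mods 10 = false) : Params D n s' :=
  ⟨by rw [hf.reg 9 h9, h.D], by rw [hf.reg 10 h10, h.n]⟩

theorem abs_natCast_le {V : ℤ} {x : ℕ} (h : (x : ℤ) ≤ V) : |(x : ℤ)| ≤ V := by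
  rwa [abs_of_nonneg (Int.natCast_nonneg x)]

theorem eval_mod_lt_one_iff {s : State} {i w x y : ℕ} (hx : s.reg x = i) (hy : s.reg y = w) :
    (Expr.reg x % Expr.reg y).eval s < (1 : Expr).eval s ↔ w ∣ i := by
  rw [Expr.eval_mod, Expr.eval_reg, Expr.eval_reg, Expr.eval_one, hx, hy, Nat.dvd_iff_mod_eq_zero]
  norm_cast
  omega

section

variable {V : ℤ} {D n w : ℕ} {s : State}

theorem eval_tokBase (h9 : s.reg 9 = D) (h10 : s.reg 10 = n) (h14 : s.reg 14 = w)
    (hw : 2 * w ≤ n) : tokBase.eval s = (3 * D * (n - 2 * w) : ℕ) := by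
  simp only [tokBase, Expr.eval_mul, Expr.eval_sub, Expr.eval_ofNat, Expr.eval_reg, h9, h10, h14]
  push_cast [Nat.cast_sub hw]
  ring

theorem eval_headExpr (h9 : s.reg 9 = D) (h10 : s.reg 10 = n) (h14 : s.reg 14 = w)
    (hw : 2 * w ≤ n) {k : ℕ} (h15 : s.reg 15 = k) (h18 : s.reg 18 = (w * D : ℕ)) (side : Bool) :
    (headExpr side).eval s = (tokStart D n w (headTok side k) : ℕ) := by
  have h : ((1 - k % 2 : ℕ) : ℤ) = 1 - k % 2 := by omega
  cases side <;>
    simp only [headExpr, Expr.eval_add, Expr.eval_mul, Expr.eval_sub, Expr.eval_mod,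
      Expr.eval_ofNat, Expr.eval_reg, eval_tokBase h9 h10 h14 hw, h15, h18, tokStart,
      headTok, if_true, if_false, Bool.false_eq_true] <;> push_cast [h] <;> ring

theorem eval_tailExpr (h9 : s.reg 9 = D) (h10 : s.reg 10 = n) (h14 : s.reg 14 = w)
    (hw : 2 * w ≤ n) (h18 : s.reg 18 = (w * D : ℕ)) :
    (tokBase + 2 * .reg 18).eval s = (tokStart D n w 2 : ℕ) := by
  simp only [Expr.eval_add, Expr.eval_mul, Expr.eval_ofNat, Expr.eval_reg,
    eval_tokBase h9 h10 h14 hw, h18, tokStart]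
  push_cast; ring

theorem tokStart_add_le (hw : 2 * w ≤ n) {τ : ℕ} (hτ : τ ≤ 2) :
    tokStart D n w τ + w * D ≤ 3 * D * n := by
  obtain ⟨c, rfl⟩ := Nat.exists_eq_add_of_le hw
  rw [tokStart, Nat.add_sub_cancel_left]
  have h := Nat.mul_le_mul_right (w * D) hτ
  have h1 : 3 * D * (2 * w + c) = 6 * (w * D) + 3 * D * c := by ring
  omega

theorem eval_mirrorExpr (h9 : s.reg 9 = D) (h10 : s.reg 10 = n) (h18 : s.reg 18 = (w * D : ℕ))
    {e : Expr} {st : ℕ} (he : e.eval s = st) (hst : st + w * D ≤ 3 * D * n) :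
    (mirrorExpr e).eval s = (2 * (3 * D * n) + D + 1 - (st + w * D) : ℕ) := by
  simp only [mirrorExpr, Expr.eval_add, Expr.eval_mul, Expr.eval_sub, Expr.eval_ofNat,
    Expr.eval_reg, h9, h10, h18, he]
  push_cast [Nat.cast_sub (show st + w * D ≤ 2 * (3 * D * n) + D + 1 by omega)]
  ring

variable {i : ℕ} {m : ℤ → ℤ} {P : ℤ} {L : List ℤ}

theorem mul_le_three (hw : 2 * w ≤ n) : w * D ≤ 3 * D * n := by
  calc w * D ≤ n * D := Nat.mul_le_mul_right _ (by omega)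
    _ ≤ 3 * (n * D) := by omega
    _ = _ := by ring

/-- The time is a constant plus a multiple of the output length. The constant is paid for every
weight, even where the separator has no token of it, and adds only O(K) per block. -/
theorem emitLowTok_spec (side : Bool) (hp : Params D n s) (h14 : s.reg 14 = w) (hw : 2 * w ≤ n)
    (h13 : s.reg 13 = i) (hi : (i : ℤ) ≤ V) (hVD : ((2 * (3 * D * n) + D + 1 : ℕ) : ℤ) ≤ V)
    (hO : Out m P L s) (hV : P + (L.length + (lowTok D n side i w).length) ≤ V) (hP : 0 ≤ P) :
    Wp V (emitLowTok side) s (11 + 4 * (lowTok D n side i w).length)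
      (Out m P (L ++ (lowTok D n side i w).map (↑))) := by
  have hwD := mul_le_three (D := D) hw
  have hdiv : i / w ≤ i := Nat.div_le_self _ _
  by_cases hd : w ∣ i
  · have hl : lowTok D n side i w = List.range' (tokStart D n w (headTok side (i / w))) (w * D) ++
        List.range' (tokStart D n w 2) (if i / w % 2 = 1 then w * D else 0) := if_pos hd
    rw [hl] at hV ⊢
    rw [List.length_append, List.length_range', List.length_range'] at hV ⊢
    have hs1 := tokStart_add_le (D := D) hw (show headTok side (i / w) ≤ 2 from
      (headTok_le _ _).trans one_le_two)
    have hs2 := tokStart_add_le (D := D) hw (le_refl 2)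
    refine (Wp.ite_pos (τ := (4 * (w * D) + 3) + (4 * (if i / w % 2 = 1 then w * D else 0) + 5) + 1 + 1)
      ((eval_mod_lt_one_iff h13 h14).2 hd) ?_).mono (fun _ _ h => h) (by omega)
    have e15 : (Expr.reg 13 / Expr.reg 14).eval s = (i / w : ℕ) := by
      simp [Expr.eval_div, Expr.eval_reg, h13, h14]
    refine Wp.assign_seq (by rw [e15]; exact abs_natCast_le (by omega)) ?_
    rw [e15]
    set s1 := s.setReg 15 (i / w : ℕ) with hs1'
    have e18 : (Expr.reg 14 * Expr.reg 9).eval s1 = (w * D : ℕ) := by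
      simp [Expr.eval_mul, Expr.eval_reg, hs1', State.setReg_reg, h14, hp.D]
    refine Wp.assign_seq (by rw [e18]; exact abs_natCast_le (by omega)) ?_
    rw [e18]
    set s2 := s1.setReg 18 (w * D : ℕ) with hs2'
    have r9 : s2.reg 9 = D := by simp [hs2', hs1', State.setReg_reg, hp.D]
    have r10 : s2.reg 10 = n := by simp [hs2', hs1', State.setReg_reg, hp.n]
    have r14 : s2.reg 14 = w := by simp [hs2', hs1', State.setReg_reg, h14]
    have r15 : s2.reg 15 = (i / w : ℕ) := by simp [hs2', hs1', State.setReg_reg]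
    have r18 : s2.reg 18 = (w * D : ℕ) := by simp [hs2', State.setReg_reg]
    have hO2 : Out m P L s2 := (hO.setReg (by norm_num) _).setReg (by norm_num) _
    refine Wp.seq ((emitAt_spec hO2 (eval_headExpr r9 r10 r14 hw r15 r18 side) r18
      (by omega) (by omega) hP).mono (fun s3 hf hO3 => ?_) le_rfl)
    have m3 : ∀ r, (emitAt (headExpr side)).mods r = false → s3.reg r = s2.reg r := hf.reg
    have q15 : (Expr.reg 15 % 2).eval s3 = ((i / w % 2 : ℕ) : ℤ) := by
      simp [Expr.eval_mod, Expr.eval_reg, Expr.eval_ofNat, m3 15 rfl, r15]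
    refine (Wp.ite (τ := 4 * (if i / w % 2 = 1 then w * D else 0) + 3) (fun hc => ?_)
      (fun hc => ?_)).mono (fun _ _ h => h) (by omega)
    · rw [q15, Expr.eval_one] at hc
      rw [if_neg (by omega)]
      exact (Wp.skip (by simpa using hO3)).mono (fun _ _ h => h) (by omega)
    · rw [q15, Expr.eval_one] at hc
      rw [if_pos (by omega)] at hV ⊢
      have := emitAt_spec (V := V) hO3 (eval_tailExpr ((m3 9 rfl).trans r9) ((m3 10 rfl).trans r10)
        ((m3 14 rfl).trans r14) hw ((m3 18 rfl).trans r18)) ((m3 18 rfl).trans r18)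
        (by omega) (by simp only [List.length_append, List.length_map, List.length_range']
                       push_cast at hV ⊢; omega) hP
      rw [List.map_append, ← List.append_assoc]
      exact this
  · have hl : lowTok D n side i w = [] := if_neg hd
    rw [hl]
    refine (Wp.ite_neg (fun h => hd ((eval_mod_lt_one_iff h13 h14).1 h)) (Wp.skip ?_)).mono
      (fun _ _ h => h) (by simp)
    simpa using hO

/-- Reversing and mirroring an interval. -/
theorem reverse_map_sub_range' {M st len : ℕ} (h : st + len ≤ M + 1) :
    ((List.range' st len).map (M - ·)).reverse = List.range' (M + 1 - (st + len)) len := by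
  refine List.ext_getElem (by simp) fun k h1 h2 => ?_
  simp at h1 h2 ⊢
  omega

theorem emitHighTok_spec (side : Bool) (hp : Params D n s) (h14 : s.reg 14 = w) (hw : 2 * w ≤ n)
    (h33 : s.reg 33 = i) (hi : (i : ℤ) ≤ V) (hVD : ((2 * (3 * D * n) + D + 1 : ℕ) : ℤ) ≤ V)
    (hO : Out m P L s) (hV : P + (L.length + (lowTok D n side i w).length) ≤ V) (hP : 0 ≤ P) :
    Wp V (emitHighTok side) s (11 + 4 * (lowTok D n side i w).length)
      (Out m P (L ++ (((lowTok D n side i w).map (2 * (3 * D * n) + D - ·)).reverse).map (↑))) := by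
  have hwD := mul_le_three (D := D) hw
  have hdiv : i / w ≤ i := Nat.div_le_self _ _
  by_cases hd : w ∣ i
  · have hl : lowTok D n side i w = List.range' (tokStart D n w (headTok side (i / w))) (w * D) ++
        List.range' (tokStart D n w 2) (if i / w % 2 = 1 then w * D else 0) := if_pos hd
    rw [hl] at hV ⊢
    rw [List.length_append, List.length_range', List.length_range'] at hV ⊢
    have hs1 := tokStart_add_le (D := D) hw (show headTok side (i / w) ≤ 2 from
      (headTok_le _ _).trans one_le_two)
    have hs2 := tokStart_add_le (D := D) hw (le_refl 2)
    rw [List.map_append, List.reverse_append, reverse_map_sub_range' (by split_ifs <;> omega),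
      reverse_map_sub_range' (by omega)]
    refine (Wp.ite_pos (τ := (4 * (if i / w % 2 = 1 then w * D else 0) + 5) + (4 * (w * D) + 3) + 1 + 1)
      ((eval_mod_lt_one_iff h33 h14).2 hd) ?_).mono (fun _ _ h => h) (by omega)
    have e15 : (Expr.reg 33 / Expr.reg 14).eval s = (i / w : ℕ) := by
      simp [Expr.eval_div, Expr.eval_reg, h33, h14]
    refine Wp.assign_seq (by rw [e15]; exact abs_natCast_le (by omega)) ?_
    rw [e15]
    set s1 := s.setReg 15 (i / w : ℕ) with hs1'
    have e18 : (Expr.reg 14 * Expr.reg 9).eval s1 = (w * D : ℕ) := by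
      simp [Expr.eval_mul, Expr.eval_reg, hs1', State.setReg_reg, h14, hp.D]
    refine Wp.assign_seq (by rw [e18]; exact abs_natCast_le (by omega)) ?_
    rw [e18]
    set s2 := s1.setReg 18 (w * D : ℕ) with hs2'
    have r9 : s2.reg 9 = D := by simp [hs2', hs1', State.setReg_reg, hp.D]
    have r10 : s2.reg 10 = n := by simp [hs2', hs1', State.setReg_reg, hp.n]
    have r14 : s2.reg 14 = w := by simp [hs2', hs1', State.setReg_reg, h14]
    have r15 : s2.reg 15 = (i / w : ℕ) := by simp [hs2', hs1', State.setReg_reg]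
    have r18 : s2.reg 18 = (w * D : ℕ) := by simp [hs2', State.setReg_reg]
    have hO2 : Out m P L s2 := (hO.setReg (by norm_num) _).setReg (by norm_num) _
    have q15 : (Expr.reg 15 % 2).eval s2 = ((i / w % 2 : ℕ) : ℤ) := by
      simp [Expr.eval_mod, Expr.eval_reg, Expr.eval_ofNat, r15]
    have hfirst : Wp V (.ite (.reg 15 % 2) 1 .skip (emitAt (mirrorExpr (tokBase + 2 * .reg 18)))) s2
        (4 * (if i / w % 2 = 1 then w * D else 0) + 3 + 1)
        (Out m P (L ++ (List.range' (2 * (3 * D * n) + D + 1 - (tokStart D n w 2 +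
          if i / w % 2 = 1 then w * D else 0)) (if i / w % 2 = 1 then w * D else 0)).map (↑))) := by
      refine Wp.ite (fun hc => ?_) (fun hc => ?_)
      · rw [q15, Expr.eval_one] at hc
        rw [if_neg (by omega)]
        exact (Wp.skip (by simpa using hO2)).mono (fun _ _ h => h) (by omega)
      · rw [q15, Expr.eval_one] at hc
        rw [if_pos (by omega)] at hV ⊢
        exact emitAt_spec hO2 (eval_mirrorExpr r9 r10 r18 (eval_tailExpr r9 r10 r14 hw r18) hs2) r18
          (by omega) (by push_cast at hV ⊢; omega) hP
    refine Wp.seq (hfirst.mono (fun s3 hf hO3 => ?_) (by omega))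
    have m3 := hf.reg
    have := emitAt_spec (V := V) hO3 (eval_mirrorExpr ((m3 9 rfl).trans r9) ((m3 10 rfl).trans r10)
        ((m3 18 rfl).trans r18) (eval_headExpr ((m3 9 rfl).trans r9) ((m3 10 rfl).trans r10)
        ((m3 14 rfl).trans r14) hw ((m3 15 rfl).trans r15) ((m3 18 rfl).trans r18) side) hs1)
        ((m3 18 rfl).trans r18) (by omega)
        (by simp only [List.length_append, List.length_map, List.length_range']
            push_cast at hV ⊢; omega) hP
    rw [List.map_append, ← List.append_assoc]
    exact this
  · have hl : lowTok D n side i w = [] := if_neg hd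
    rw [hl]
    refine (Wp.ite_neg (fun h => hd ((eval_mod_lt_one_iff h33 h14).1 h)) (Wp.skip ?_)).mono
      (fun _ _ h => h) (by simp)
    simpa using hO

end

/-- Write the separator with number `reg 13`. -/
def emitLow (side : Bool) : Stm :=
  .seq (.assign 14 (.reg 10 / 2))
    (.while 0 (.reg 14) (.seq (emitLowTok side) (.assign 14 (.reg 14 / 2))))

/-- Write the mirrored separator with number `reg 13`. -/
def emitHigh (side : Bool) : Stm :=
  .seq (.assign 33 (.reg 10 - 1 - .reg 13)) (.seq (.assign 14 1)
    (.while (.reg 14) (.reg 10) (.seq (emitHighTok side) (.assign 14 (.reg 14 + .reg 14)))))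

section

variable {V : ℤ} {D K : ℕ} {s : State} {i : ℕ} {m : ℤ → ℤ} {P : ℤ} {L : List ℤ}

/-- Makes room for the powers of two used as weights and as loop bounds. -/
theorem two_pow_le_cast (hD : 0 < D) (hVD : ((mirror D K + 1 : ℕ) : ℤ) ≤ V) :
    ((2 * 2 ^ K : ℕ) : ℤ) ≤ V := by
  refine le_trans ?_ hVD
  have : 1 * (2 * 2 ^ K) ≤ D * (2 * 2 ^ K) := Nat.mul_le_mul_right _ hD
  have h2 : mirror D K = 3 * (D * (2 * 2 ^ K)) + D := by unfold mirror; ring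
  have : 2 * 2 ^ K ≤ mirror D K + 1 := by omega
  exact_mod_cast this

theorem emitLow_spec (side : Bool) (hD : 0 < D) (hp : Params D (2 ^ K) s) (h13 : s.reg 13 = i)
    (hi : i < 2 ^ K) (hVD : ((mirror D K + 1 : ℕ) : ℤ) ≤ V)
    (hO : Out m P L s) (hV : P + (L.length + (low D K side i).length) ≤ V) (hP : 0 ≤ P) :
    Wp V (emitLow side) s (13 * K + 4 * (low D K side i).length + 2)
      (Out m P (L ++ (low D K side i).map (↑))) := by
  have hlist : (low D K side i).map (fun x : ℕ => (x : ℤ)) = (List.range K).flatMap fun j =>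
      (lowTok D (2 ^ K) side i (2 ^ (K - 1 - j))).map (Nat.cast : ℕ → ℤ) := by rw [low, List.map_flatMap]
  have hlen : (low D K side i).length = ((List.range K).flatMap fun j =>
      (lowTok D (2 ^ K) side i (2 ^ (K - 1 - j))).map (Nat.cast : ℕ → ℤ)).length := by
    rw [← hlist, List.length_map]
  rw [hlist, hlen]
  have h2n := two_pow_le_cast hD hVD
  have e14 : (Expr.reg 10 / 2).eval s = (2 ^ K / 2 : ℕ) := by
    simp [Expr.eval_div, Expr.eval_reg, Expr.eval_ofNat, hp.n]
  have hpow : ∀ j < K, 2 ^ K / 2 ^ (j + 1) = 2 ^ (K - 1 - j) := fun j hj => by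
    rw [Nat.pow_div (by omega) (by norm_num)]; congr 1; omega
  refine (Wp.assign_seq ?_ (Wp.emit_loop (α := 12) (β := 4)
    (I := fun j s' => s'.reg 14 = (2 ^ K / 2 ^ (j + 1) : ℕ)) ?_
      (hO.setReg (by norm_num) _) (by rw [← hlen]; exact hV) ?_ ?_)).mono (fun _ _ h => h) ?_
  · rw [e14, abs_of_nonneg (by omega)]
    omega
  · simp [State.setReg_reg, e14]
  · intro j hj s' L' hf hI hO' hV'
    rw [hpow j hj] at hI
    have hp' : Params D (2 ^ K) s' := Params.frame ⟨by simp [State.setReg_reg, hp.D],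
      by simp [State.setReg_reg, hp.n]⟩ hf rfl rfl
    have r13 : s'.reg 13 = i := by rw [hf.reg 13 rfl]; simpa [State.setReg_reg] using h13
    have hw : 2 * 2 ^ (K - 1 - j) ≤ 2 ^ K := by
      rw [← pow_succ']; exact Nat.pow_le_pow_right (by norm_num) (by omega)
    refine ⟨by simp only [Expr.eval_reg, hI, Expr.eval_zero]; positivity, ?_⟩
    rw [List.length_map] at hV' ⊢
    refine (Wp.seq ((emitLowTok_spec side hp' hI hw r13 (by omega) hVD hO' hV' hP).mono
      (fun s'' hf' h => ?_) le_rfl) (τ₂ := 1)).mono (fun _ _ h => h) (by omega)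
    have r14 : s''.reg 14 = (2 ^ (K - 1 - j) : ℕ) := by
      rw [hf'.reg 14 rfl, hI]
    have e : (Expr.reg 14 / 2).eval s'' = (2 ^ K / 2 ^ (j + 1 + 1) : ℕ) := by
      rw [Expr.eval_div, Expr.eval_reg, r14, ← hpow j hj, pow_succ 2 (j + 1),
        ← Nat.div_div_eq_div_mul]
      simp [Expr.eval_ofNat]
    refine Wp.assign ?_ ⟨?_, h.setReg (by norm_num) _⟩
    · rw [e]
      have : 2 ^ K / 2 ^ (j + 1 + 1) ≤ 2 ^ K := Nat.div_le_self _ _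
      exact abs_natCast_le (by omega)
    · simp [State.setReg_reg, e]
  · intro s' hf hI
    have : 2 ^ K / 2 ^ (K + 1) = 0 := Nat.div_eq_of_lt (Nat.pow_lt_pow_right (by norm_num) (by omega))
    simp [Expr.eval_reg, Expr.eval_zero, hI, this]
  · omega

/-- Reversal of a concatenation reverses the order of the weights, so the mirrored separator can be
written from light to heavy without storing the original. -/
theorem high_eq (side : Bool) : high D K side i = (List.range K).flatMap fun j =>
    ((lowTok D (2 ^ K) side (2 ^ K - 1 - i) (2 ^ j)).map (mirror D K - ·)).reverse := by
  have key : ∀ k, ∀ f : ℕ → List ℕ, ((List.range k).flatMap fun j => f (k - 1 - j)).reverse =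
      (List.range k).flatMap fun j => (f j).reverse := by
    intro k f
    induction k with
    | zero => rfl
    | succ k ih =>
      rw [List.range_succ_eq_map, List.flatMap_cons, List.flatMap_map, List.reverse_append,
        ← List.range_succ_eq_map, List.range_succ, List.flatMap_append, ← ih]
      simp [Nat.sub_sub, add_comm]
  rw [high, low, List.map_flatMap]
  exact key K fun j => (lowTok D (2 ^ K) side (2 ^ K - 1 - i) (2 ^ j)).map (mirror D K - ·)

theorem emitHigh_spec (side : Bool) (hD : 0 < D) (hp : Params D (2 ^ K) s) (h13 : s.reg 13 = i)
    (hi : i < 2 ^ K) (hVD : ((mirror D K + 1 : ℕ) : ℤ) ≤ V)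
    (hO : Out m P L s) (hV : P + (L.length + (high D K side i).length) ≤ V) (hP : 0 ≤ P) :
    Wp V (emitHigh side) s (13 * K + 4 * (high D K side i).length + 3)
      (Out m P (L ++ (high D K side i).map (↑))) := by
  have hlist : (high D K side i).map (fun x : ℕ => (x : ℤ)) = (List.range K).flatMap fun j =>
      (((lowTok D (2 ^ K) side (2 ^ K - 1 - i) (2 ^ j)).map (mirror D K - ·)).reverse).map
        (Nat.cast : ℕ → ℤ) := by
    rw [high_eq, List.map_flatMap]
  have hlen : (high D K side i).length = ((List.range K).flatMap fun j =>
      (((lowTok D (2 ^ K) side (2 ^ K - 1 - i) (2 ^ j)).map (mirror D K - ·)).reverse).map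
        (Nat.cast : ℕ → ℤ)).length := by
    rw [← hlist, List.length_map]
  rw [hlist, hlen]
  have h2n := two_pow_le_cast hD hVD
  have e33 : (Expr.reg 10 - 1 - Expr.reg 13).eval s = (2 ^ K - 1 - i : ℕ) := by
    simp only [Expr.eval_sub, Expr.eval_reg, Expr.eval_one, hp.n, h13]
    omega
  refine (Wp.assign_seq ?_ (Wp.assign_seq ?_ (Wp.emit_loop (α := 12) (β := 4)
    (I := fun j s' => s'.reg 14 = (2 ^ j : ℕ)) ?_
      ((hO.setReg (by norm_num) _).setReg (by norm_num) _)
      (by rw [← hlen]; exact hV) ?_ ?_))).mono (fun _ _ h => h) ?_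
  · rw [e33, abs_of_nonneg (by omega)]
    omega
  · rw [Expr.eval_one, abs_of_nonneg (by omega)]
    have : 0 < 2 ^ K := by positivity
    omega
  · simp [State.setReg_reg, Expr.eval_one]
  · intro j hj s' L' hf hI hO' hV'
    have hp' : Params D (2 ^ K) s' := Params.frame ⟨by simp [State.setReg_reg, hp.D],
      by simp [State.setReg_reg, hp.n]⟩ hf rfl rfl
    have r33 : s'.reg 33 = (2 ^ K - 1 - i : ℕ) := by
      rw [hf.reg 33 rfl, ← e33]; simp [State.setReg_reg]
    have hw : 2 * 2 ^ j ≤ 2 ^ K := by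
      rw [← pow_succ']; exact Nat.pow_le_pow_right (by norm_num) (by omega)
    have hpos : 0 < 2 ^ j := by positivity
    refine ⟨by simp only [Expr.eval_reg, hI, hp'.n]; exact_mod_cast (by omega), ?_⟩
    rw [List.length_map, List.length_reverse, List.length_map] at hV' ⊢
    refine (Wp.seq ((emitHighTok_spec side hp' hI hw r33 (by omega) hVD hO' hV' hP).mono
      (fun s'' hf' h => ?_) le_rfl) (τ₂ := 1)).mono (fun _ _ h => h) (by omega)
    have r14 : s''.reg 14 = (2 ^ j : ℕ) := by
      rw [hf'.reg 14 rfl, hI]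
    have e : (Expr.reg 14 + Expr.reg 14).eval s'' = (2 ^ (j + 1) : ℕ) := by
      rw [Expr.eval_add, Expr.eval_reg, r14, pow_succ]; push_cast; ring
    refine Wp.assign ?_ ⟨?_, h.setReg (by norm_num) _⟩
    · rw [e, abs_of_nonneg (by omega), pow_succ]
      omega
    · simp [State.setReg_reg, e]
  · intro s' hf hI
    have : s'.reg 10 = (2 ^ K : ℕ) := by rw [hf.reg 10 rfl]; simpa [State.setReg_reg] using hp.n
    simp [Expr.eval_reg, hI, this]
  · omega

end

end WordRAM

/-! ### Programs that write gadgets -/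

namespace WordRAM

open LCISBlocks Reachability

variable {N W T : ℕ}

/-- The order of the leaves on the two sides. -/
def sideOrd (W : ℕ) (side : Bool) (d e : ℕ) : ℕ := if side then flipOrd W d e else e

/-- The first intermediate node selected by the position with leading digit `q`. -/
def sideNode (W : ℕ) (side : Bool) (q : ℕ) : ℕ := if side then W - 1 - q / 2 else q / 2

theorem sideOrd_lt {side : Bool} {d e : ℕ} (h : e < (2 * W) ^ d) :
    sideOrd W side d e < (2 * W) ^ d := by
  cases side
  · exact h
  · exact flipOrd_lt h

theorem sideOrd_succ (side : Bool) {d e : ℕ} :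
    sideOrd W side (d + 1) e =
      (2 * sideNode W side (e / (2 * W) ^ d) + e / (2 * W) ^ d % 2) * (2 * W) ^ d +
        sideOrd W side d (e % (2 * W) ^ d) := by
  cases side
  · simp only [sideOrd, sideNode, Bool.false_eq_true, if_false]
    rw [Nat.div_add_mod (e / (2 * W) ^ d) 2, mul_comm, Nat.div_add_mod]
  · simp only [sideOrd, sideNode, if_true]
    rw [flipOrd]

theorem sideOrd_digits (side : Bool) {d e : ℕ} (h : e < (2 * W) ^ (d + 1)) :
    sideOrd W side (d + 1) e / (2 * W) ^ d =
      2 * sideNode W side (e / (2 * W) ^ d) + e / (2 * W) ^ d % 2 ∧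
    sideOrd W side (d + 1) e % (2 * W) ^ d = sideOrd W side d (e % (2 * W) ^ d) := by
  obtain ⟨h1, h2, h3⟩ := digits_lt h
  have h4 := sideOrd_lt (side := side) h2
  rw [sideOrd_succ]
  constructor
  · rw [mul_comm, Nat.mul_add_div h3, Nat.div_eq_of_lt h4, add_zero]
  · rw [mul_comm, Nat.mul_add_mod, Nat.mod_eq_of_lt h4]

theorem sideNode_lt {side : Bool} {q : ℕ} (h : q < 2 * W) : sideNode W side q < W := by
  cases side <;> simp [sideNode] <;> omega

/-- The registers with the parameters of the branching program. -/
structure BPParams (G : BranchingProgram N W T) (K d : ℕ) (s : State) : Prop where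
  width : s.reg 3 = W
  length : s.reg 4 = T
  start : s.reg 5 = (G.start : ℕ)
  accept : s.reg 6 = (G.accept : ℕ)
  stride : s.reg 7 = (1 + 2 * (W * W) : ℕ)
  half : s.reg 8 = (2 ^ d : ℕ)
  leaves : s.reg 9 = ((2 * W) ^ d : ℕ)
  blocks : s.reg 10 = (2 ^ K : ℕ)
  vars : s.reg 11 = (K : ℕ)

variable {G : BranchingProgram N W T} {K d : ℕ} {s s' : State}

theorem BPParams.congr (h : BPParams G K d s) (hr : ∀ r < 12, 3 ≤ r → s'.reg r = s.reg r) :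
    BPParams G K d s' := by
  constructor <;> rw [hr _ (by norm_num) (by norm_num)]
  exacts [h.width, h.length, h.start, h.accept, h.stride, h.half, h.leaves, h.blocks, h.vars]

/-- The side condition is a closed Boolean computation on the syntax of the program. -/
theorem BPParams.frame (h : BPParams G K d s) {p : Stm} (hf : p.Frame s s')
    (hp : (List.range 12).all (fun r => decide (r < 3) || !p.mods r) = true) :
    BPParams G K d s' := by
  refine h.congr fun r hr hr' => hf.reg r ?_
  have := List.all_eq_true.1 hp r (List.mem_range.2 hr)
  simpa [not_lt.2 hr'] using this

theorem BPParams.setReg (h : BPParams G K d s) {r : ℕ} (hr : 12 ≤ r) (v : ℤ) :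
    BPParams G K d (s.setReg r v) :=
  h.congr fun q hq _ => by rw [State.setReg_reg, if_neg (by omega)]

/-- The parameters of the construction are bounded by `V`. -/
structure Bounds (N W T K d : ℕ) (V : ℤ) : Prop where
  W_pos : 0 < W
  vars : (N : ℤ) ≤ V
  width : (W : ℤ) ≤ V
  length : (T : ℤ) ≤ V
  mirror : ((LCISBlocks.mirror ((2 * W) ^ d) K + 1 : ℕ) : ℤ) ≤ V

theorem Bounds.D_pos {V : ℤ} (h : Bounds N W T K d V) : 0 < (2 * W) ^ d := by
  have := h.W_pos; positivity

theorem Bounds.D {V : ℤ} (h : Bounds N W T K d V) : (((2 * W) ^ d : ℕ) : ℤ) ≤ V := by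
  refine le_trans ?_ h.mirror
  rw [LCISBlocks.mirror]
  push_cast
  have : (0 : ℤ) ≤ 2 * (3 * (2 * W) ^ d * 2 ^ K) := by positivity
  linarith

theorem Bounds.H {V : ℤ} (h : Bounds N W T K d V) : ((2 ^ d : ℕ) : ℤ) ≤ V := by
  refine le_trans ?_ h.D
  have := h.W_pos
  exact_mod_cast Nat.pow_le_pow_left (show 2 ≤ 2 * W by omega) d

/-- One step of the descent in the formula. -/
def descendStep (side : Bool) : Stm :=
  .seq (.assign 24 (.reg 24 / (2 * .reg 3)))
  (.seq (.assign 23 (.reg 23 / 2))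
  (.seq (.assign 27 (.reg 25 / .reg 24))
  (.seq (.assign 25 (.reg 25 % .reg 24))
  (.seq (.assign 28 (if side then .reg 3 - 1 - .reg 27 / 2 else .reg 27 / 2))
  (.seq (.assign 26 (.reg 26 + (2 * .reg 28 + .reg 27 % 2) * .reg 24))
  (.ite (.reg 27 % 2) 1 (.assign 21 (.reg 28))
    (.seq (.assign 20 (.reg 28)) (.assign 22 (.reg 22 + .reg 23)))))))))

/-- Find the leaf at position `reg 19`. -/
def descend (side : Bool) : Stm :=
  .seq (.assign 20 (.reg 5)) (.seq (.assign 21 (.reg 6)) (.seq (.assign 22 0)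
  (.seq (.assign 23 (.reg 8)) (.seq (.assign 24 (.reg 9)) (.seq (.assign 25 (.reg 19))
  (.seq (.assign 26 0) (.while 1 (.reg 23) (descendStep side))))))))

/-- The state of the descent after `j` steps, at position `e`. -/
def DescendInv (G : BranchingProgram N W T) (d : ℕ) (side : Bool) (e j : ℕ) (s : State) : Prop :=
  ∃ u v k rem acc : ℕ, s.reg 20 = u ∧ s.reg 21 = v ∧ s.reg 22 = k ∧
    s.reg 23 = (2 ^ (d - j) : ℕ) ∧ s.reg 24 = ((2 * W) ^ (d - j) : ℕ) ∧ s.reg 25 = rem ∧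
    s.reg 26 = acc ∧ u < W ∧ v < W ∧ rem < (2 * W) ^ (d - j) ∧ k + 2 ^ (d - j) ≤ 2 ^ d ∧
    acc + sideOrd W side (d - j) rem = sideOrd W side d e ∧
    leafOf W (d - j) u v k (sideOrd W side (d - j) rem) =
      leafOf W d G.start G.accept 0 (sideOrd W side d e)

/-- One digit of the position is consumed. It selects the node, reversed on the Y side, and the
half; this extends the accumulated value `acc` and replaces one endpoint of the current subformula.
-/
theorem descendStep_spec {V : ℤ} (hV : Bounds N W T K d V) (hp : BPParams G K d s) {side : Bool}
    {e j : ℕ} (he : e < (2 * W) ^ d) (hj : j < d) (h : DescendInv G d side e j s) :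
    Wp V (descendStep side) s 9 (DescendInv G d side e (j + 1)) := by
  obtain ⟨u, v, k, rem, acc, r20, r21, r22, r23, r24, r25, r26, hu, hv, hrem, hk, hacc, hleaf⟩ := h
  obtain ⟨c, hc⟩ : ∃ c, c = d - (j + 1) := ⟨_, rfl⟩
  have hdj : d - j = c + 1 := by omega
  rw [hdj] at r23 r24 hrem hk hacc hleaf
  have hWpos := hV.W_pos
  have hVD := hV.D
  have hVH := hV.H
  obtain ⟨q1, q2, q3⟩ := digits_lt hrem
  obtain ⟨o1, o2⟩ := sideOrd_digits side hrem
  rw [sideOrd_succ] at hacc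
  have hnode := sideNode_lt (side := side) q1
  have hord := sideOrd_lt (side := side) he
  have hcd : (2 * W) ^ (c + 1) ≤ (2 * W) ^ d := Nat.pow_le_pow_right (by omega) (by omega)
  have hdivle : rem / (2 * W) ^ c ≤ rem := Nat.div_le_self _ _
  rw [leafOf, o1, o2] at hleaf
  have hPD : (2 * W) ^ c ≤ (2 * W) ^ d := Nat.pow_le_pow_right (by omega) (by omega)
  have h2c : 2 ^ c ≤ 2 ^ d := Nat.pow_le_pow_right (by omega) (by omega)
  have e24 : (Expr.reg 24 / (2 * Expr.reg 3)).eval s = ((2 * W) ^ c : ℕ) := by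
    simp only [Expr.eval_div, Expr.eval_mul, Expr.eval_reg, Expr.eval_ofNat, r24, hp.width]
    rw [pow_succ]
    norm_cast
    exact Nat.mul_div_cancel _ (by omega)
  unfold DescendInv
  rw [← hc]
  set P := (2 * W) ^ c with hP
  set q := rem / P with hq
  refine Wp.assign_seq (τ := 8) (by rw [e24]; exact abs_natCast_le (by omega)) ?_
  rw [e24]
  set s1 := s.setReg 24 (P : ℕ) with hs1
  have e23 : (Expr.reg 23 / 2).eval s1 = (2 ^ c : ℕ) := by
    simp only [Expr.eval_div, Expr.eval_reg, Expr.eval_ofNat, hs1, State.setReg_reg]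
    simp only [Nat.reduceEqDiff, if_false, r23]
    rw [pow_succ]
    norm_cast
    exact Nat.mul_div_cancel _ (by omega)
  refine Wp.assign_seq (τ := 7) (by rw [e23]; exact abs_natCast_le (by omega)) ?_
  rw [e23]
  set s2 := s1.setReg 23 (2 ^ c : ℕ) with hs2
  have e27 : (Expr.reg 25 / Expr.reg 24).eval s2 = (q : ℕ) := by
    simp [Expr.eval_div, Expr.eval_reg, hs2, hs1, State.setReg_reg, r25, hq]
  refine Wp.assign_seq (τ := 6) (by rw [e27]; exact abs_natCast_le (by omega)) ?_
  rw [e27]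
  set s3 := s2.setReg 27 (q : ℕ) with hs3
  have e25 : (Expr.reg 25 % Expr.reg 24).eval s3 = (rem % P : ℕ) := by
    simp [Expr.eval_mod, Expr.eval_reg, hs3, hs2, hs1, State.setReg_reg, r25]
  refine Wp.assign_seq (τ := 5) (by rw [e25]; exact abs_natCast_le (by omega)) ?_
  rw [e25]
  set s4 := s3.setReg 25 (rem % P : ℕ) with hs4
  have hq2W : q / 2 ≤ W - 1 := by omega
  have e28 : ((if side then .reg 3 - 1 - .reg 27 / 2 else .reg 27 / 2 : Expr)).eval s4 =
      (sideNode W side q : ℕ) := by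
    have h27 : s4.reg 27 = q := by simp [hs4, hs3, State.setReg_reg]
    have h3 : s4.reg 3 = W := by simp [hs4, hs3, hs2, hs1, State.setReg_reg, hp.width]
    cases side
    · simp [sideNode, Expr.eval_div, Expr.eval_reg, Expr.eval_ofNat, h27]
    · simp only [if_true, sideNode, Expr.eval_sub, Expr.eval_div, Expr.eval_reg, Expr.eval_ofNat,
        h27, h3]
      omega
  have hWV := hV.width
  refine Wp.assign_seq (τ := 4) (by rw [e28]; exact abs_natCast_le (by omega)) ?_
  rw [e28]
  set w := sideNode W side q with hw
  set s5 := s4.setReg 28 (w : ℕ) with hs5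
  have e26 : (Expr.reg 26 + (2 * Expr.reg 28 + Expr.reg 27 % 2) * Expr.reg 24).eval s5 =
      (acc + (2 * w + q % 2) * P : ℕ) := by
    have h27 : s5.reg 27 = q := by simp [hs5, hs4, hs3, State.setReg_reg]
    have h28 : s5.reg 28 = w := by simp [hs5, State.setReg_reg]
    have h24 : s5.reg 24 = P := by simp [hs5, hs4, hs3, hs2, hs1, State.setReg_reg]
    have h26 : s5.reg 26 = acc := by simp [hs5, hs4, hs3, hs2, hs1, State.setReg_reg, r26]
    simp only [Expr.eval_add, Expr.eval_mul, Expr.eval_mod, Expr.eval_reg, Expr.eval_ofNat, h27,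
      h28, h24, h26]
    push_cast; ring
  refine Wp.assign_seq (τ := 3) (by rw [e26]; exact abs_natCast_le (by omega)) ?_
  rw [e26]
  set s6 := s5.setReg 26 (acc + (2 * w + q % 2) * P : ℕ) with hs6
  have h20 : s6.reg 20 = u := by
    simp [hs6, hs5, hs4, hs3, hs2, hs1, State.setReg_reg, r20]
  have h21 : s6.reg 21 = v := by
    simp [hs6, hs5, hs4, hs3, hs2, hs1, State.setReg_reg, r21]
  have h22 : s6.reg 22 = k := by
    simp [hs6, hs5, hs4, hs3, hs2, hs1, State.setReg_reg, r22]
  have h23 : s6.reg 23 = (2 ^ c : ℕ) := by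
    simp [hs6, hs5, hs4, hs3, hs2, State.setReg_reg]
  have h24 : s6.reg 24 = P := by
    simp [hs6, hs5, hs4, hs3, hs2, hs1, State.setReg_reg]
  have h25 : s6.reg 25 = (rem % P : ℕ) := by
    simp [hs6, hs5, hs4, State.setReg_reg]
  have h26 : s6.reg 26 = (acc + (2 * w + q % 2) * P : ℕ) := by
    simp [hs6, State.setReg_reg]
  have h28 : s6.reg 28 = w := by simp [hs6, hs5, State.setReg_reg]
  have e27' : (Expr.reg 27 % 2).eval s6 = (q % 2 : ℕ) := by
    simp [Expr.eval_mod, Expr.eval_reg, Expr.eval_ofNat, hs6, hs5, hs4, hs3, State.setReg_reg]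
  rw [pow_succ] at hk
  clear_value s6
  refine Wp.ite (fun hcond => ?_) (fun hcond => ?_)
  · rw [e27', Expr.eval_one] at hcond
    have hq0 : q % 2 = 0 := by omega
    refine (Wp.assign ?_ ?_).mono (fun _ _ h => h) one_le_two
    · rw [Expr.eval_reg, h28]; exact abs_natCast_le (by omega)
    · refine ⟨u, w, k, rem % P, acc + (2 * w + q % 2) * P, ?_, ?_, ?_, ?_, ?_, ?_, ?_, hu, hnode, q2,
        by omega, by rw [← hacc, add_assoc], ?_⟩
      · simpa [State.setReg_reg] using h20
      · simpa [State.setReg_reg, Expr.eval_reg] using h28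
      · simpa [State.setReg_reg] using h22
      · simpa [State.setReg_reg] using h23
      · simpa [State.setReg_reg] using h24
      · simpa [State.setReg_reg] using h25
      · simpa [State.setReg_reg] using h26
      · rw [← hleaf, if_pos (by omega), show (2 * w + q % 2) / 2 = w by omega]
  · rw [e27', Expr.eval_one] at hcond
    have hq1 : q % 2 = 1 := by omega
    have e22 : (Expr.reg 22 + Expr.reg 23).eval (s6.setReg 20 ((Expr.reg 28).eval s6)) =
        (k + 2 ^ c : ℕ) := by
      simp only [Expr.eval_add, Expr.eval_reg, State.setReg_reg]
      simp only [Nat.reduceEqDiff, if_false, h22, h23]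
      push_cast; ring
    refine Wp.assign_seq (τ := 1) ?_ (Wp.assign ?_ ?_)
    · rw [Expr.eval_reg, h28]; exact abs_natCast_le (by omega)
    · rw [e22]; exact abs_natCast_le (by omega)
    · rw [e22]
      refine ⟨w, v, k + 2 ^ c, rem % P, acc + (2 * w + q % 2) * P, ?_, ?_, ?_, ?_, ?_, ?_, ?_, hnode,
        hv, q2, by omega, by rw [← hacc, add_assoc], ?_⟩
      · simpa [State.setReg_reg, Expr.eval_reg] using h28
      · simpa [State.setReg_reg] using h21
      · simp [State.setReg_reg]
      · simpa [State.setReg_reg] using h23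
      · simpa [State.setReg_reg] using h24
      · simpa [State.setReg_reg] using h25
      · simpa [State.setReg_reg] using h26
      · rw [← hleaf, if_neg (by omega), show (2 * w + q % 2) / 2 = w by omega]

/-- The gadget must be written in its own order, so the program enumerates positions e. A single
pass over the digits yields both the value at that position and the edge it stands for. -/
theorem descend_spec {V : ℤ} (hV : Bounds N W T K d V) (hp : BPParams G K d s) (side : Bool)
    {e : ℕ} (he : e < (2 * W) ^ d) (h19 : s.reg 19 = e) :
    Wp V (descend side) s (10 * d + 8) (fun s' =>
      s'.reg 20 = ((leafOf W d G.start G.accept 0 (sideOrd W side d e)).1 : ℕ) ∧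
      s'.reg 21 = ((leafOf W d G.start G.accept 0 (sideOrd W side d e)).2.1 : ℕ) ∧
      s'.reg 22 = ((leafOf W d G.start G.accept 0 (sideOrd W side d e)).2.2 : ℕ) ∧
      s'.reg 26 = (sideOrd W side d e : ℕ)) := by
  have hWV := hV.width
  have hVD := hV.D
  have hVH := hV.H
  have hS := G.start.2
  have hA := G.accept.2
  have hT := hV.length
  refine (Wp.assign_seq (by rw [Expr.eval_reg, hp.start]; exact abs_natCast_le (by omega))
    (Wp.assign_seq ?_ (Wp.assign_seq ?_ (Wp.assign_seq ?_ (Wp.assign_seq ?_ (Wp.assign_seq ?_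
    (Wp.assign_seq ?_ (Wp.while_const (τ := 9) (n := d)
      (I := DescendInv G d side e) ?_ ?_ ?_)))))))).mono (fun _ _ h => h) (by omega)
  · simp [Expr.eval_reg, State.setReg_reg, hp.accept]; omega
  · rw [Expr.eval_zero, abs_zero]; omega
  · simp only [Expr.eval_reg, State.setReg_reg, Nat.reduceEqDiff, if_false, hp.half]
    exact abs_natCast_le hVH
  · simp only [Expr.eval_reg, State.setReg_reg, Nat.reduceEqDiff, if_false, hp.leaves]
    exact abs_natCast_le hVD
  · simp only [Expr.eval_reg, State.setReg_reg, Nat.reduceEqDiff, if_false, h19]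
    exact abs_natCast_le (by omega)
  · rw [Expr.eval_zero, abs_zero]; omega
  · refine ⟨G.start, G.accept, 0, e, 0, ?_, ?_, ?_, ?_, ?_, ?_, ?_, hS, hA, by simpa using he,
      by simp, by simp, by simp⟩ <;>
      simp [State.setReg_reg, Expr.eval_reg, Expr.eval_zero, hp.start, hp.accept, hp.half, hp.leaves, h19]
  · intro j hj s' hf hI
    have hp' : BPParams G K d s' := by
      refine BPParams.frame ?_ hf (by cases side <;> rfl)
      repeat (refine BPParams.setReg ?_ (by norm_num) _)
      exact hp
    refine ⟨?_, descendStep_spec hV hp' he hj hI⟩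
    obtain ⟨u, v, k, rem, acc, -, -, -, r23, -⟩ := hI
    rw [Expr.eval_one, Expr.eval_reg, r23]
    exact_mod_cast Nat.one_lt_two_pow (by omega)
  · intro s' hf hI
    obtain ⟨u, v, k, rem, acc, r20, r21, r22, r23, r24, r25, r26, hu, hv, hrem, hk, hacc, hleaf⟩ := hI
    rw [Nat.sub_self] at r23 hrem hacc hleaf
    rw [pow_zero, Nat.lt_one_iff] at hrem
    -- At depth 0 no digits are left, so `acc` is the complete value and the registers hold the leaf
    -- itself.
    have h0 : sideOrd W side 0 rem = 0 := by cases side <;> simpa [sideOrd, flipOrd] using hrem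
    rw [h0] at hacc hleaf
    rw [← hleaf, ← hacc, r20, r21, r22, r26]
    refine ⟨?_, rfl, rfl, rfl, rfl⟩
    rw [Expr.eval_one, Expr.eval_reg, r23]
    simp

/-- The memory `m` contains the table of edges, below the address `P`. -/
structure Table (G : BranchingProgram N W T) (m : ℤ → ℤ) (P : ℤ) : Prop where
  var : ∀ k (h : k < T - 1), m (5 + k * (1 + 2 * (W * W))) = (G.var ⟨k, h⟩ : ℕ)
  edge : ∀ k u v (hk : k < T - 1) (hu : u < W) (hv : v < W) (b : Bool),
    m (5 + k * (1 + 2 * (W * W)) + 1 + 2 * (u * W + v) + b.toNat) =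
      (G.edge ⟨k, hk⟩ ⟨u, hu⟩ ⟨v, hv⟩ b).toNat
  le : 5 + ((T - 1 : ℕ) : ℤ) * (1 + 2 * (W * W)) ≤ P

/-- Table entries lie inside the input, hence below the output, so reading them is unaffected by
what has been written. -/
theorem entry_lt {k u v c T W : ℕ} (hk : k < T - 1) (hu : u < W) (hv : v < W) (hc : c ≤ 1) :
    5 + k * (1 + 2 * (W * W)) + 1 + 2 * (u * W + v) + c < 5 + (T - 1) * (1 + 2 * (W * W)) := by
  have h1 := Nat.mul_le_mul_right (1 + 2 * (W * W)) (show k + 1 ≤ T - 1 from hk)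
  have h2 := Nat.mul_le_mul_right W (show u + 1 ≤ W from hu)
  rw [add_mul, one_mul] at h1 h2
  omega

def rowExpr : Expr := 5 + .reg 22 * .reg 7

/-- The entry of the table for the current edge and the value of the variable `x`. -/
def entryExpr (x : Expr) : Expr :=
  .deref (rowExpr + 1 + 2 * (.reg 20 * .reg 3 + .reg 21) + .bin .shr (.reg 13) x % 2)

/-- Compute in `reg 29` whether the gadget with number `reg 13` contains the current leaf. -/
def checkLeaf (side : Bool) : Stm :=
  .ite (.reg 22) (.reg 4 - 1)
    (.seq (.assign 30 (.deref rowExpr))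
      (.ite (.reg 30) (.reg 11)
        (.assign 29 (if side then 1 else entryExpr (.reg 30)))
        (.assign 29 (if side then entryExpr (.reg 30 - .reg 11) else 1))))
    (.ite (.reg 20) (.reg 21) (.assign 29 0)
      (.ite (.reg 21) (.reg 20) (.assign 29 0) (.assign 29 1)))

theorem checkLeaf_spec {V : ℤ} (hV : Bounds N W T K d V) (hp : BPParams G K d s) (side : Bool)
    {m : ℤ → ℤ} {P : ℤ} {L : List ℤ} (hm : Table G m P) (hO : Out m P L s)
    {i u v k : ℕ} (h13 : s.reg 13 = i) (h20 : s.reg 20 = u) (h21 : s.reg 21 = v)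
    (h22 : s.reg 22 = k) (hu : u < W) (hv : v < W) :
    Wp V (checkLeaf side) s 4 (fun s' => s'.reg 29 = (G.leafSat K side i k u v).toNat) := by
  have hT := G.length_pos
  have hNV := hV.vars
  have hVD := hV.D
  have hDpos := hV.D_pos
  have hV1 : (1 : ℤ) ≤ V := by omega
  by_cases hk : k < T - 1
  · have hrow : rowExpr.eval s = 5 + k * (1 + 2 * (W * W)) := by
      simp only [rowExpr, Expr.eval_add, Expr.eval_mul, Expr.eval_reg, Expr.eval_ofNat, h22,
        hp.stride]
      push_cast; ring
    have hlt0 : (5 + k * (1 + 2 * (W * W)) : ℤ) < P := by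
      have := entry_lt hk hu hv (Nat.zero_le 1)
      have h2 := hm.le
      zify at this
      have h3 : (0 : ℤ) ≤ 2 * (u * W + v) := by positivity
      linarith
    have hvar := (G.var ⟨k, hk⟩).2
    set x := (G.var ⟨k, hk⟩ : ℕ) with hx
    have e30 : (Expr.deref rowExpr).eval s = x := by
      rw [Expr.eval_deref, hrow, hO.mem, writeList_of_lt hlt0, hm.var k hk]
    refine Wp.ite_pos (τ := 3) ?_ ?_
    · rw [Expr.eval_reg, h22, Expr.eval_sub, Expr.eval_reg, Expr.eval_one, hp.length]
      omega
    refine Wp.assign_seq (τ := 2) (by rw [e30]; exact abs_natCast_le (by omega)) ?_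
    rw [e30]
    set s1 := s.setReg 30 (x : ℕ) with hs1
    have hO1 : Out m P L s1 := hO.setReg (by norm_num) _
    have r30 : s1.reg 30 = x := by simp [hs1, State.setReg_reg]
    have r11 : s1.reg 11 = K := by simp [hs1, State.setReg_reg, hp.vars]
    have entry : ∀ (y : Expr) (c : ℕ), y.eval s1 = c →
        (entryExpr y).eval s1 = (G.edge ⟨k, hk⟩ ⟨u, hu⟩ ⟨v, hv⟩ (decide (i / 2 ^ c % 2 = 1))).toNat := by
      intro y c hy
      -- The bit of the assignment, obtained by a shift and a remainder, serves directly as the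
      -- offset in the pair of table entries.
      have hb : ((decide (i / 2 ^ c % 2 = 1)).toNat : ℤ) = (i : ℤ) / 2 ^ c % 2 := by
        rcases Nat.mod_two_eq_zero_or_one (i / 2 ^ c) with h | h
        · rw [h]; simp; exact_mod_cast h.symm
        · rw [h]; simp; exact_mod_cast h.symm
      have hlt1 : (5 + k * (1 + 2 * (W * W)) + 1 + 2 * (u * W + v) +
          (decide (i / 2 ^ c % 2 = 1)).toNat : ℤ) < P := by
        have h1 := entry_lt hk hu hv (Bool.toNat_le (decide (i / 2 ^ c % 2 = 1)))
        have h2 := hm.le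
        generalize (decide (i / 2 ^ c % 2 = 1)).toNat = b at h1 ⊢
        zify at h1
        linarith
      have hrow1 : rowExpr.eval s1 = 5 + k * (1 + 2 * (W * W)) := by
        rw [← hrow]; simp [rowExpr, Expr.eval_add, Expr.eval_mul, Expr.eval_reg, Expr.eval_ofNat, hs1,
          State.setReg_reg]
      rw [← hm.edge k u v hk hu hv, ← writeList_of_lt (m := m) (L := L) hlt1, ← hO1.mem, entryExpr,
        Expr.eval_deref]
      congr 1
      simp only [Expr.eval_add, Expr.eval_mul, Expr.eval_mod, Expr.eval_shr, hrow1, hy,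
        Expr.eval_ofNat, Expr.eval_reg, hb]
      simp [hs1, State.setReg_reg, h20, h21, hp.width, h13]
    have hbound : ∀ b : Bool, |(b.toNat : ℤ)| ≤ V := fun b => by
      refine abs_natCast_le ?_
      have := Bool.toNat_le b
      omega
    have hset : ∀ (s : State) (z : ℤ), (s.setReg 29 z).reg 29 = z := fun s z => by
      simp [State.setReg_reg]
    have hleaf : G.leafSat K side i k u v = if x < K then
        side || G.edge ⟨k, hk⟩ ⟨u, hu⟩ ⟨v, hv⟩ (decide (i / 2 ^ x % 2 = 1)) else
        !side || G.edge ⟨k, hk⟩ ⟨u, hu⟩ ⟨v, hv⟩ (decide (i / 2 ^ (x - K) % 2 = 1)) := by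
      rw [BranchingProgram.leafSat, dif_pos ⟨hk, hu, hv⟩]
    refine Wp.ite (fun hc => ?_) (fun hc => ?_)
    · rw [Expr.eval_reg, Expr.eval_reg, r30, r11] at hc
      rw [if_pos (by exact_mod_cast hc)] at hleaf
      rw [hleaf]
      cases side
      · have e := entry (.reg 30) x (by rw [Expr.eval_reg, r30])
        refine Wp.assign ?_ ?_
        · simp only [Bool.false_eq_true, if_false, e]; exact hbound _
        · simp only [Bool.false_eq_true, if_false, e, Bool.false_or, hset]
      · refine Wp.assign ?_ ?_
        · simp only [if_true, Expr.eval_one]; exact hbound true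
        · simp [Expr.eval_one, hset]
    · rw [Expr.eval_reg, Expr.eval_reg, r30, r11] at hc
      rw [if_neg (by exact_mod_cast hc)] at hleaf
      rw [hleaf]
      cases side
      · refine Wp.assign ?_ ?_
        · simp only [Bool.false_eq_true, if_false, Expr.eval_one]; exact hbound true
        · simp [Expr.eval_one, hset]
      · have e := entry (.reg 30 - .reg 11) (x - K) (by
          rw [Expr.eval_sub, Expr.eval_reg, Expr.eval_reg, r30, r11]; omega)
        refine Wp.assign ?_ ?_
        · simp only [if_true, e]; exact hbound _
        · simp only [if_true, e, Bool.not_true, Bool.false_or, hset]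
  · have hleaf : G.leafSat K side i k u v = decide (u = v) := by
      rw [BranchingProgram.leafSat, dif_neg (by tauto)]
    rw [hleaf]
    refine (Wp.ite_neg (τ := 3) ?_ ?_).mono (fun _ _ h => h) le_rfl
    · rw [Expr.eval_reg, h22, Expr.eval_sub, Expr.eval_reg, Expr.eval_one, hp.length]
      omega
    refine Wp.ite (τ := 2) (fun hc => ?_) (fun hc => ?_)
    · rw [Expr.eval_reg, Expr.eval_reg, h20, h21] at hc
      refine (Wp.assign (by rw [Expr.eval_zero, abs_zero]; omega) ?_).mono (fun _ _ h => h) one_le_two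
      have : u ≠ v := by omega
      simp [State.setReg_reg, Expr.eval_zero, this]
    · rw [Expr.eval_reg, Expr.eval_reg, h20, h21] at hc
      refine Wp.ite (τ := 1) (fun hc' => ?_) (fun hc' => ?_)
      · rw [Expr.eval_reg, Expr.eval_reg, h20, h21] at hc'
        refine Wp.assign (by rw [Expr.eval_zero, abs_zero]; omega) ?_
        have : u ≠ v := by omega
        simp [State.setReg_reg, Expr.eval_zero, this]
      · rw [Expr.eval_reg, Expr.eval_reg, h20, h21] at hc'
        refine Wp.assign (by rw [Expr.eval_one, abs_one]; omega) ?_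
        have : u = v := by omega
        simp [State.setReg_reg, Expr.eval_one, this]

/-- Write the gadget with number `reg 13`. -/
def emitMid (side : Bool) : Stm :=
  .seq (.assign 19 0) (.while (.reg 19) (.reg 9)
    (.seq (descend side) (.seq (checkLeaf side)
      (.seq (.ite 0 (.reg 29) (.seq (.store (.reg 12) (3 * .reg 9 * .reg 10 + .reg 26))
          (.assign 12 (.reg 12 + 1))) .skip)
        (.assign 19 (.reg 19 + 1))))))

/-- Every one of the D positions costs a descent of depth d whether or not its leaf is written, so
the time is not charged to the output length. -/
theorem emitMid_spec {V : ℤ} (hV : Bounds N W T K d V) (hp : BPParams G K d s) (side : Bool)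
    {m : ℤ → ℤ} {P : ℤ} {L : List ℤ} (hm : Table G m P) (hO : Out m P L s)
    {i : ℕ} (h13 : s.reg 13 = i)
    (hL : P + (L.length + ((G.gadgets K d).mid side i).length) ≤ V) (hP : 0 ≤ P) :
    Wp V (emitMid side) s ((10 * d + 17) * (2 * W) ^ d + 2)
      (Out m P (L ++ ((G.gadgets K d).mid side i).map (↑))) := by
  have hlist : ((G.gadgets K d).mid side i).map (fun x : ℕ => (x : ℤ)) =
      (List.range ((2 * W) ^ d)).flatMap fun e => (if (G.gadgets K d).leaf side i (sideOrd W side d e)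
        then [3 * (2 * W) ^ d * 2 ^ K + sideOrd W side d e] else []).map (Nat.cast : ℕ → ℤ) := by
    rw [Gadgets.mid, List.map_flatMap]
    rfl
  have hlen : ((G.gadgets K d).mid side i).length = ((List.range ((2 * W) ^ d)).flatMap fun e =>
      (if (G.gadgets K d).leaf side i (sideOrd W side d e)
        then [3 * (2 * W) ^ d * 2 ^ K + sideOrd W side d e] else []).map
          (Nat.cast : ℕ → ℤ)).length := by rw [← hlist, List.length_map]
  rw [hlist]
  rw [hlen] at hL
  have hVD := hV.D
  refine (Wp.assign_seq (by rw [Expr.eval_zero, abs_zero]; omega)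
    (Wp.emit_loop (α := 10 * d + 16) (β := 0) (I := fun j s' => s'.reg 19 = j) ?_
      (hO.setReg (by norm_num) _) hL ?_ ?_)).mono (fun _ _ h => h)
      (by rw [show 10 * d + 16 + 1 = 10 * d + 17 from rfl]; omega)
  · simp [State.setReg_reg, Expr.eval_zero]
  · intro e he s' L' hf hI hO' hL'
    have hp' : BPParams G K d s' := by
      refine BPParams.frame ?_ hf (by cases side <;> rfl)
      exact hp.setReg (by norm_num) _
    have r13 : s'.reg 13 = i := by
      rw [hf.reg 13 (by cases side <;> rfl)]; simpa [State.setReg_reg] using h13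
    refine ⟨by rw [Expr.eval_reg, Expr.eval_reg, hI, hp'.leaves]; exact_mod_cast he, ?_⟩
    have ho := sideOrd_lt (side := side) he
    obtain ⟨l1, l2, -⟩ := leafOf_lt (k := 0) G.start.2 G.accept.2 ho
    refine (Wp.seq (τ₁ := 10 * d + 8) (τ₂ := 8) ((descend_spec hV hp' side he hI).mono
      (fun s1 hf1 ⟨a20, a21, a22, a26⟩ => ?_) le_rfl)).mono (fun _ _ h => h) (by omega)
    have hp1 := hp'.frame hf1 (by cases side <;> rfl)
    have hO1 : Out m P L' s1 := ⟨by rw [hf1.mem (by cases side <;> rfl), hO'.mem],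
      by rw [hf1.reg 12 (by cases side <;> rfl), hO'.ptr]⟩
    refine Wp.seq (τ₁ := 4) (τ₂ := 4) ((checkLeaf_spec hV hp1 side hm hO1
      (by rw [hf1.reg 13 (by cases side <;> rfl), r13]) a20 a21 a22 l1 l2).mono
      (fun s2 hf2 a29 => ?_) le_rfl)
    have hp2 := hp1.frame hf2 (by cases side <;> rfl)
    have hO2 : Out m P L' s2 := ⟨by rw [hf2.mem (by cases side <;> rfl), hO1.mem],
      by rw [hf2.reg 12 (by cases side <;> rfl), hO1.ptr]⟩
    have a19 : s2.reg 19 = e := by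
      rw [hf2.reg 19 (by cases side <;> rfl), hf1.reg 19 (by cases side <;> rfl), hI]
    have a26' : s2.reg 26 = (sideOrd W side d e : ℕ) := by
      rw [hf2.reg 26 (by cases side <;> rfl), a26]
    have hleaf : (G.gadgets K d).leaf side i (sideOrd W side d e) = G.leafSat K side i
        (leafOf W d G.start G.accept 0 (sideOrd W side d e)).2.2
        (leafOf W d G.start G.accept 0 (sideOrd W side d e)).1
        (leafOf W d G.start G.accept 0 (sideOrd W side d e)).2.1 := rfl
    rw [← hleaf] at a29
    have fin : ∀ s3 : State, s3.reg 19 = e → ∀ L'', Out m P L'' s3 →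
        Wp V (.assign 19 (.reg 19 + 1)) s3 1 (fun s'' => s''.reg 19 = (e + 1 : ℕ) ∧ Out m P L'' s'') := by
      intro s3 h3 L'' hO3
      have e19 : (Expr.reg 19 + 1).eval s3 = (e + 1 : ℕ) := by
        rw [Expr.eval_add, Expr.eval_reg, Expr.eval_one, h3]; push_cast; ring
      refine Wp.assign ?_ ⟨?_, hO3.setReg (by norm_num) _⟩
      · rw [e19]; exact abs_natCast_le (by omega)
      · rw [e19]; simp [State.setReg_reg]
    refine Wp.seq (τ₁ := 3) (τ₂ := 1) (Wp.ite (τ := 2) (fun hc => ?_) (fun hc => ?_))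
    · rw [Expr.eval_zero, Expr.eval_reg, a29] at hc
      have hT : (G.gadgets K d).leaf side i (sideOrd W side d e) = true := by
        by_contra hne
        rw [Bool.not_eq_true] at hne
        rw [hne] at hc
        simp at hc
      rw [if_pos hT] at hL' ⊢
      refine (Wp.emit (τ := 3 * (2 * W) ^ d * 2 ^ K + sideOrd W side d e) hO2 ?_ ?_ ?_ hP).mono
        (fun s3 hf3 hO3 => fin s3 ((hf3.reg 19 rfl).trans a19) _ hO3) le_rfl
      · simp only [Expr.eval_add, Expr.eval_mul, Expr.eval_reg, Expr.eval_ofNat, hp2.leaves, hp2.blocks, a26']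
        push_cast; ring
      · refine le_trans ?_ hV.mirror
        have : 3 * (2 * W) ^ d * 2 ^ K + sideOrd W side d e ≤ mirror ((2 * W) ^ d) K + 1 := by
          rw [mirror]; omega
        exact_mod_cast this
      · simpa using hL'
    · rw [Expr.eval_zero, Expr.eval_reg, a29] at hc
      have hF : (G.gadgets K d).leaf side i (sideOrd W side d e) ≠ true := by
        intro hne
        rw [hne] at hc
        simp at hc
      rw [if_neg hF]
      exact (Wp.skip (fin s2 a19 _ (by simpa using hO2))).mono (fun _ _ h => h) one_le_two
  · intro s' hf hI
    have hp' : BPParams G K d s' := by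
      refine BPParams.frame ?_ hf (by cases side <;> rfl)
      exact hp.setReg (by norm_num) _
    rw [Expr.eval_reg, Expr.eval_reg, hI, hp'.leaves]
    exact lt_irrefl _

end WordRAM

/-! ### The lengths of the sequences -/

theorem List.length_flatMap_range {α : Type*} (n : ℕ) (f : ℕ → List α) :
    ((List.range n).flatMap f).length = ∑ i ∈ Finset.range n, (f i).length :=
  List.length_flatMap

namespace LCISBlocks

/-- Tokens of weight w have length w * D but occur only in the c separators with numbers divisible
by w, at most two in each. -/
theorem sum_lowTok_le (D : ℕ) (side : Bool) {w : ℕ} (c : ℕ) :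
    ∑ i ∈ Finset.range (w * c), (lowTok D (w * c) side i w).length ≤ 2 * ((w * c) * D) := by
  have h1 : ∀ i, (lowTok D (w * c) side i w).length ≤ if w ∣ i then 2 * (w * D) else 0 := by
    intro i
    rw [lowTok]
    split_ifs <;> simp <;> omega
  refine (Finset.sum_le_sum fun i _ => h1 i).trans ?_
  rw [← Finset.sum_filter, Finset.sum_const, smul_eq_mul]
  have h2 : (Finset.range (w * c)).filter (w ∣ ·) ⊆ (Finset.range c).image (w * ·) := by
    intro i hi
    rw [Finset.mem_filter, Finset.mem_range] at hi
    obtain ⟨hi, k, rfl⟩ := hi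
    exact Finset.mem_image.2 ⟨k, Finset.mem_range.2 (Nat.lt_of_mul_lt_mul_left hi), rfl⟩
  have h3 : ((Finset.range (w * c)).filter (w ∣ ·)).card ≤ c :=
    (Finset.card_le_card h2).trans (Finset.card_image_le.trans (Finset.card_range c).le)
  calc _ ≤ c * (2 * (w * D)) := Nat.mul_le_mul_right _ h3
    _ = _ := by ring

theorem sum_low_le (D K : ℕ) (side : Bool) :
    ∑ i ∈ Finset.range (2 ^ K), (low D K side i).length ≤ K * (2 * (2 ^ K * D)) := by
  have h1 : ∀ i, (low D K side i).length =
      ∑ j ∈ Finset.range K, (lowTok D (2 ^ K) side i (2 ^ (K - 1 - j))).length := by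
    intro i
    rw [low, List.length_flatMap_range]
  simp_rw [h1]
  rw [Finset.sum_comm]
  refine (Finset.sum_le_card_nsmul _ _ (2 * (2 ^ K * D)) fun j hj => ?_).trans (by simp)
  have hj := Finset.mem_range.1 hj
  have hK : 2 ^ K = 2 ^ (K - 1 - j) * 2 ^ (j + 1) := by rw [← pow_add]; congr 1; omega
  have := sum_lowTok_le D side (w := 2 ^ (K - 1 - j)) (2 ^ (j + 1))
  rwa [← hK] at this

theorem length_high (D K : ℕ) (side : Bool) (i : ℕ) :
    (high D K side i).length = (low D K side (2 ^ K - 1 - i)).length := by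
  simp [high]

namespace Gadgets

variable {D K : ℕ} (Γ : Gadgets D K)

theorem length_mid_le (side : Bool) (i : ℕ) : (Γ.mid side i).length ≤ D := by
  rw [mid, List.length_flatMap]
  refine (List.sum_le_card_nsmul _ 1 ?_).trans (by simp)
  intro x hx
  obtain ⟨e, -, rfl⟩ := List.mem_map.1 hx
  split_ifs <;> simp

/-- K weights of cost 2 * 2 ^ K * D for the low separators, the same for the mirrored ones, and at
most D values for each gadget. -/
theorem length_sequence_le (side : Bool) :
    (Γ.sequence side).length ≤ (4 * K + 1) * (2 ^ K * D) := by
  have h : (Γ.sequence side).length = ∑ i ∈ Finset.range (2 ^ K), ((low D K side i).length +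
      ((Γ.mid side i).length + (high D K side i).length)) := by
    rw [sequence, List.length_flatMap_range]
    simp [block]
  have h2 : ∑ i ∈ Finset.range (2 ^ K), (high D K side i).length =
      ∑ i ∈ Finset.range (2 ^ K), (low D K side i).length := by
    simp_rw [length_high]
    exact Finset.sum_range_reflect (fun i => (low D K side i).length) _
  have h3 : ∑ i ∈ Finset.range (2 ^ K), (Γ.mid side i).length ≤ 2 ^ K * D :=
    (Finset.sum_le_card_nsmul _ _ D fun i _ => Γ.length_mid_le side i).trans (by simp)
  have h4 := sum_low_le D K side
  rw [h, Finset.sum_add_distrib, Finset.sum_add_distrib, h2]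
  calc _ ≤ K * (2 * (2 ^ K * D)) + (2 ^ K * D + K * (2 * (2 ^ K * D))) := by omega
    _ = _ := by ring

theorem le_mirror_of_mem_sequence {side : Bool} {v : ℕ} (h : v ∈ Γ.sequence side) :
    v ≤ mirror D K := by
  rw [sequence, List.mem_flatMap] at h
  obtain ⟨i, -, h⟩ := h
  rw [block, List.mem_append, List.mem_append] at h
  rcases h with h | h | h
  · have := low_lt h
    rw [mirror]; omega
  · rw [mid, List.mem_flatMap] at h
    obtain ⟨e, he, h⟩ := h
    split_ifs at h with hl
    · rw [List.mem_singleton] at h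
      have := Γ.ord_lt side e (List.mem_range.1 he)
      rw [mirror]; omega
    · simp at h
  · rw [high, List.mem_reverse, List.mem_map] at h
    obtain ⟨x, -, rfl⟩ := h
    exact Nat.sub_le _ _

end Gadgets

end LCISBlocks

/-! ### Branching programs in memory -/

theorem List.length_flatten_ofFn {α : Type*} {n R : ℕ} {f : Fin n → List α}
    (h : ∀ i, (f i).length = R) : (List.ofFn f).flatten.length = n * R := by
  simp [List.length_flatten, List.map_ofFn, Function.comp_def, h]

theorem List.getD_flatten_ofFn {α : Type*} {n R : ℕ} {f : Fin n → List α}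
    (h : ∀ i, (f i).length = R) {k r : ℕ} (hk : k < n) (hr : r < R) (x : α) :
    (List.ofFn f).flatten.getD (k * R + r) x = (f ⟨k, hk⟩).getD r x := by
  induction n generalizing k with
  | zero => omega
  | succ n ih =>
    rw [List.ofFn_succ, List.flatten_cons]
    rcases k with _ | k
    · rw [zero_mul, zero_add, List.getD_append _ _ _ _ (by rw [h]; exact hr)]
      rfl
    · rw [List.getD_append_right _ _ _ _ (by rw [h]; nlinarith), h,
        show (k + 1) * R + r - R = k * R + r by rw [add_mul, one_mul]; omega]
      exact ih (fun i => h _) (Nat.lt_of_succ_lt_succ hk)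

namespace BranchingProgram

variable {N W T : ℕ} (G : BranchingProgram N W T)

/-- The part of the encoding that describes the edges leaving layer `k`. -/
def row (k : Fin (T - 1)) : List ℤ :=
  ((G.var k : ℕ) : ℤ) ::
    (List.ofFn fun u : Fin W =>
      (List.ofFn fun v : Fin W =>
        [((G.edge k u v false).toNat : ℤ), ((G.edge k u v true).toNat : ℤ)]).flatten).flatten

theorem encode_eq : G.encode = [(N : ℤ), (W : ℤ), (T : ℤ), ((G.start : ℕ) : ℤ),
    ((G.accept : ℕ) : ℤ)] ++ (List.ofFn G.row).flatten := rfl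

theorem length_row (k : Fin (T - 1)) : (G.row k).length = 1 + 2 * (W * W) := by
  rw [row, List.length_cons, List.length_flatten_ofFn (R := W * 2)
    (fun u => List.length_flatten_ofFn fun v => rfl)]
  ring

theorem length_encode : G.encode.length = 5 + (T - 1) * (1 + 2 * (W * W)) := by
  rw [encode_eq, List.length_append, List.length_flatten_ofFn G.length_row]
  rfl

theorem getD_encode {k r : ℕ} (hk : k < T - 1) (hr : r < 1 + 2 * (W * W)) :
    G.encode.getD (5 + k * (1 + 2 * (W * W)) + r) 0 = (G.row ⟨k, hk⟩).getD r 0 := by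
  rw [encode_eq, List.getD_append_right _ _ _ _ (by simp; omega),
    show 5 + k * (1 + 2 * (W * W)) + r - [(N : ℤ), (W : ℤ), (T : ℤ), ((G.start : ℕ) : ℤ),
      ((G.accept : ℕ) : ℤ)].length = k * (1 + 2 * (W * W)) + r by simp; omega,
    List.getD_flatten_ofFn G.length_row hk hr]

theorem getD_row {k : Fin (T - 1)} {u v : ℕ} (hu : u < W) (hv : v < W) (b : Bool) :
    (G.row k).getD (1 + 2 * (u * W + v) + b.toNat) 0 = (G.edge k ⟨u, hu⟩ ⟨v, hv⟩ b).toNat := by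
  have hb := Bool.toNat_le b
  rw [row, show 1 + 2 * (u * W + v) + b.toNat = (u * (W * 2) + (v * 2 + b.toNat)) + 1 by ring,
    List.getD_cons_succ,
    List.getD_flatten_ofFn (R := W * 2) (fun u => List.length_flatten_ofFn fun v => rfl) hu
      (by omega),
    List.getD_flatten_ofFn (R := 2) (fun v => rfl) hv (by omega)]
  cases b <;> rfl

theorem abs_le_of_mem_encode {x : ℤ} (hx : x ∈ G.encode) : |x| ≤ N + W + T := by
  have hT := G.length_pos
  have h : ∃ y : ℕ, x = y ∧ y ≤ N + W + T := by
    rw [encode_eq, List.mem_append] at hx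
    rcases hx with hx | hx
    · have hs := G.start.2
      have ha := G.accept.2
      simp only [List.mem_cons, List.not_mem_nil, or_false] at hx
      rcases hx with rfl | rfl | rfl | rfl | rfl <;> exact ⟨_, rfl, by omega⟩
    · rw [List.mem_flatten] at hx
      obtain ⟨l, hl, hx⟩ := hx
      rw [List.mem_ofFn] at hl
      obtain ⟨k, rfl⟩ := hl
      rw [row, List.mem_cons] at hx
      rcases hx with rfl | hx
      · exact ⟨_, rfl, by have := (G.var k).2; omega⟩
      · simp only [List.mem_flatten, List.mem_ofFn] at hx
        obtain ⟨_, ⟨u, rfl⟩, hx⟩ := hx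
        simp only [List.mem_flatten, List.mem_ofFn] at hx
        obtain ⟨_, ⟨v, rfl⟩, hx⟩ := hx
        simp only [List.mem_cons, List.not_mem_nil, or_false] at hx
        rcases hx with rfl | rfl <;> exact ⟨_, rfl, (Bool.toNat_le _).trans (by omega)⟩
  obtain ⟨y, rfl, hy⟩ := h
  rw [abs_of_nonneg (by positivity)]
  exact_mod_cast hy

end BranchingProgram

namespace WordRAM

theorem initState_mem_natCast (l : List ℤ) (a : ℕ) : (initState l).mem a = l.getD a 0 := by
  simp [initState]

theorem initState_mem_eq_zero {l : List ℤ} {a : ℤ} (h : a < 0 ∨ (l.length : ℤ) ≤ a) :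
    (initState l).mem a = 0 := by
  rw [initState]
  dsimp only
  split_ifs with h0
  · exact List.getD_eq_default _ _ (by omega)
  · rfl

/-- Five header cells precede the table, and all its rows have the same length, so entries are found
by multiplication. -/
theorem table_encode {N W T : ℕ} (G : BranchingProgram N W T) :
    Table G (initState G.encode).mem G.encode.length where
  var k hk := by
    have := G.getD_encode hk (r := 0) (by omega)
    rw [add_zero, ← initState_mem_natCast] at this
    push_cast at this
    rw [this]
    rfl
  edge k u v hk hu hv b := by
    have h := entry_lt hk hu hv (Bool.toNat_le b)
    have h2 := Nat.mul_le_mul_right W (show u + 1 ≤ W from hu)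
    rw [add_mul, one_mul] at h2
    have := G.getD_encode hk (r := 1 + 2 * (u * W + v) + b.toNat)
      (by have := Bool.toNat_le b; omega)
    rw [G.getD_row hu hv, ← initState_mem_natCast] at this
    rw [← this]
    congr 1
    push_cast
    ring
  le := by rw [G.length_encode]; push_cast; exact le_rfl

end WordRAM

/-! ### The program for the reduction -/

namespace WordRAM

open LCISBlocks

/-- Write the block with number `reg 13` of a sequence. -/
def emitBlock (side : Bool) : Stm :=
  .seq (emitLow side) (.seq (emitMid side) (.seq (emitHigh side) (.assign 13 (.reg 13 + 1))))

/-- Write a sequence. -/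
def emitSequence (side : Bool) : Stm :=
  .seq (.assign 13 0) (.while (.reg 13) (.reg 10) (emitBlock side))

theorem Wp.assign_seq_nat {V : ℤ} {q : Stm} {s : State} {τ : ℕ} {Q : State → Prop} {e : Expr}
    {r x : ℕ} (he : e.eval s = x) (hx : (x : ℤ) ≤ V) (h : Wp V q (s.setReg r x) τ Q) :
    Wp V (.seq (.assign r e) q) s (τ + 1) Q :=
  Wp.assign_seq (by rw [he]; exact abs_natCast_le hx) (by rw [he]; exact h)

section

variable {N W T : ℕ} {G : BranchingProgram N W T} {K d : ℕ} {s : State} {V : ℤ} {m : ℤ → ℤ} {P : ℤ}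
  {L : List ℤ}

theorem BPParams.params (h : BPParams G K d s) : Params ((2 * W) ^ d) (2 ^ K) s :=
  ⟨h.leaves, h.blocks⟩

theorem emitBlock_spec (hV : Bounds N W T K d V) (hp : BPParams G K d s) (side : Bool)
    (hm : Table G m P) (hO : Out m P L s) {i : ℕ} (h13 : s.reg 13 = i) (hi : i < 2 ^ K)
    (hL : P + (L.length + ((G.gadgets K d).block side i).length) ≤ V) (hP : 0 ≤ P) :
    Wp V (emitBlock side) s
      (26 * K + (10 * d + 17) * (2 * W) ^ d + 8 + 4 * ((G.gadgets K d).block side i).length)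
      (fun s' => s'.reg 13 = (i + 1 : ℕ) ∧
        Out m P (L ++ ((G.gadgets K d).block side i).map (↑)) s') := by
  have hVD := hV.mirror
  have h2n := two_pow_le_cast hV.D_pos hVD
  rw [Gadgets.block, List.length_append, List.length_append] at hL ⊢
  push_cast at hL
  refine (Wp.seq ((emitLow_spec side hV.D_pos hp.params h13 hi hVD hO (by omega) hP).mono
    (fun s1 hf1 hO1 => ?_) le_rfl) (τ₂ := (10 * d + 17) * (2 * W) ^ d + 2 +
      (13 * K + 4 * (high ((2 * W) ^ d) K side i).length + 3 + 1))).mono (fun _ _ h => h) (by omega)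
  have hp1 := hp.frame hf1 (by cases side <;> rfl)
  have r1 : s1.reg 13 = i := by rw [hf1.reg 13 (by cases side <;> rfl), h13]
  refine Wp.seq ((emitMid_spec hV hp1 side hm hO1 r1 (by
    rw [List.length_append, List.length_map]; push_cast; omega) hP).mono
    (fun s2 hf2 hO2 => ?_) le_rfl)
  have hp2 := hp1.frame hf2 (by cases side <;> rfl)
  have r2 : s2.reg 13 = i := by rw [hf2.reg 13 (by cases side <;> rfl), r1]
  refine Wp.seq ((emitHigh_spec side hV.D_pos hp2.params r2 hi hVD hO2 (by
    simp only [List.length_append, List.length_map]; push_cast; omega) hP).mono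
    (fun s3 hf3 hO3 => ?_) le_rfl)
  have e13 : (Expr.reg 13 + 1).eval s3 = (i + 1 : ℕ) := by
    rw [Expr.eval_add, Expr.eval_reg, Expr.eval_one, hf3.reg 13 (by cases side <;> rfl), r2]
    push_cast; ring
  refine Wp.assign ?_ ⟨?_, ?_⟩
  · rw [e13]; exact abs_natCast_le (by omega)
  · rw [e13]; simp [State.setReg_reg]
  · rw [List.map_append, List.map_append, ← List.append_assoc, ← List.append_assoc]
    exact hO3.setReg (by norm_num) _

theorem emitSequence_spec (hV : Bounds N W T K d V) (hp : BPParams G K d s) (side : Bool)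
    (hm : Table G m P) (hO : Out m P L s)
    (hL : P + (L.length + ((G.gadgets K d).sequence side).length) ≤ V) (hP : 0 ≤ P) :
    Wp V (emitSequence side) s ((26 * K + (10 * d + 17) * (2 * W) ^ d + 9) * 2 ^ K +
        4 * ((G.gadgets K d).sequence side).length + 2)
      (Out m P (L ++ ((G.gadgets K d).sequence side).map (↑))) := by
  have hlist : ((G.gadgets K d).sequence side).map (fun x : ℕ => (x : ℤ)) =
      (List.range (2 ^ K)).flatMap fun i =>
        ((G.gadgets K d).block side i).map (Nat.cast : ℕ → ℤ) := by
    rw [Gadgets.sequence, List.map_flatMap]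
  have hlen : ((G.gadgets K d).sequence side).length = ((List.range (2 ^ K)).flatMap fun i =>
      ((G.gadgets K d).block side i).map (Nat.cast : ℕ → ℤ)).length := by
    rw [← hlist, List.length_map]
  rw [hlist, hlen]
  rw [hlen] at hL
  refine (Wp.assign_seq (by rw [Expr.eval_zero, abs_zero]; omega)
    (Wp.emit_loop (I := fun j s' => s'.reg 13 = j) ?_ (hO.setReg (by norm_num) _) hL ?_ ?_)).mono
      (fun _ _ h => h) le_rfl
  · simp [State.setReg_reg, Expr.eval_zero]
  · intro i hi s' L' hf hI hO' hL'
    have hp' : BPParams G K d s' := by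
      refine BPParams.frame ?_ hf (by cases side <;> rfl)
      exact hp.setReg (by norm_num) _
    refine ⟨by rw [Expr.eval_reg, Expr.eval_reg, hI, hp'.blocks]; exact_mod_cast hi, ?_⟩
    rw [List.length_map] at hL' ⊢
    exact emitBlock_spec hV hp' side hm hO' hI hi hL' hP
  · intro s' hf hI
    have hp' : BPParams G K d s' := by
      refine BPParams.frame ?_ hf (by cases side <;> rfl)
      exact hp.setReg (by norm_num) _
    rw [Expr.eval_reg, Expr.eval_reg, hI, hp'.blocks]
    exact lt_irrefl _

end

/-- Compute the size of the formula. -/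
def sizeLoop : Stm :=
  .while (.reg 8) (.reg 4) (.seq (.assign 8 (2 * .reg 8)) (.assign 9 (.reg 9 * (2 * .reg 3))))

/-- The two conditions on d say that it is the least exponent with T ≤ 2 ^ d, so that doubling until
T is reached takes exactly d rounds. -/
theorem sizeLoop_spec {V : ℤ} {s : State} {N W T K d : ℕ} (hV : Bounds N W T K d V)
    (hd : T ≤ 2 ^ d) (hd' : ∀ j < d, 2 ^ j < T) (h3 : s.reg 3 = W) (h4 : s.reg 4 = T)
    (h8 : s.reg 8 = 1) (h9 : s.reg 9 = 1) :
    Wp V sizeLoop s (3 * d + 1)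
      (fun s' => s'.reg 8 = (2 ^ d : ℕ) ∧ s'.reg 9 = ((2 * W) ^ d : ℕ)) := by
  refine (Wp.while_const (τ := 2) (n := d)
    (I := fun j s' => s'.reg 8 = (2 ^ j : ℕ) ∧ s'.reg 9 = ((2 * W) ^ j : ℕ)) ?_ ?_ ?_).mono
      (fun _ _ h => h) (by omega)
  · simp [h8, h9]
  · intro j hj s' hf ⟨r8, r9⟩
    have r4 : s'.reg 4 = T := by rw [hf.reg 4 rfl, h4]
    have r3 : s'.reg 3 = W := by rw [hf.reg 3 rfl, h3]
    have e8 : (2 * Expr.reg 8).eval s' = (2 ^ (j + 1) : ℕ) := by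
      rw [Expr.eval_mul, Expr.eval_ofNat, Expr.eval_reg, r8, pow_succ']; push_cast; rfl
    have e9 : (Expr.reg 9 * (2 * Expr.reg 3)).eval (s'.setReg 8 (2 ^ (j + 1) : ℕ)) =
        ((2 * W) ^ (j + 1) : ℕ) := by
      simp only [Expr.eval_mul, Expr.eval_ofNat, Expr.eval_reg, State.setReg_reg]
      simp only [Nat.reduceEqDiff, if_false, r3, r9]
      push_cast; ring
    refine ⟨by rw [Expr.eval_reg, Expr.eval_reg, r8, r4]; exact_mod_cast hd' j hj, ?_⟩
    refine Wp.assign_seq (τ := 1) ?_ (Wp.assign ?_ ⟨?_, ?_⟩)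
    · rw [e8]
      exact abs_natCast_le (le_trans (by exact_mod_cast Nat.pow_le_pow_right two_pos hj) hV.H)
    · rw [e8, e9]
      have hW := hV.W_pos
      exact abs_natCast_le (le_trans (by
        exact_mod_cast Nat.pow_le_pow_right (show 0 < 2 * W by omega) hj) hV.D)
    · rw [e8]; simp [State.setReg_reg]
    · rw [e8, e9]; simp [State.setReg_reg]
  · intro s' hf ⟨r8, r9⟩
    have r4 : s'.reg 4 = T := by rw [hf.reg 4 rfl, h4]
    refine ⟨?_, r8, r9⟩
    rw [Expr.eval_reg, Expr.eval_reg, r8, r4]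
    exact_mod_cast not_lt.2 hd

/-- Compute the number of blocks. -/
def blocksLoop : Stm :=
  .while (.reg 13) (.reg 11) (.seq (.assign 10 (2 * .reg 10)) (.assign 13 (.reg 13 + 1)))

theorem blocksLoop_spec {V : ℤ} {s : State} {K : ℕ} (hV : ((2 ^ K : ℕ) : ℤ) ≤ V)
    (h11 : s.reg 11 = K) (h10 : s.reg 10 = 1) (h13 : s.reg 13 = 0) :
    Wp V blocksLoop s (3 * K + 1) (fun s' => s'.reg 10 = (2 ^ K : ℕ)) := by
  refine (Wp.while_const (τ := 2) (n := K)
    (I := fun j s' => s'.reg 10 = (2 ^ j : ℕ) ∧ s'.reg 13 = (j : ℕ)) ?_ ?_ ?_).mono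
      (fun _ _ h => h) (by omega)
  · simp [h10, h13]
  · intro j hj s' hf ⟨r10, r13⟩
    have r11 : s'.reg 11 = K := by rw [hf.reg 11 rfl, h11]
    have e10 : (2 * Expr.reg 10).eval s' = (2 ^ (j + 1) : ℕ) := by
      rw [Expr.eval_mul, Expr.eval_ofNat, Expr.eval_reg, r10, pow_succ']; push_cast; rfl
    have e13 : (Expr.reg 13 + 1).eval (s'.setReg 10 (2 ^ (j + 1) : ℕ)) = (j + 1 : ℕ) := by
      simp [Expr.eval_add, Expr.eval_one, Expr.eval_reg, State.setReg_reg, r13]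
    have hjK : j + 1 ≤ 2 ^ K := (Nat.succ_le_of_lt hj).trans Nat.lt_two_pow_self.le
    refine ⟨by rw [Expr.eval_reg, Expr.eval_reg, r13, r11]; exact_mod_cast hj, ?_⟩
    refine Wp.assign_seq (τ := 1) ?_ (Wp.assign ?_ ⟨?_, ?_⟩)
    · rw [e10]
      exact abs_natCast_le (le_trans (by exact_mod_cast Nat.pow_le_pow_right two_pos hj) hV)
    · rw [e10, e13]
      exact abs_natCast_le (by omega)
    · rw [e10]; simp [State.setReg_reg]
    · rw [e10, e13]; simp [State.setReg_reg]
  · intro s' hf ⟨r10, r13⟩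
    have r11 : s'.reg 11 = K := by rw [hf.reg 11 rfl, h11]
    exact ⟨by rw [Expr.eval_reg, Expr.eval_reg, r13, r11]; exact lt_irrefl _, r10⟩

/-- Load and compute the parameters. -/
def loadParams : Stm :=
  .seq (.assign 3 (.deref 1)) (.seq (.assign 4 (.deref 2)) (.seq (.assign 5 (.deref 3))
  (.seq (.assign 6 (.deref 4)) (.seq (.assign 7 (1 + 2 * (.reg 3 * .reg 3)))
  (.seq (.assign 1 (5 + (.reg 4 - 1) * .reg 7)) (.seq (.assign 12 (.reg 1 + 2))
  (.seq (.assign 11 ((.deref 0 + 1) / 2)) (.seq (.assign 8 1) (.seq (.assign 9 1)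
  (.seq (.assign 10 1) (.seq (.assign 13 0) (.seq sizeLoop blocksLoop))))))))))))

theorem loadParams_spec {V : ℤ} {N W T : ℕ} (G : BranchingProgram N W T) {d : ℕ}
    (hV : Bounds N W T ((N + 1) / 2) d V) (hd : T ≤ 2 ^ d) (hd' : ∀ j < d, 2 ^ j < T)
    (hW : ((1 + 2 * (W * W) : ℕ) : ℤ) ≤ V) (hB : (G.encode.length + 2 : ℤ) ≤ V) :
    Wp V loadParams (initState G.encode) (3 * d + 3 * ((N + 1) / 2) + 14) (fun s' =>
      BPParams G ((N + 1) / 2) d s' ∧ s'.reg 1 = G.encode.length ∧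
      s'.reg 12 = (G.encode.length : ℤ) + 2) := by
  have hm : ∀ (a : ℕ), (initState G.encode).mem a = G.encode.getD a 0 := initState_mem_natCast _
  have h0 : (initState G.encode).mem 0 = N := hm 0
  have h1 : (initState G.encode).mem 1 = W := hm 1
  have h2 : (initState G.encode).mem 2 = T := hm 2
  have h3 : (initState G.encode).mem 3 = (G.start : ℕ) := hm 3
  have h4 : (initState G.encode).mem 4 = (G.accept : ℕ) := hm 4
  have hWV := hV.width
  have hTV := hV.length
  have hS := G.start.2
  have hA := G.accept.2
  have hT := G.length_pos
  have hlen := G.length_encode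
  set s0 := initState G.encode with hs0
  have hB' : ((T : ℤ) - 1) * (1 + 2 * (W * W)) + 5 = G.encode.length := by
    rw [hlen]; push_cast [Nat.cast_sub (show 1 ≤ T from hT)]; ring
  have hNV := hV.vars
  have h2n := two_pow_le_cast hV.D_pos hV.mirror
  have hV1 : ((1 : ℕ) : ℤ) ≤ V := by omega
  refine (Wp.assign_seq_nat (x := W) (by simp [Expr.eval_deref, Expr.eval_one, h1]) hWV
    (Wp.assign_seq_nat (x := T) ?_ hTV (Wp.assign_seq_nat (x := G.start) ?_ (by omega)
    (Wp.assign_seq_nat (x := G.accept) ?_ (by omega)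
    (Wp.assign_seq_nat (x := 1 + 2 * (W * W)) ?_ hW
    (Wp.assign_seq_nat (x := G.encode.length) ?_ (by omega)
    (Wp.assign_seq_nat (x := G.encode.length + 2) ?_ (by push_cast; exact hB)
    (Wp.assign_seq_nat (x := (N + 1) / 2) ?_ (by omega)
    (Wp.assign_seq_nat (x := 1) ?_ hV1 (Wp.assign_seq_nat (x := 1) ?_ hV1
    (Wp.assign_seq_nat (x := 1) ?_ hV1 (Wp.assign_seq_nat (x := 0) ?_ (by omega)
    (Wp.seq (τ₁ := 3 * d + 1) (τ₂ := 3 * ((N + 1) / 2) + 1)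
      ((sizeLoop_spec hV hd hd' ?_ ?_ ?_ ?_).mono (fun s1 hf1 ⟨r8, r9⟩ =>
        (blocksLoop_spec (K := (N + 1) / 2) ?_ ?_ ?_ ?_).mono (fun s2 hf2 r10 =>
          ⟨⟨?_, ?_, ?_, ?_, ?_, ?_, ?_, ?_, ?_⟩, ?_, ?_⟩) le_rfl) le_rfl)))))))))))))).mono
    (fun _ _ h => h) (by omega)
  · simp [Expr.eval_deref, Expr.eval_ofNat, State.setReg_mem, h2]
  · simp [Expr.eval_deref, Expr.eval_ofNat, State.setReg_mem, h3]
  · simp [Expr.eval_deref, Expr.eval_ofNat, State.setReg_mem, h4]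
  · simp [Expr.eval_add, Expr.eval_mul, Expr.eval_ofNat, Expr.eval_reg, State.setReg_reg]
  · simp [Expr.eval_add, Expr.eval_sub, Expr.eval_mul, Expr.eval_ofNat, Expr.eval_reg,
      State.setReg_reg]
    linarith
  · simp [Expr.eval_add, Expr.eval_ofNat, Expr.eval_reg, State.setReg_reg]
  · simp [Expr.eval_add, Expr.eval_div, Expr.eval_ofNat,
      Expr.eval_deref, State.setReg_mem, h0]
  · simp [Expr.eval_one]
  · simp [Expr.eval_one]
  · simp [Expr.eval_one]
  · simp [Expr.eval_zero]
  · simp [State.setReg_reg]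
  · simp [State.setReg_reg]
  · simp [State.setReg_reg]
  · simp [State.setReg_reg]
  · omega
  · rw [hf1.reg 11 rfl]; simp [State.setReg_reg]
  · rw [hf1.reg 10 rfl]; simp [State.setReg_reg]
  · rw [hf1.reg 13 rfl]; simp [State.setReg_reg]
  · rw [hf2.reg 3 rfl, hf1.reg 3 rfl]; simp [State.setReg_reg]
  · rw [hf2.reg 4 rfl, hf1.reg 4 rfl]; simp [State.setReg_reg]
  · rw [hf2.reg 5 rfl, hf1.reg 5 rfl]; simp [State.setReg_reg]
  · rw [hf2.reg 6 rfl, hf1.reg 6 rfl]; simp [State.setReg_reg]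
  · rw [hf2.reg 7 rfl, hf1.reg 7 rfl]; simp [State.setReg_reg]
  · rw [hf2.reg 8 rfl, r8]
  · rw [hf2.reg 9 rfl, r9]
  · exact r10
  · rw [hf2.reg 11 rfl, hf1.reg 11 rfl]; simp [State.setReg_reg]
  · rw [hf2.reg 1 rfl, hf1.reg 1 rfl]; simp [State.setReg_reg]
  · rw [hf2.reg 12 rfl, hf1.reg 12 rfl]; simp [State.setReg_reg]

/-- Write the two sequences behind the input, and compute the threshold. -/
def reduction : Stm :=
  .seq loadParams (.seq (emitSequence false)
  (.seq (.assign 32 (.reg 12 - .reg 1 - 2)) (.seq (.store (.reg 1) (.reg 32))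
  (.seq (emitSequence true) (.seq (.store (.reg 1 + 1) (.reg 12 - .reg 1 - 2 - .reg 32))
  (.assign 31 (.reg 9 * (2 * (.reg 10 - 1)) + .reg 8)))))))

/-- The LCIS instance is written directly behind the input, whose table is still read. The lengths
are known only afterwards; two cells are reserved for them and filled in later. -/
theorem reduction_spec {V : ℤ} {N W T : ℕ} (G : BranchingProgram N W T) {K d : ℕ}
    (hK : K = (N + 1) / 2)
    (hV : Bounds N W T K d V) (hd : T ≤ 2 ^ d) (hd' : ∀ j < d, 2 ^ j < T)
    (hW : ((1 + 2 * (W * W) : ℕ) : ℤ) ≤ V)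
    (hB : (G.encode.length + 2 + (2 * ((4 * K + 1) * (2 ^ K * (2 * W) ^ d)) : ℕ) : ℤ) ≤ V) :
    Wp V reduction (initState G.encode) (3 * d + 3 * K + 22 +
      2 * ((26 * K + (10 * d + 17) * (2 * W) ^ d + 9) * 2 ^ K +
        4 * ((4 * K + 1) * (2 ^ K * (2 * W) ^ d)))) (fun s' =>
      s'.mem = writeList (initState G.encode).mem G.encode.length
        (encodeLCIS (((G.gadgets K d).sequence false).map (↑))
          (((G.gadgets K d).sequence true).map (↑))) ∧
      s'.reg 1 = G.encode.length ∧
      s'.reg 31 = ((2 * W) ^ d * (2 * (2 ^ K - 1)) + 2 ^ d : ℕ)) := by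
  have hX := (G.gadgets K d).length_sequence_le false
  have hY := (G.gadgets K d).length_sequence_le true
  have hVD := hV.mirror
  have hDpos := hV.D_pos
  have h2n := two_pow_le_cast hDpos hVD
  have hHD : 2 ^ d ≤ (2 * W) ^ d := by
    have := hV.W_pos
    exact Nat.pow_le_pow_left (by omega) d
  have hthr : (2 * W) ^ d * (2 * (2 ^ K - 1)) + 2 ^ d ≤ mirror ((2 * W) ^ d) K := by
    rw [mirror]
    have h1 : (2 * W) ^ d * (2 * (2 ^ K - 1)) ≤ (2 * W) ^ d * (2 * (2 ^ K)) :=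
      Nat.mul_le_mul_left _ (by omega)
    have h2 : 2 * (3 * (2 * W) ^ d * 2 ^ K) = 3 * ((2 * W) ^ d * (2 * (2 ^ K))) := by ring
    omega
  have htab := table_encode G
  set X := (G.gadgets K d).sequence false with hXdef
  set Y := (G.gadgets K d).sequence true with hYdef
  set Λ := (4 * K + 1) * (2 ^ K * (2 * W) ^ d) with hΛ
  set B := G.encode.length with hBdef
  set m := (initState G.encode).mem with hm
  set α := 26 * K + (10 * d + 17) * (2 * W) ^ d + 9 with hα
  push_cast at hB
  -- The memory behind the input is zero, so the two reserved cells count as already written.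
  have hm0 : m = writeList m B [0, 0] := by
    funext a
    rw [writeList]
    split_ifs with h
    · rw [hm, initState_mem_eq_zero (Or.inr h.1)]
      rcases (a - B).toNat with _ | _ | k <;> rfl
    · rfl
  have hload : Wp V loadParams (initState G.encode) (3 * d + 3 * K + 14) (fun s' =>
      BPParams G K d s' ∧ s'.reg 1 = B ∧ s'.reg 12 = (B : ℤ) + 2) := by
    have := loadParams_spec G (hK ▸ hV) hd hd' hW (by omega)
    rwa [← hK] at this
  refine (Wp.seq (τ₂ := (α * 2 ^ K + 4 * X.length + 2) + (1 + (1 +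
    ((α * 2 ^ K + 4 * Y.length + 2) + (1 + 1))))) (hload.mono
    (fun s1 hf1 ⟨hp1, b1, p1⟩ => ?_) le_rfl)).mono (fun _ _ h => h) (by omega)
  have hO1 : Out m B [0, 0] s1 := ⟨by rw [hf1.mem rfl]; exact hm0, by rw [p1]; rfl⟩
  refine Wp.seq ((emitSequence_spec hV hp1 false htab hO1 (by
    rw [← hXdef]; simp only [List.length_cons, List.length_nil]; push_cast; omega)
    (by omega)).mono (fun s2 hf2 hO2 => ?_) le_rfl)
  have hp2 := hp1.frame hf2 rfl
  have b2 : s2.reg 1 = B := by rw [hf2.reg 1 rfl, b1]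
  have e32 : (Expr.reg 12 - Expr.reg 1 - 2).eval s2 = X.length := by
    rw [Expr.eval_sub, Expr.eval_sub, Expr.eval_reg, Expr.eval_reg, Expr.eval_ofNat, hO2.ptr, b2,
      ← hXdef]
    simp
    ring
  rw [add_comm 1]
  refine Wp.assign_seq_nat e32 (by omega) ?_
  set s3 := s2.setReg 32 (X.length : ℕ) with hs3
  have hp3 : BPParams G K d s3 := hp2.setReg (by norm_num) _
  have hO3 : Out m B _ s3 := hO2.setReg (by norm_num) _
  have b3 : s3.reg 1 = B := by simp [hs3, State.setReg_reg, b2]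
  have r3 : s3.reg 32 = X.length := by simp [hs3, State.setReg_reg]
  refine Wp.seq (Wp.store (by rw [Expr.eval_reg, r3]; exact abs_natCast_le (by omega)) ?_)
  rw [Expr.eval_reg, Expr.eval_reg, r3, b3]
  set s4 := s3.setMem B X.length with hs4
  have hp4 : BPParams G K d s4 := hp3.congr fun _ _ _ => rfl
  have hO4 : Out m B ((X.length : ℤ) :: 0 :: X.map (↑)) s4 := by
    refine ⟨?_, ?_⟩
    · rw [hs4, State.setMem_mem, hO3.mem]
      have := writeList_set (m := m) (P := B) (L := [0, 0] ++ X.map (↑)) (k := 0) (by simp) X.length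
      rw [Nat.cast_zero, add_zero] at this
      exact this
    · rw [hs4, State.setMem_reg, hO3.ptr]; rfl
  refine Wp.seq ((emitSequence_spec hV hp4 true htab hO4 (by
    rw [← hYdef]; simp only [List.length_cons, List.length_map]; push_cast; omega)
    (by omega)).mono (fun s5 hf5 hO5 => ?_) le_rfl)
  have hp5 := hp4.frame hf5 rfl
  have b5 : s5.reg 1 = B := by rw [hf5.reg 1 rfl]; exact b3
  have r5 : s5.reg 32 = X.length := by rw [hf5.reg 32 rfl]; exact r3
  have e5 : (Expr.reg 12 - Expr.reg 1 - 2 - Expr.reg 32).eval s5 = Y.length := by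
    simp only [Expr.eval_sub, Expr.eval_reg, Expr.eval_ofNat, hO5.ptr, b5, r5, ← hYdef]
    simp
    ring
  have e5' : (Expr.reg 1 + 1).eval s5 = (B : ℤ) + (1 : ℕ) := by
    rw [Expr.eval_add, Expr.eval_reg, Expr.eval_one, b5]; rfl
  refine Wp.seq (Wp.store (by rw [e5]; exact abs_natCast_le (by omega)) ?_)
  rw [e5, e5']
  set s6 := s5.setMem ((B : ℤ) + (1 : ℕ)) Y.length with hs6
  have hp6 : BPParams G K d s6 := hp5.congr fun _ _ _ => rfl
  have e6 : (Expr.reg 9 * (2 * (Expr.reg 10 - 1)) + Expr.reg 8).eval s6 =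
      ((2 * W) ^ d * (2 * (2 ^ K - 1)) + 2 ^ d : ℕ) := by
    simp only [Expr.eval_add, Expr.eval_mul, Expr.eval_sub, Expr.eval_reg, Expr.eval_ofNat,
      hp6.leaves, hp6.blocks, hp6.half]
    push_cast [Nat.cast_sub Nat.one_le_two_pow]
    ring
  refine Wp.assign (by rw [e6]; exact abs_natCast_le (by omega)) ⟨?_, ?_, ?_⟩
  · rw [State.setReg_mem, hs6, State.setMem_mem, hO5.mem, writeList_set (by simp)]
    simp [encodeLCIS, ← hYdef]
  · rw [State.setReg_reg, if_neg (by norm_num), hs6, State.setMem_reg, b5]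
  · rw [e6, State.setReg_reg, if_pos rfl]

end WordRAM

/-! ### The program for satisfiability -/

namespace WordRAM

open LCISBlocks

/-- The constants fix the layout: 40 registers for the reduction, expressions of size at most 20,
hence scratch registers below 61. The embedded program can therefore start at register 70. -/
theorem reduction_wf : reduction.wf 40 20 = true := by decide

/-- Decide satisfiability of branching programs by means of the program `p` for LCIS. -/
def satProg (p : Prog) : Prog :=
  .seq (reduction.comp 40) (.seq (p.embed 70) (.ifLt 70 31 (.const 0 0) (.const 0 1)))

/-- Around the two lists the memory is zero, so the translated memory looks exactly like a fresh
memory with input l. -/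
theorem mem_encodeLCIS_layout {l m : List ℤ} {a : ℤ} :
    writeList (initState m).mem m.length l (shiftAddr m.length a) = (initState l).mem a := by
  rw [shiftAddr, writeList]
  split_ifs with h1 h2 h2
  · omega
  · rw [initState_mem_eq_zero (Or.inl h1), initState_mem_eq_zero (Or.inl h1)]
  · rw [initState, add_sub_cancel_right]
    exact (if_pos (by omega)).symm
  · rw [initState_mem_eq_zero (Or.inr (by omega)), initState_mem_eq_zero (Or.inr (by omega))]

-- After the reduction, the registers from 61 on are zero and the translated memory holds the
-- instance, so the embedded program starts in its initial state. Below 70 it changes register 0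
-- only; the threshold in register 31 survives and is compared with the output in register 70. The
-- factor 121 = 6 * 20 + 1 is the slowdown of compilation, 4 that of embedding.
open Classical in
theorem satProg_computes {p : Prog} {N W T K d w wp : ℕ} (G : BranchingProgram N W T) {V : ℤ} {τ : ℝ}
    (hK : K = (N + 1) / 2)
    (hV : Bounds N W T K d V) (hd : T ≤ 2 ^ d) (hd' : ∀ j < d, 2 ^ j < T)
    (hW : ((1 + 2 * (W * W) : ℕ) : ℤ) ≤ V)
    (hB : (G.encode.length + 2 + (2 * ((4 * K + 1) * (2 ^ K * (2 * W) ^ d)) : ℕ) : ℤ) ≤ V)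
    (h8 : 8 ≤ V) (hin : (N + W + T : ℤ) ≤ V) (hw : V ^ 20 < 2 ^ w)
    (hwp : (2 : ℤ) ^ wp + G.encode.length ≤ 2 ^ w)
    (hp : Computes wp p (encodeLCIS (((G.gadgets K d).sequence false).map (↑))
      (((G.gadgets K d).sequence true).map (↑))) τ (G.gadgets K d).value) :
    Computes w (satProg p) G.encode
      (121 * (3 * d + 3 * K + 22 + 2 * ((26 * K + (10 * d + 17) * (2 * W) ^ d + 9) * 2 ^ K +
        4 * ((4 * K + 1) * (2 ^ K * (2 * W) ^ d))) : ℕ) + 4 * τ + 2)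
      (if G.Satisfiable then 1 else 0) := by
  obtain ⟨t₁, s₁, h₁, ht₁, hm₁, b₁, r₁⟩ := reduction_spec G hK hV hd hd' hW hB
  have hbdd : (initState G.encode).Bdd V := by
    refine ⟨fun r => by simp only [initState, abs_zero]; omega, fun a => ?_⟩
    by_cases ha : a < 0 ∨ (G.encode.length : ℤ) ≤ a
    · rw [initState_mem_eq_zero ha, abs_zero]; omega
    · push Not at ha
      lift a to ℕ using ha.1
      rw [initState_mem_natCast, List.getD_eq_getElem _ _ (by omega)]
      exact (G.abs_le_of_mem_encode (List.getElem_mem _)).trans hin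
  obtain ⟨t₂, c₂, h₂, ht₂, hc₂⟩ := h₁.comp_exec h8 hw reduction_wf hbdd (c := initState G.encode)
    ⟨fun _ _ => rfl, fun _ _ => rfl, rfl⟩
  obtain ⟨t₃, s₃, h₃, ht₃, hv₃⟩ := hp
  obtain ⟨t₄, c₄, h₄, ht₄, hc₄, hr₄⟩ := h₃.embed (k := 70) (c := c₂) (B := G.encode.length)
    (by norm_num) (by positivity) hwp
    ⟨fun r => by simp [initState, Fits], by rw [hc₂.reg 1 (by norm_num), b₁],
      fun r => by rw [hc₂.zero _ (by omega)]; rfl,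
      fun a => by rw [hc₂.mem, hm₁, mem_encodeLCIS_layout]⟩
  have r31 : c₄.reg 31 = ((2 * W) ^ d * (2 * (2 ^ K - 1)) + 2 ^ d : ℕ) := by
    rw [hr₄ 31 (by norm_num) (by norm_num), hc₂.reg 31 (by norm_num), r₁]
  have r70 : c₄.reg 70 = (G.gadgets K d).value := by
    rw [← hv₃]; exact hc₄.reg 0
  have hw1 : ∀ z : ℤ, |z| ≤ 1 → Fits w z := fun z hz =>
    hz.trans_lt ((one_le_pow₀ (by omega : (1 : ℤ) ≤ V)).trans_lt hw)
  have hsat := G.satisfiable_iff (K := K) (by omega) hd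
  have ht : ((t₂ + (t₄ + (1 + 1)) : ℕ) : ℝ) ≤ 121 * (3 * d + 3 * K + 22 + 2 * ((26 * K +
      (10 * d + 17) * (2 * W) ^ d + 9) * 2 ^ K +
        4 * ((4 * K + 1) * (2 ^ K * (2 * W) ^ d))) : ℕ) + 4 * τ + 2 := by
    have h1 : (t₂ : ℝ) ≤ 121 * (3 * d + 3 * K + 22 + 2 * ((26 * K +
      (10 * d + 17) * (2 * W) ^ d + 9) * 2 ^ K +
        4 * ((4 * K + 1) * (2 ^ K * (2 * W) ^ d))) : ℕ) := by
      exact_mod_cast ht₂.trans (Nat.mul_le_mul_left _ ht₁)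
    have h2 : (t₄ : ℝ) ≤ 4 * t₃ := by exact_mod_cast ht₄
    push_cast at h1 ⊢
    linarith
  by_cases hG : G.Satisfiable
  · rw [if_pos hG]
    refine ⟨_, _, .seq h₂ (.seq h₄ (.if_false ?_ (.const _ 0 1 (hw1 _ (by simp))))), ht, by
      simp [State.setReg]⟩
    rw [r70, r31, not_lt]
    exact_mod_cast hsat.1 hG
  · rw [if_neg hG]
    refine ⟨_, _, .seq h₂ (.seq h₄ (.if_true ?_ (.const _ 0 0 (hw1 _ (by simp))))), ht, by
      simp [State.setReg]⟩
    rw [r70, r31]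
    exact_mod_cast not_le.1 fun h => hG (hsat.2 h)

end WordRAM

/-! ### Asymptotics -/

namespace LogProductLittleO

/-- The function in `LogProductLittleO`. -/
noncomputable def logProduct (W T : ℕ) : ℝ :=
  Real.logb 2 (max W 2 : ℕ) * Real.logb 2 (max T 2 : ℕ)

theorem one_le_logb (x : ℕ) : 1 ≤ Real.logb 2 (max x 2 : ℕ) := by
  rw [Real.le_logb_iff_rpow_le one_lt_two (by positivity), Real.rpow_one]
  exact_mod_cast le_max_right x 2

theorem logProduct_nonneg (W T : ℕ) : 0 ≤ logProduct W T :=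
  mul_nonneg (zero_le_one.trans (one_le_logb W)) (zero_le_one.trans (one_le_logb T))

/-- The additive constant absorbs the finitely many N for which the asymptotic bound fails; this is
where constants come to depend on the functions W and T. -/
theorem exists_logProduct_le {W T : ℕ → ℕ} (h : LogProductLittleO W T) {δ : ℝ} (hδ : 0 < δ) :
    ∃ A, 0 ≤ A ∧ ∀ N : ℕ, logProduct (W N) (T N) ≤ δ * N + A := by
  obtain ⟨N₀, hN⟩ := eventually_atTop.1 (h.bound hδ)
  refine ⟨∑ N ∈ Finset.range N₀, logProduct (W N) (T N),
    Finset.sum_nonneg fun N _ => logProduct_nonneg _ _, fun N => ?_⟩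
  by_cases hlt : N < N₀
  · have := Finset.single_le_sum (f := fun N => logProduct (W N) (T N))
      (fun N _ => logProduct_nonneg _ _) (Finset.mem_range.2 hlt)
    have h0 : 0 ≤ δ * N := by positivity
    linarith
  · have h1 := hN N (not_lt.1 hlt)
    rw [Real.norm_natCast] at h1
    have h0 : 0 ≤ ∑ N ∈ Finset.range N₀, logProduct (W N) (T N) :=
      Finset.sum_nonneg fun N _ => logProduct_nonneg _ _
    exact (le_abs_self _).trans (h1.trans (by linarith))

theorem two_rpow_logb_max (x : ℕ) : (2 : ℝ) ^ Real.logb 2 (max x 2 : ℕ) = (max x 2 : ℕ) :=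
  Real.rpow_logb two_pos (by norm_num) (by positivity)

theorem width_le (W T : ℕ) : (W : ℝ) ≤ 2 ^ logProduct W T := by
  calc (W : ℝ) ≤ (max W 2 : ℕ) := by exact_mod_cast le_max_left W 2
    _ = 2 ^ Real.logb 2 (max W 2 : ℕ) := (two_rpow_logb_max W).symm
    _ ≤ _ := Real.rpow_le_rpow_of_exponent_le one_le_two
      (le_mul_of_one_le_right (zero_le_one.trans (one_le_logb W)) (one_le_logb T))

theorem length_le (W T : ℕ) : (T : ℝ) ≤ 2 ^ logProduct W T := by
  rw [logProduct, mul_comm]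
  exact width_le T W

theorem clog_le (T : ℕ) : (Nat.clog 2 T : ℝ) ≤ 2 * Real.logb 2 (max T 2 : ℕ) := by
  have h1 := one_le_logb T
  rcases Nat.eq_zero_or_pos (Nat.clog 2 T) with h | h
  · rw [h, Nat.cast_zero]; linarith
  · have h2 : 2 ^ (Nat.clog 2 T - 1) < T :=
      (Nat.lt_clog_iff_pow_lt one_lt_two).1 (by omega)
    have h3 : ((Nat.clog 2 T - 1 : ℕ) : ℝ) ≤ Real.logb 2 (max T 2 : ℕ) := by
      rw [Real.le_logb_iff_rpow_le one_lt_two (by positivity), Real.rpow_natCast]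
      exact_mod_cast h2.le.trans (le_max_left T 2)
    rw [Nat.cast_sub h, Nat.cast_one] at h3
    linarith

/-- 2W is at most the square of max W 2, and the rounded-up logarithm of T is at most twice the
logarithm of max T 2; the two factors 2 give the 4. -/
theorem leaves_le {W : ℕ} (hW : 0 < W) (T : ℕ) :
    (((2 * W) ^ Nat.clog 2 T : ℕ) : ℝ) ≤ 2 ^ (4 * logProduct W T) := by
  have hw := one_le_logb W
  have h1 : ((2 * W : ℕ) : ℝ) ≤ 2 ^ (2 * Real.logb 2 (max W 2 : ℕ)) := by
    rw [two_mul (Real.logb _ _), Real.rpow_add two_pos, two_rpow_logb_max]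
    exact_mod_cast Nat.mul_le_mul (le_max_right W 2) (le_max_left W 2)
  calc (((2 * W) ^ Nat.clog 2 T : ℕ) : ℝ) = ((2 * W : ℕ) : ℝ) ^ Nat.clog 2 T := by push_cast; rfl
    _ ≤ (2 ^ (2 * Real.logb 2 (max W 2 : ℕ))) ^ Nat.clog 2 T := by gcongr
    _ = 2 ^ (2 * Real.logb 2 (max W 2 : ℕ) * Nat.clog 2 T) := by
      rw [Real.rpow_mul zero_le_two _ (Nat.clog 2 T : ℝ), Real.rpow_natCast]
    _ ≤ _ := by
      refine Real.rpow_le_rpow_of_exponent_le one_le_two ?_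
      rw [logProduct]
      have := mul_le_mul_of_nonneg_left (clog_le T) (show 0 ≤ 2 * Real.logb 2 (max W 2 : ℕ) by linarith)
      linarith

/-- Polynomial factors and powers of the formula size are subexponential. -/
theorem exists_mul_leaves_sq_le {W T : ℕ → ℕ} (h : LogProductLittleO W T) {δ : ℝ} (hδ : 0 < δ) :
    ∃ A : ℝ, 1 ≤ A ∧ ∀ N : ℕ, 0 < W N →
      ((N + 1) * (2 * W N) ^ Nat.clog 2 (T N) * (2 * W N) ^ Nat.clog 2 (T N) : ℝ) ≤
        A * 2 ^ (δ * N) := by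
  -- The square of the formula size has exponent 8 times `logProduct`, which uses δ / 2 of the
  -- budget; the other half pays for N + 1.
  obtain ⟨A, hA, hN⟩ := h.exists_logProduct_le (show 0 < δ / 16 by positivity)
  have hlog : 0 < Real.log 2 := Real.log_pos one_lt_two
  set b := δ / 2 * Real.log 2 with hb
  have hb0 : 0 < b := by positivity
  refine ⟨(1 + 1 / b) * 2 ^ (8 * A), one_le_mul_of_one_le_of_one_le (by
    have : 0 < 1 / b := by positivity
    linarith) (Real.one_le_rpow one_le_two (by positivity)), fun N hW => ?_⟩
  have h1 : (N + 1 : ℝ) ≤ (1 + 1 / b) * 2 ^ (δ / 2 * N) := by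
    have h2 : (2 : ℝ) ^ (δ / 2 * N) = Real.exp (b * N) := by
      rw [Real.rpow_def_of_pos two_pos, hb]; congr 1; ring
    have h3 := Real.add_one_le_exp (b * N)
    rw [h2]
    calc (N + 1 : ℝ) ≤ (1 + 1 / b) * (b * N + 1) := by
          have : (1 + 1 / b) * (b * N + 1) = b * N + 1 + N + 1 / b := by field_simp; ring
          rw [this]
          have : 0 ≤ b * N + 1 / b := by positivity
          linarith
      _ ≤ _ := by gcongr
  have h2 := leaves_le hW (T N)
  push_cast at h2
  have h3 := hN N
  calc ((N + 1) * (2 * W N) ^ Nat.clog 2 (T N) * (2 * W N) ^ Nat.clog 2 (T N) : ℝ)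
      ≤ ((1 + 1 / b) * 2 ^ (δ / 2 * N)) * 2 ^ (4 * logProduct (W N) (T N)) *
        2 ^ (4 * logProduct (W N) (T N)) := by gcongr
    _ = (1 + 1 / b) * 2 ^ (δ / 2 * N + 4 * logProduct (W N) (T N) +
        4 * logProduct (W N) (T N)) := by
      rw [Real.rpow_add two_pos, Real.rpow_add two_pos]; ring
    _ ≤ (1 + 1 / b) * 2 ^ (8 * A + δ * N) := by
      refine mul_le_mul_of_nonneg_left (Real.rpow_le_rpow_of_exponent_le one_le_two ?_)
        (by positivity)
      linarith
    _ = _ := by rw [Real.rpow_add two_pos]; ring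

/-- Width, length and formula size are at most exponential. -/
theorem exists_le_two_pow {W T : ℕ → ℕ} (h : LogProductLittleO W T) :
    ∃ a : ℕ, 1 ≤ a ∧ ∀ N : ℕ, W N ≤ 2 ^ (a * (N + 1)) ∧ T N ≤ 2 ^ (a * (N + 1)) ∧
      (0 < W N → (2 * W N) ^ Nat.clog 2 (T N) ≤ (2 ^ (a * (N + 1))) ^ 4) := by
  obtain ⟨A, hA, hN⟩ := h.exists_logProduct_le one_pos
  obtain ⟨a, ha⟩ := exists_nat_ge (A + 1)
  refine ⟨a, by exact_mod_cast (show (1 : ℝ) ≤ a by linarith), fun N => ?_⟩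
  have h1 : logProduct (W N) (T N) ≤ (a * (N + 1) : ℕ) := by
    refine (hN N).trans ?_
    push_cast
    have : (0 : ℝ) ≤ (a - 1) * N := mul_nonneg (by linarith) (Nat.cast_nonneg N)
    linarith
  have key : (2 : ℝ) ^ logProduct (W N) (T N) ≤ (2 ^ (a * (N + 1)) : ℕ) := by
    rw [Nat.cast_pow, Nat.cast_two, ← Real.rpow_natCast]
    exact Real.rpow_le_rpow_of_exponent_le one_le_two h1
  refine ⟨by exact_mod_cast (width_le _ (T N)).trans key,
    by exact_mod_cast (length_le (W N) _).trans key, fun hW => ?_⟩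
  have h2 := leaves_le hW (T N)
  rw [mul_comm 4, Real.rpow_mul zero_le_two] at h2
  have h3 : ((2 : ℝ) ^ logProduct (W N) (T N)) ^ (4 : ℝ) ≤ ((2 ^ (a * (N + 1)) : ℕ) : ℝ) ^ (4 : ℝ) :=
    Real.rpow_le_rpow (by positivity) key (by norm_num)
  have h4 := h2.trans h3
  rw [show (4 : ℝ) = (4 : ℕ) by norm_num, Real.rpow_natCast] at h4
  exact_mod_cast h4

end LogProductLittleO

/-! ### Bounds on words, time and lengths -/

namespace WordRAM

open LCISBlocks

/-- A bound on the words in the reduction. -/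
def wordBound (N W T K D : ℕ) : ℕ :=
  5 + (T - 1) * (1 + 2 * (W * W)) + 2 + 2 * ((4 * K + 1) * (2 ^ K * D)) + (mirror D K + 1) +
    (N + W + T) + (1 + 2 * (W * W)) + 8

/-- Every summand is a small multiple of a power of Z up to the sixth; the total is at most 64 * Z ^
6, and 64 ≤ Z ^ 6. -/
theorem wordBound_le {N W T K D Z : ℕ} (hZ : 2 ≤ Z) (hN : N + 1 ≤ Z) (hW : W ≤ Z) (hT : T ≤ Z)
    (hK : K ≤ N) (hn : 2 ^ K ≤ Z) (hD : D ≤ Z ^ 4) : wordBound N W T K D ≤ Z ^ 12 := by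
  have hp : ∀ k ≤ 6, Z ^ k ≤ Z ^ 6 := fun k hk => Nat.pow_le_pow_right (by omega) hk
  have h0 := hp 0 (by norm_num)
  have h1 := hp 1 (by norm_num)
  have h2 := hp 2 (by norm_num)
  have h3 := hp 3 (by norm_num)
  have h4 := hp 4 (by norm_num)
  have h5 := hp 5 (by norm_num)
  have hWW : W * W ≤ Z ^ 2 := by rw [pow_two]; exact Nat.mul_le_mul hW hW
  have hTW : (T - 1) * (1 + 2 * (W * W)) ≤ Z * (1 + 2 * Z ^ 2) :=
    Nat.mul_le_mul (by omega) (by omega)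
  have hnD : 2 ^ K * D ≤ Z ^ 5 := by rw [pow_succ']; exact Nat.mul_le_mul hn hD
  have hL : (4 * K + 1) * (2 ^ K * D) ≤ (4 * Z) * Z ^ 5 := Nat.mul_le_mul (by omega) hnD
  have hM : mirror D K = 6 * (2 ^ K * D) + D := by rw [mirror]; ring
  have e1 : Z * (1 + 2 * Z ^ 2) = Z ^ 1 + 2 * Z ^ 3 := by ring
  have e2 : (4 * Z) * Z ^ 5 = 4 * Z ^ 6 := by ring
  have h6 : 64 * Z ^ 6 ≤ Z ^ 12 := by
    rw [show Z ^ 12 = Z ^ 6 * Z ^ 6 by ring]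
    exact Nat.mul_le_mul_right _ (Nat.pow_le_pow_left hZ 6)
  rw [pow_one] at h1 e1
  rw [pow_zero] at h0
  rw [wordBound, hM]
  omega

/-- The second factor D replaces the depth d in the cost of a gadget. This is generous but harmless,
as D is subexponential in N. -/
theorem reduction_time_le {N K d D : ℕ} (hK : K ≤ N) (hd : d + 1 ≤ D) :
    3 * d + 3 * K + 22 + 2 * ((26 * K + (10 * d + 17) * D + 9) * 2 ^ K +
      4 * ((4 * K + 1) * (2 ^ K * D))) ≤ 164 * ((N + 1) * D * D * 2 ^ K) := by
  obtain ⟨Q, hQ⟩ : ∃ Q, Q = (N + 1) * D * D := ⟨_, rfl⟩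
  have hD : 1 ≤ D := by omega
  have hDQ : D * D ≤ Q := by
    rw [hQ, mul_assoc]; exact Nat.le_mul_of_pos_left _ (by omega)
  have hKD : (N + 1) * D ≤ Q := by
    rw [hQ]; exact Nat.le_mul_of_pos_right _ hD
  have hDD : D ≤ D * D := Nat.le_mul_of_pos_left _ hD
  have hN : N + 1 ≤ (N + 1) * D := Nat.le_mul_of_pos_right _ hD
  have h1 : (10 * d + 17) * D ≤ 17 * (D * D) := by
    rw [← mul_assoc]; exact Nat.mul_le_mul_right _ (by omega)
  have h2 : (26 * K + (10 * d + 17) * D + 9) * 2 ^ K ≤ (52 * Q) * 2 ^ K :=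
    Nat.mul_le_mul_right _ (by omega)
  have h3 : (4 * K + 1) * (2 ^ K * D) ≤ (4 * Q) * 2 ^ K := by
    rw [mul_comm (2 ^ K), ← mul_assoc]
    refine Nat.mul_le_mul_right _ ?_
    calc (4 * K + 1) * D ≤ (4 * (N + 1)) * D := Nat.mul_le_mul_right _ (by omega)
      _ = 4 * ((N + 1) * D) := by ring
      _ ≤ _ := by omega
  have h4 : Q ≤ Q * 2 ^ K := Nat.le_mul_of_pos_right _ (by positivity)
  rw [← hQ]
  rw [mul_assoc] at h2 h3
  omega

theorem length_bound_le {N K D : ℕ} (hK : K ≤ N) (hD : 1 ≤ D) :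
    (4 * K + 1) * (2 ^ K * D) ≤ 4 * ((N + 1) * D * D * 2 ^ K) := by
  calc (4 * K + 1) * (2 ^ K * D) ≤ (4 * (N + 1)) * (2 ^ K * (D * D)) :=
        Nat.mul_le_mul (by omega) (Nat.mul_le_mul_left _ (Nat.le_mul_of_pos_left _ hD))
    _ = _ := by ring

end WordRAM

/-! ### The main theorem -/

/-- The exponent in the running time. -/
theorem rpow_size_le {ε A y : ℝ} (hε : 0 < ε) (hε1 : ε ≤ 1) (hA : 1 ≤ A) (N : ℕ) (hy0 : 0 ≤ y)
    (hy : y ≤ A * 2 ^ (ε / 8 * N) * 2 ^ ((N + 1) / 2)) :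
    y ^ (2 - ε) ≤ 4 * A ^ 2 * (2 - (2 - 2 ^ (1 - ε / 4))) ^ N := by
  have h1 : ((2 : ℝ) ^ ((N + 1) / 2) : ℝ) ≤ 2 * 2 ^ ((1 / 2 : ℝ) * N) := by
    rw [← Real.rpow_natCast]
    have : (((N + 1) / 2 : ℕ) : ℝ) ≤ 1 + 1 / 2 * N := by
      have := Nat.cast_div_le (α := ℝ) (m := N + 1) (n := 2)
      push_cast at this
      linarith
    refine (Real.rpow_le_rpow_of_exponent_le one_le_two this).trans ?_
    rw [Real.rpow_add two_pos, Real.rpow_one]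
  have h2 : y ≤ (2 * A) * 2 ^ ((1 / 2 + ε / 8) * N) := by
    calc y ≤ A * 2 ^ (ε / 8 * N) * 2 ^ ((N + 1) / 2) := hy
      _ ≤ A * 2 ^ (ε / 8 * N) * (2 * 2 ^ ((1 / 2 : ℝ) * N)) := by gcongr
      _ = _ := by rw [add_mul, Real.rpow_add two_pos]; ring
  calc y ^ (2 - ε) ≤ ((2 * A) * 2 ^ ((1 / 2 + ε / 8) * N)) ^ (2 - ε) :=
        Real.rpow_le_rpow hy0 h2 (by linarith)
    _ = (2 * A) ^ (2 - ε) * 2 ^ ((1 / 2 + ε / 8) * N * (2 - ε)) := by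
      rw [Real.mul_rpow (by positivity) (by positivity), ← Real.rpow_mul zero_le_two]
    _ ≤ (2 * A) ^ (2 : ℝ) * 2 ^ ((1 - ε / 4) * N) := by
      gcongr ?_ * ?_
      · exact Real.rpow_le_rpow_of_exponent_le (by linarith) (by linarith)
      · refine Real.rpow_le_rpow_of_exponent_le one_le_two ?_
        have : (1 / 2 + ε / 8) * N * (2 - ε) = ((1 / 2 + ε / 8) * (2 - ε)) * N := by ring
        rw [this]
        refine mul_le_mul_of_nonneg_right ?_ (Nat.cast_nonneg N)
        -- The product (1/2 + ε/8) * (2 - ε) equals 1 - ε/4 - ε²/8.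
        nlinarith [sq_nonneg ε]
    _ = _ := by
      rw [Real.rpow_two, Real.rpow_mul zero_le_two, Real.rpow_natCast]; ring

open WordRAM LCISBlocks in
theorem theorem1p6
    (hLCIS : ∃ ε : ℝ, 0 < ε ∧ ∃ p : WordRAM.Prog,
      SolvesLCISInTime p (fun n => (n : ℝ) ^ (2 - ε))) :
    ∃ ε : ℝ, 0 < ε ∧ ε < 2 ∧ ∃ q : WordRAM.Prog,
      ∀ W T : ℕ → ℕ, LogProductLittleO W T →
        SolvesBPSATInTime q W T (fun N => (2 - ε) ^ N) := by
  obtain ⟨ε', hε', p, C, c, hp⟩ := hLCIS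
  -- With ε ≤ 1 the exponent 2 - ε is at least 1, so that y ^ (2 - ε) also dominates the time y of
  -- the reduction.
  obtain ⟨ε, hε, hε1, hεε⟩ : ∃ ε : ℝ, 0 < ε ∧ ε ≤ 1 ∧ ε ≤ ε' :=
    ⟨min ε' 1, lt_min hε' one_pos, min_le_right _ _, min_le_left _ _⟩
  have hpow : (2 : ℝ) ^ (1 - ε / 4) < 2 :=
    (Real.rpow_lt_rpow_of_exponent_lt one_lt_two (by linarith)).trans_eq (Real.rpow_one 2)
  have hpos : (0 : ℝ) < 2 ^ (1 - ε / 4) := by positivity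
  refine ⟨2 - 2 ^ (1 - ε / 4), by linarith, by linarith, satProg p, fun W T hWT => ?_⟩
  obtain ⟨A, hA, hAN⟩ := hWT.exists_mul_leaves_sq_le (show 0 < ε / 8 by positivity)
  obtain ⟨a, ha, haN⟩ := hWT.exists_le_two_pow
  -- 121 * 164 comes from the compiled reduction, 64 = 4 * 16 from the embedding and from sequences
  -- of length at most 4y, and 2 from the final test. In the word size, 300 exceeds 12 * 20, needed
  -- for V ^ 20, and the factor c + 1 covers the words of the LCIS program.
  refine ⟨(121 * 164 + 64 * |C| + 2) * (4 * A ^ 2), 300 * a * (c + 1), fun N G => ?_⟩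
  obtain ⟨hWZ, hTZ, hDZ⟩ := haN N
  have hW : 0 < W N := by have := G.start.2; omega
  have hT := G.length_pos
  specialize hDZ hW
  specialize hAN N hW
  obtain ⟨d, hd⟩ : ∃ d, d = Nat.clog 2 (T N) := ⟨_, rfl⟩
  obtain ⟨K, hK⟩ : ∃ K, K = (N + 1) / 2 := ⟨_, rfl⟩
  obtain ⟨D, hD⟩ : ∃ D, D = (2 * W N) ^ d := ⟨_, rfl⟩
  have hAN : ((N + 1) * D * D : ℝ) ≤ A * 2 ^ (ε / 8 * N) := by
    rw [hD, hd]; push_cast; exact hAN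
  rw [← hd, ← hD] at hDZ
  have hdT : T N ≤ 2 ^ d := hd ▸ Nat.le_pow_clog one_lt_two _
  have hdT' : ∀ j < d, 2 ^ j < T N := fun j hj =>
    (Nat.lt_clog_iff_pow_lt one_lt_two).1 (hd ▸ hj)
  have hKN : K ≤ N := by omega
  have hdD : d + 1 ≤ D := by
    rw [hD]
    exact (Nat.succ_le_of_lt Nat.lt_two_pow_self).trans (Nat.pow_le_pow_left (by omega) d)
  obtain ⟨b, hb⟩ : ∃ b, b = a * (N + 1) := ⟨_, rfl⟩
  have hNb : N + 1 ≤ b := by rw [hb]; exact Nat.le_mul_of_pos_left _ ha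
  rw [← hb] at hWZ hTZ hDZ
  have hZ2 : 2 ≤ 2 ^ b := (pow_one 2).symm.le.trans (Nat.pow_le_pow_right two_pos (by omega))
  have hV := wordBound_le hZ2 (hNb.trans Nat.lt_two_pow_self.le) hWZ hTZ hKN
    (Nat.pow_le_pow_right two_pos (by omega)) hDZ
  obtain ⟨V, hVdef⟩ : ∃ V, V = wordBound N (W N) (T N) K D := ⟨_, rfl⟩
  rw [← hVdef, ← pow_mul] at hV
  rw [wordBound] at hVdef
  obtain ⟨L, hL⟩ : ∃ L, L = (4 * K + 1) * (2 ^ K * D) := ⟨_, rfl⟩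
  have hL1 : 1 ≤ L := by
    rw [hL]; exact Nat.mul_pos (by omega) (Nat.mul_pos (by positivity) (by omega))
  rw [← hL] at hVdef
  have hlen := G.length_encode
  set w := 300 * a * (c + 1) * (N + 1) with hw
  have hwb : w = 300 * (b * (c + 1)) := by rw [hw, hb]; ring
  have hbc : b * (c + 1) = b * c + b := by ring
  set wp := c * (Nat.log 2 (L + mirror D K) + 1) with hwp
  have hwpb : wp ≤ 13 * (b * c) := by
    have h1 : Nat.log 2 (L + mirror D K) ≤ b * 12 := by
      calc _ ≤ Nat.log 2 (2 ^ (b * 12)) := Nat.log_mono_right (by omega)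
        _ = _ := Nat.log_pow one_lt_two _
    calc wp ≤ c * (13 * b) := Nat.mul_le_mul_left _ (by omega)
      _ = _ := by ring
  have hseq : ∀ side, ∀ x ∈ ((G.gadgets K d).sequence side).map (Nat.cast : ℕ → ℤ),
      |x| ≤ (mirror D K : ℤ) := by
    intro side x hx
    obtain ⟨y, hy, rfl⟩ := List.mem_map.1 hx
    rw [hD]
    exact abs_natCast_le (by exact_mod_cast (G.gadgets K d).le_mirror_of_mem_sequence hy)
  have hlenseq : ∀ side, (((G.gadgets K d).sequence side).map (Nat.cast : ℕ → ℤ)).length ≤ L := by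
    intro side
    rw [List.length_map, hL, hD]
    exact (G.gadgets K d).length_sequence_le side
  have hcomp := hp L (mirror D K) _ _ hL1 (hlenseq false) (hlenseq true) (hseq false) (hseq true)
  have hsat := satProg_computes (w := w) G (V := V) hK (d := d)
    ⟨hW, by omega, by omega, by omega, by rw [← hD]; omega⟩ hdT hdT' (by omega)
    (by rw [← hD, ← hL]; exact_mod_cast (show G.encode.length + 2 + 2 * L ≤ V by omega))
    (by omega) (by omega) ?_ ?_ hcomp
  · obtain ⟨t, s, h1, h2, h3⟩ := hsat
    refine ⟨t, s, h1, h2.trans ?_, h3⟩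
    have hR := reduction_time_le hKN hdD
    have hLy := length_bound_le hKN (show 1 ≤ D by omega)
    rw [← hD, ← hL]
    rw [← hL] at hR hLy
    -- One quantity y bounds, up to constants, both the time of the reduction and the length of the
    -- sequences.
    obtain ⟨y, hy⟩ : ∃ y, y = (N + 1) * D * D * 2 ^ K := ⟨_, rfl⟩
    rw [← hy] at hR hLy
    have hy1 : (1 : ℝ) ≤ y := by exact_mod_cast (show 1 ≤ y by omega)
    have hyA : (y : ℝ) ^ (2 - ε) ≤ 4 * A ^ 2 * (2 - (2 - 2 ^ (1 - ε / 4))) ^ N := by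
      refine rpow_size_le hε hε1 hA N (by linarith) ?_
      rw [hy, ← hK]
      push_cast
      gcongr
    have hyy : (y : ℝ) ≤ (y : ℝ) ^ (2 - ε) := Real.self_le_rpow_of_one_le hy1 (by linarith)
    have hL1' : (1 : ℝ) ≤ L := by exact_mod_cast hL1
    have hLpow : (L : ℝ) ^ (2 - ε') ≤ 16 * (y : ℝ) ^ (2 - ε) := by
      calc (L : ℝ) ^ (2 - ε') ≤ (L : ℝ) ^ (2 - ε) :=
            Real.rpow_le_rpow_of_exponent_le hL1' (by linarith)
        _ ≤ (4 * y : ℝ) ^ (2 - ε) :=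
            Real.rpow_le_rpow (by positivity) (by exact_mod_cast hLy) (by linarith)
        _ = 4 ^ (2 - ε) * (y : ℝ) ^ (2 - ε) := Real.mul_rpow (by norm_num) (by positivity)
        _ ≤ 4 ^ (2 : ℝ) * (y : ℝ) ^ (2 - ε) := by
            gcongr
            · norm_num
            · linarith
        _ = _ := by norm_num
    have hCL : C * (L : ℝ) ^ (2 - ε') ≤ |C| * (16 * (y : ℝ) ^ (2 - ε)) :=
      mul_le_mul (le_abs_self C) hLpow (by positivity) (abs_nonneg C)
    have hR' : ((3 * d + 3 * K + 22 + 2 * ((26 * K + (10 * d + 17) * D + 9) * 2 ^ K + 4 * L) : ℕ) : ℝ)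
        ≤ 164 * y := by exact_mod_cast hR
    calc _ ≤ (121 * 164 + 64 * |C| + 2) * (y : ℝ) ^ (2 - ε) := by linarith
      _ ≤ (121 * 164 + 64 * |C| + 2) * (4 * A ^ 2 * (2 - (2 - 2 ^ (1 - ε / 4))) ^ N) := by gcongr
      _ = _ := by ring
  · have h1 : V ^ 20 < 2 ^ w :=
      calc V ^ 20 ≤ (2 ^ (b * 12)) ^ 20 := Nat.pow_le_pow_left hV 20
        _ = 2 ^ (b * 12 * 20) := (pow_mul _ _ _).symm
        _ < 2 ^ w := Nat.pow_lt_pow_right one_lt_two (by omega)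
    exact_mod_cast h1
  · have h1 : 2 ^ wp + G.encode.length ≤ 2 ^ w :=
      -- The words of the LCIS program and the offset of its memory each take at most half of the
      -- available range.
      calc 2 ^ wp + G.encode.length ≤ 2 ^ (w - 1) + 2 ^ (w - 1) := by
            refine Nat.add_le_add (Nat.pow_le_pow_right two_pos (by omega))
              ((show G.encode.length ≤ V by omega).trans
                (hV.trans (Nat.pow_le_pow_right two_pos (by omega))))
        _ = 2 ^ w := by rw [← two_mul, ← pow_succ']; congr 1; omega
    exact_mod_cast h1
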